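/- Let $\lambda>0$, let $A(x)=\sqrt{\lambda}\,\mathrm{Ai}(x)$ with $\mathrm{Ai}$ the Airy function, and let $$K(x,y)=\frac{A(x)A'(y)-A'(x)A(y)}{x-y}\quad(x\ne y),\qquad K(x,x)=A'(x)^2-xA(x)^2 .$$ For $s\in\mathbb{R}$ let $K=K_s$ also denote the integral operator with this kernel on $L^2(J)$, $J=(s,\infty)$. When $I-K_s$ is invertible, let $(I-K_s)^{-1}g$, for a continuous $g\in L^2(J)$ defined on $\mathbb{R}$, be evaluated pointwise through its continuous representative $x\mapsto g(x)+\int_s^\infty K(x,y)\,\big((I-K_s)^{-1}g\big)(y)\,dy$, and put $$q(s)=q(s;\lambda)=\big((I-K_s)^{-1}A\big)(s),\qquad R(x,y)=\big((I-K_s)^{-1}K(\cdot,y)\big)(x),\qquad R(s)=R(s,s).$$ Let $\det(I-K_s)=\sum_{n\ge0}\frac{(-1)^n}{n!}\int_{J^n}\det\big(K(x_i,x_j)\big)_{i,j\le n}\,dx_1\cdots dx_n$ be the Fredholm determinant. Then: (1) $I-K_s$ is invertible for all sufficiently large $s$, and, if $\lambda\le 1$, for every $s\in\mathbb{R}$.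 (2) $q(s;\lambda)\sim\sqrt{\lambda}\,\mathrm{Ai}(s)$ as $s\to\infty$. (3) For every $s\in\mathbb{R}$ such that $I-K_x$ is invertible for all $x\ge s$ (so for every $s$ when $\lambda\le1$): $R(x,y)$ is continuous on $[s,\infty)^2$ and is the kernel of the operator $K_s(I-K_s)^{-1}$ on $L^2(J)$; $q$ is $C^2$ and $R$ is $C^3$ near $s$; and * $q''(s)=s\,q(s)+2q(s)^3$; * $R'(s)=-q(s)^2$; * if $R'(s)\ne0$, then $\dfrac12\left(\dfrac{R''}{R'}\right)'(s)-\dfrac{R(s)}{R'(s)}+R'(s)=0$; * $\displaystyle\int_s^\infty (x-s)\,q(x;\lambda)^2\,dx$ converges and $\displaystyle\det(I-K_s)=\exp\left(-\int_s^\infty (x-s)\,q(x;\lambda)^2\,dx\right)$. -/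

import Mathlib

open Real Set Filter Topology MeasureTheory Asymptotics
open scoped Nat

noncomputable section

/-- The Airy function `Ai`, by its absolutely convergent Laplace contour integral
`Ai(x) = (2πi)⁻¹ ∫_{Re w = 1} exp(w³/3 - x w) dw`, parametrised by `w = 1 + i t`. -/
def airyAi (x : ℝ) : ℝ :=
  (2 * π)⁻¹ * ∫ t : ℝ, (Complex.exp ((1 + t * Complex.I) ^ 3 / 3 - x * (1 + t * Complex.I))).re

/-- The function `A(x) = √lam Ai(x)`. -/
def airyA (lam x : ℝ) : ℝ := √lam * airyAi x

/-- The Airy kernel `(A(x) A'(y) - A'(x) A(y)) / (x - y)` with `A = √lam Ai`. On the diagonal it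
has the value of its continuous extension, `A'(x)² - x A(x)²`. -/
def airyKernel (lam x y : ℝ) : ℝ :=
  if x = y then deriv (airyA lam) x ^ 2 - x * airyA lam x ^ 2
  else (airyA lam x * deriv (airyA lam) y - deriv (airyA lam) x * airyA lam y) / (x - y)

/-- The real Hilbert space `L²(J)`, for `J = (s, ∞)` with Lebesgue measure. -/
abbrev L2Ray (s : ℝ) : Type := Lp ℝ 2 (volume.restrict (Ioi s))

open Classical in
/-- The class in `L²(s, ∞)` of a square integrable function (`0` for any other function). -/
def toL2Ray (s : ℝ) (g : ℝ → ℝ) : L2Ray s :=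
  if h : MemLp g 2 (volume.restrict (Ioi s)) then h.toLp g else 0

open Classical in
/-- The bounded operator `f ↦ ∫_s^∞ k(·, y) f(y) dy` on `L²(s, ∞)` (`0` if the kernel `k` does not
define a bounded operator). An operator with this property is unique. -/
def integralOp (s : ℝ) (k : ℝ → ℝ → ℝ) : L2Ray s →L[ℝ] L2Ray s :=
  if h : ∃ T : L2Ray s →L[ℝ] L2Ray s, ∀ f : L2Ray s,
      T f =ᵐ[volume.restrict (Ioi s)] fun x => ∫ y in Ioi s, k x y * f y
  then h.choose else 0

/-- The Airy operator `K` on `L²(s, ∞)`. -/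
def airyOp (lam s : ℝ) : L2Ray s →L[ℝ] L2Ray s := integralOp s (airyKernel lam)

/-- `(I - K)⁻¹` on `L²(s, ∞)` (`0` if `I - K` is not invertible). -/
def airyResolvent (lam s : ℝ) : L2Ray s →L[ℝ] L2Ray s := Ring.inverse (1 - airyOp lam s)

/-- The function `(I - K)⁻¹ g`, with its value at every point: if `f` is the class of
`(I - K)⁻¹ g` in `L²(s, ∞)`, then `f = g + K f`, and the right-hand side
`g(x) + ∫_s^∞ K(x, y) f(y) dy` is its representative, which is continuous when `g` is. -/
def resolventApply (lam s : ℝ) (g : ℝ → ℝ) (x : ℝ) : ℝ :=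
  g x + ∫ y in Ioi s, airyKernel lam x y * airyResolvent lam s (toL2Ray s g) y

/-- `q(s; lam) = ((I - K)⁻¹ A)(s)`. -/
def airyQ (lam s : ℝ) : ℝ := resolventApply lam s (airyA lam) s

/-- The resolvent kernel `R(x, y) = ((I - K)⁻¹ K(·, y))(x)`. -/
def resolventKernel (lam s x y : ℝ) : ℝ := resolventApply lam s (fun z => airyKernel lam z y) x

/-- `R(s) = R(s, s)`. -/
def airyR (lam s : ℝ) : ℝ := resolventKernel lam s s s

/-- The Fredholm determinant `det(I - k)` on `(s, ∞)`, by the Fredholm series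
`∑ₙ (-1)ⁿ / n! ∫_{(s, ∞)ⁿ} det (k(xᵢ, xⱼ)) dx₁ ⋯ dxₙ`. -/
def fredholmDet (s : ℝ) (k : ℝ → ℝ → ℝ) : ℝ :=
  ∑' n : ℕ, (-1) ^ n / (n ! : ℝ) *
    ∫ x : Fin n → ℝ, Matrix.det (Matrix.of fun i j : Fin n => k (x i) (x j))
      ∂(Measure.pi fun _ => volume.restrict (Ioi s))

end

/-!
The Airy operator is the square of a Hankel operator, `K_s = H_s²`, where `H_s` has the kernel
`A(s + x + y)` on `L²(0, ∞)` after a translation of `(s, ∞)`. All objects are moved to this fixed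
Hilbert space. With `α_n(s)` the class of `A⁽ⁿ⁾(s + ·)`, the kernel is the Gram kernel
`K(x, y) = ⟨α_0(x), α_0(y)⟩` (`inner_airyVec_airyVec`), and `K_s` is the integral over `t > s` of
the rank-one operators `α_0(t) ⊗ α_0(t)` (`airyShiftOp_eq_integral`). Hence `K_s` is differentiable
in `s` with a derivative of rank one, and the resolvent `ρ` as well.

*Differential equations.* Put `Q = ρ α_0` and `P = ρ H α_0 = H Q`. Then `q = A + ⟨α_0, P⟩`, and
`R(s, s)` equals `u = ⟨α_0, Q⟩` because `K = H²` (`scalarR_eq_scalarU`). Differentiation through the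
resolvent gives `R' = -q²`, and comparison with the derivative of `u` gives the first integral
`2 v = u² - q²` with `v = ⟨α_1, Q⟩` (`two_mul_scalarV`). The Airy equation enters through the
commutator of `K` with the multiplication by `x`, which has rank two since
`(x - y) K(x, y) = A(x) A'(y) - A'(x) A(y)` (`airyMPvec_eq`). Together these give
`q'' = s q + 2 q³` (`hasDerivAt_deriv_scalarQ`). The difference of `R` and `q'² - s q² - q⁴` has
derivative zero and tends to zero at infinity, so that it vanishes (`scalarR_eq_hamiltonian`); the
third-order equation for `R` is a consequence.

*Invertibility.* For large `s` the norm of `H_s` is small. For `lam ≤ 1`, moving the contour of the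
Airy integral to the imaginary axis and Plancherel's identity show that
`∫_{t > x} ⟨α_0(t), f⟩² dt ≤ lam ‖f‖²` for every `x` (`setIntegral_inner_airyVec_sq_le`). If
`K_s f = f`, the left-hand side equals `‖f‖²` already for `x = s`, so `⟨α_0(t), f⟩ = 0` for `t < s`.
This function of `t` is the restriction of an entire function, hence it vanishes for all `t`, and
`f = 0`. As `K_s` is compact, the Fredholm alternative applies.

*Behaviour at infinity.* For large `s` one has `|q - A| ≤ 2 ‖H_s‖ ‖α_0(s)‖²`. The modulus of `A` is
decreasing on `(0, ∞)`, so `‖α_0(s)‖²` is at most a constant times `|A(s)|`, whereas `‖H_s‖` tends to zero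
(`isEquivalent_scalarQ`).

*The determinant.* Hadamard's inequality gives the convergence of the Fredholm series `D(s)` and of
the series of bordered determinants `E(s)`, a vector in `L²(0, ∞)`. Expanding the bordered
determinants along their first column gives `E - K E = D α_0`, that is `E = D Q`
(`tsum_fredholmVec`). The derivative of `D` is `⟨α_0, E⟩`, because the kernel has the derivative
`-A(s + x) A(s + y)`; so `D' = D u = D R` (`hasDerivAt_fredholmSeries`). Since `D` tends to `1`,
it is the exponential of `-∫_s^∞ R`, and an integration by parts with `R' = -q²` gives
`∫_s^∞ R = ∫_s^∞ (x - s) q²`.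
-/

noncomputable section

/-! ### The Airy function -/

/-- The moments `∫ wⁿ exp(w³/3 - z w) dt` along the contour `w = 1 + i t`. Up to the factor
`(-1)ⁿ / (2π)` this is the `n`-th derivative of the entire Airy function. -/
def airyMoment (n : ℕ) (z : ℂ) : ℂ :=
  ∫ t : ℝ, (1 + t * Complex.I) ^ n *
    Complex.exp ((1 + t * Complex.I) ^ 3 / 3 - z * (1 + t * Complex.I))

theorem norm_cexp_cube_sub (c t : ℝ) (z : ℂ) :
    ‖Complex.exp ((c + t * Complex.I) ^ 3 / 3 - z * (c + t * Complex.I))‖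
      = Real.exp (c ^ 3 / 3 - c * t ^ 2 - z.re * c + z.im * t) := by
  rw [Complex.norm_exp]
  congr 1
  have : ((c + t * Complex.I) ^ 3 / 3 : ℂ)
      = ((c ^ 3 / 3 - c * t ^ 2 : ℝ) : ℂ) + ((c ^ 2 * t - t ^ 3 / 3 : ℝ) : ℂ) * Complex.I := by
    push_cast
    linear_combination (c * t ^ 2 + t ^ 3 * Complex.I / 3) * Complex.I_sq
  rw [this]
  simp only [Complex.sub_re, Complex.add_re, Complex.ofReal_re, Complex.mul_re, Complex.ofReal_im,
    Complex.add_im, Complex.mul_im, Complex.I_re, Complex.I_im]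
  ring

theorem norm_one_add_mul_I_le (t : ℝ) : ‖(1 + t * Complex.I : ℂ)‖ ≤ 1 + |t| := by
  refine (norm_add_le _ _).trans ?_
  simp

/-- A Gaussian majorant for the integrands of `airyMoment n`, uniform for `z` in a ball. -/
theorem norm_airyMoment_integrand_le (n : ℕ) (B t : ℝ) (z : ℂ) (hz : ‖z‖ ≤ B) :
    ‖(1 + t * Complex.I : ℂ) ^ n *
      Complex.exp ((1 + t * Complex.I) ^ 3 / 3 - z * (1 + t * Complex.I))‖
      ≤ n ! * Real.exp (4 / 3 + B + (B + 1) ^ 2 / 2) * Real.exp (-(1 / 2) * t ^ 2) := by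
  have h1 := norm_cexp_cube_sub 1 t z
  push_cast at h1
  rw [norm_mul, norm_pow, h1]
  have h2 : ‖(1 + t * Complex.I : ℂ)‖ ^ n ≤ n ! * Real.exp (1 + |t|) := by
    have h3 : (1 + |t|) ^ n / n ! ≤ Real.exp (1 + |t|) :=
      Real.pow_div_factorial_le_exp _ (by positivity) n
    rw [div_le_iff₀ (by positivity)] at h3
    calc _ ≤ (1 + |t|) ^ n := by gcongr; exact norm_one_add_mul_I_le t
      _ ≤ _ := by linarith
  have hre : -B ≤ z.re := by
    have := Complex.abs_re_le_norm z
    have := abs_le.1 this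
    linarith [this.1]
  have him : z.im * t ≤ B * |t| := by
    calc z.im * t ≤ |z.im * t| := le_abs_self _
      _ = |z.im| * |t| := abs_mul _ _
      _ ≤ B * |t| := by gcongr; exact (Complex.abs_im_le_norm z).trans hz
  calc _ ≤ (n ! * Real.exp (1 + |t|)) * Real.exp (1 / 3 - t ^ 2 + B + B * |t|) := by
        gcongr
        linarith
    _ = n ! * Real.exp (1 + |t| + (1 / 3 - t ^ 2 + B + B * |t|)) := by
        rw [Real.exp_add (1 + |t|)]; ring
    _ ≤ n ! * Real.exp ((4 / 3 + B + (B + 1) ^ 2 / 2) + (-(1 / 2) * t ^ 2)) := by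
        refine mul_le_mul_of_nonneg_left (Real.exp_le_exp.2 ?_) (by positivity)
        nlinarith [sq_nonneg (|t| - (B + 1)), sq_abs t]
    _ = _ := by rw [Real.exp_add]; ring

theorem integrable_gaussian_half (C : ℝ) :
    Integrable (fun t : ℝ => C * Real.exp (-(1 / 2) * t ^ 2)) :=
  (integrable_exp_neg_mul_sq (by norm_num)).const_mul C

theorem continuous_airyMoment_integrand (n : ℕ) (z : ℂ) :
    Continuous fun t : ℝ => (1 + t * Complex.I : ℂ) ^ n *
      Complex.exp ((1 + t * Complex.I) ^ 3 / 3 - z * (1 + t * Complex.I)) := by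
  fun_prop

theorem integrable_airyMoment_integrand (n : ℕ) (z : ℂ) :
    Integrable fun t : ℝ => (1 + t * Complex.I : ℂ) ^ n *
      Complex.exp ((1 + t * Complex.I) ^ 3 / 3 - z * (1 + t * Complex.I)) :=
  (integrable_gaussian_half _).mono' (continuous_airyMoment_integrand n z).aestronglyMeasurable
    (.of_forall fun t => norm_airyMoment_integrand_le n ‖z‖ t z le_rfl)

theorem hasDerivAt_airyMoment (n : ℕ) (z : ℂ) :
    HasDerivAt (airyMoment n) (-airyMoment (n + 1) z) z := by
  unfold airyMoment
  rw [← integral_neg]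
  refine (hasDerivAt_integral_of_dominated_loc_of_deriv_le (𝕜 := ℂ) (E := ℂ)
    (F' := fun w t => -((1 + t * Complex.I : ℂ) ^ (n + 1) *
      Complex.exp ((1 + t * Complex.I) ^ 3 / 3 - w * (1 + t * Complex.I))))
    (s := Metric.ball z 1)
    (bound := fun t => (n + 1)! * Real.exp (4 / 3 + (‖z‖ + 1) + ((‖z‖ + 1) + 1) ^ 2 / 2)
      * Real.exp (-(1 / 2) * t ^ 2)) (Metric.ball_mem_nhds z one_pos) ?_ ?_ ?_ ?_ ?_ ?_).2
  · exact .of_forall fun y => (continuous_airyMoment_integrand n y).aestronglyMeasurable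
  · exact integrable_airyMoment_integrand n z
  · exact (continuous_airyMoment_integrand (n + 1) z).neg.aestronglyMeasurable
  · refine .of_forall fun t y hy => ?_
    rw [norm_neg]
    apply norm_airyMoment_integrand_le
    have : ‖y - z‖ < 1 := by simpa [dist_eq_norm] using hy
    calc ‖y‖ = ‖z + (y - z)‖ := by ring_nf
      _ ≤ _ := (norm_add_le _ _).trans (by linarith)
  · exact integrable_gaussian_half _
  · refine .of_forall fun t y hy => ?_
    have h := (((hasDerivAt_id y).mul_const (1 + t * Complex.I : ℂ)).const_sub
      ((1 + t * Complex.I : ℂ) ^ 3 / 3)).cexp.const_mul ((1 + t * Complex.I : ℂ) ^ n)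
    refine h.congr_deriv ?_
    simp only [id]
    ring

/-- The Airy equation, as the vanishing of the integral of a total derivative. -/
theorem airyMoment_two (z : ℂ) : airyMoment 2 z = z * airyMoment 0 z := by
  have hd : ∀ t : ℝ, HasDerivAt (fun t : ℝ =>
      Complex.exp ((1 + t * Complex.I) ^ 3 / 3 - z * (1 + t * Complex.I)))
      (Complex.I * ((1 + t * Complex.I : ℂ) ^ 2 *
        Complex.exp ((1 + t * Complex.I) ^ 3 / 3 - z * (1 + t * Complex.I))
       - z * ((1 + t * Complex.I : ℂ) ^ 0 *
        Complex.exp ((1 + t * Complex.I) ^ 3 / 3 - z * (1 + t * Complex.I))))) t := by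
    intro t
    have h0 : HasDerivAt (fun t : ℝ => (1 + t * Complex.I : ℂ)) Complex.I t := by
      simpa using ((Complex.ofRealCLM.hasDerivAt (x := t)).mul_const Complex.I).const_add 1
    have h := (((h0.fun_pow 3).div_const 3).fun_sub (h0.const_mul z)).cexp
    convert h using 1
    push_cast
    ring
  have h0 := integral_eq_zero_of_hasDerivAt_of_integrable hd
    (((integrable_airyMoment_integrand 2 z).sub
      ((integrable_airyMoment_integrand 0 z).const_mul z)).const_mul Complex.I)
    (by simpa using integrable_airyMoment_integrand 0 z)
  rw [integral_const_mul, integral_sub (integrable_airyMoment_integrand 2 z)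
      ((integrable_airyMoment_integrand 0 z).const_mul z), integral_const_mul] at h0
  have := (mul_eq_zero.1 h0).resolve_left Complex.I_ne_zero
  exact sub_eq_zero.1 this

theorem conj_airyMoment (n : ℕ) (x : ℝ) :
    (starRingEnd ℂ) (airyMoment n x) = airyMoment n x := by
  unfold airyMoment
  rw [← integral_conj, ← integral_neg_eq_self]
  congr 1
  ext t
  simp only [map_mul, map_pow, map_add, map_one, Complex.conj_ofReal, Complex.conj_I,
    ← Complex.exp_conj, map_sub, map_div₀]
  have h3 : (starRingEnd ℂ) 3 = 3 := Complex.conj_ofNat 3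
  rw [h3]
  push_cast
  ring_nf

theorem ofReal_re_airyMoment (n : ℕ) (x : ℝ) : ((airyMoment n x).re : ℂ) = airyMoment n x :=
  Complex.conj_eq_iff_re.1 (conj_airyMoment n x)

theorem exists_norm_airyMoment_le (n : ℕ) :
    ∃ C : ℝ, 0 < C ∧ ∀ x : ℝ, ‖airyMoment n x‖ ≤ C * Real.exp (-x) := by
  refine ⟨‖airyMoment n 0‖ + 1 + ∫ t : ℝ, ‖(1 + t * Complex.I : ℂ) ^ n *
      Complex.exp ((1 + t * Complex.I) ^ 3 / 3 - 0 * (1 + t * Complex.I))‖, by positivity,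
    fun x => ?_⟩
  refine (norm_integral_le_integral_norm _).trans ?_
  have : ∀ t : ℝ, ‖(1 + t * Complex.I : ℂ) ^ n *
      Complex.exp ((1 + t * Complex.I) ^ 3 / 3 - x * (1 + t * Complex.I))‖ =
      ‖(1 + t * Complex.I : ℂ) ^ n *
      Complex.exp ((1 + t * Complex.I) ^ 3 / 3 - 0 * (1 + t * Complex.I))‖ * Real.exp (-x) := by
    intro t
    have h1 := norm_cexp_cube_sub 1 t x
    have h2 := norm_cexp_cube_sub 1 t 0
    push_cast at h1 h2
    rw [norm_mul, norm_mul, h1, h2, mul_assoc, ← Real.exp_add]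
    simp
    left
    ring
  simp_rw [this]
  rw [integral_mul_const]
  gcongr
  have := norm_nonneg (airyMoment n 0)
  linarith

theorem airyAi_eq_airyMoment (x : ℝ) : (airyAi x : ℂ) = (2 * π : ℂ)⁻¹ * airyMoment 0 x := by
  rw [← ofReal_re_airyMoment]
  have h := integrable_airyMoment_integrand 0 x
  simp only [pow_zero, one_mul] at h
  have : ∫ t : ℝ, (Complex.exp ((1 + t * Complex.I) ^ 3 / 3 - x * (1 + t * Complex.I))).re
      = (∫ t : ℝ, Complex.exp ((1 + t * Complex.I) ^ 3 / 3 - x * (1 + t * Complex.I))).re :=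
    integral_re h
  unfold airyAi airyMoment
  simp only [pow_zero, one_mul]
  rw [this]
  push_cast
  rfl

/-- The `n`-th derivative of `A = √lam Ai`. -/
def airyD (lam : ℝ) (n : ℕ) (x : ℝ) : ℝ :=
  √lam * ((2 * π)⁻¹ * ((-1) ^ n * (airyMoment n x).re))

theorem airyD_zero (lam : ℝ) : airyD lam 0 = airyA lam := by
  ext x
  have := congrArg Complex.re (airyAi_eq_airyMoment x)
  rw [← ofReal_re_airyMoment] at this
  norm_cast at this
  rw [airyD, airyA, this]
  simp

theorem hasDerivAt_airyD (lam : ℝ) (n : ℕ) (x : ℝ) :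
    HasDerivAt (airyD lam n) (airyD lam (n + 1) x) x := by
  have h := (hasDerivAt_airyMoment n (x : ℂ)).real_of_complex
  have := ((h.const_mul ((-1) ^ n)).const_mul (2 * π)⁻¹).const_mul √lam
  refine this.congr_deriv ?_
  simp [airyD, pow_succ]

theorem hasDerivAt_airyA (lam x : ℝ) : HasDerivAt (airyA lam) (airyD lam 1 x) x := by
  simpa [airyD_zero] using hasDerivAt_airyD lam 0 x

theorem deriv_airyA (lam : ℝ) : deriv (airyA lam) = airyD lam 1 :=
  funext fun x => (hasDerivAt_airyA lam x).deriv

theorem continuous_airyD (lam : ℝ) (n : ℕ) : Continuous (airyD lam n) :=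
  continuous_iff_continuousAt.2 fun x => (hasDerivAt_airyD lam n x).continuousAt

theorem airyD_two (lam x : ℝ) : airyD lam 2 x = x * airyD lam 0 x := by
  simp [airyD, airyMoment_two]
  ring

theorem exists_abs_airyD_le (lam : ℝ) (n : ℕ) :
    ∃ C : ℝ, 0 < C ∧ ∀ x : ℝ, |airyD lam n x| ≤ C * Real.exp (-x) := by
  obtain ⟨C, hC, h⟩ := exists_norm_airyMoment_le n
  refine ⟨(√lam + 1) * ((2 * π)⁻¹ * C), by positivity, fun x => ?_⟩
  rw [airyD, abs_mul, abs_mul, abs_mul, abs_pow]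
  simp only [abs_neg, abs_one, one_pow, one_mul]
  rw [abs_of_nonneg (Real.sqrt_nonneg _), abs_of_pos (by positivity : 0 < (2 * π)⁻¹), mul_assoc,
    mul_assoc]
  gcongr
  · linarith
  · exact (Complex.abs_re_le_norm _).trans (h x)

/-! ### Translates of the Airy function in `L²` -/

theorem toL2Ray_coeFn {s : ℝ} {g : ℝ → ℝ} (h : MemLp g 2 (volume.restrict (Ioi s))) :
    toL2Ray s g =ᵐ[volume.restrict (Ioi s)] g := by
  rw [toL2Ray, dif_pos h]
  exact h.coeFn_toLp

theorem L2Ray.inner_eq {s : ℝ} (f g : L2Ray s) : inner ℝ f g = ∫ x in Ioi s, f x * g x := by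
  rw [L2.inner_def]
  congr 1
  ext x
  simp [mul_comm]

theorem inner_toL2Ray {s : ℝ} {g : ℝ → ℝ} (h : MemLp g 2 (volume.restrict (Ioi s)))
    (f : L2Ray s) : inner ℝ (toL2Ray s g) f = ∫ x in Ioi s, g x * f x := by
  rw [L2Ray.inner_eq]
  refine integral_congr_ae ?_
  filter_upwards [toL2Ray_coeFn h] with x hx
  rw [hx]

theorem inner_toL2Ray_toL2Ray {s : ℝ} {f g : ℝ → ℝ} (hf : MemLp f 2 (volume.restrict (Ioi s)))
    (hg : MemLp g 2 (volume.restrict (Ioi s))) :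
    inner ℝ (toL2Ray s f) (toL2Ray s g) = ∫ x in Ioi s, f x * g x := by
  rw [inner_toL2Ray hf]
  refine integral_congr_ae ?_
  filter_upwards [toL2Ray_coeFn hg] with x hx
  rw [hx]

theorem L2Ray.integrable_mul {s : ℝ} {f g : ℝ → ℝ} (hf : MemLp f 2 (volume.restrict (Ioi s)))
    (hg : MemLp g 2 (volume.restrict (Ioi s))) :
    Integrable (fun x => f x * g x) (volume.restrict (Ioi s)) :=
  hf.integrable_mul hg

theorem memLp_exp_neg : MemLp (fun x => Real.exp (-x)) 2 (volume.restrict (Ioi 0)) := by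
  rw [memLp_two_iff_integrable_sq (by fun_prop)]
  have := exp_neg_integrableOn_Ioi 0 (b := 2) (by norm_num)
  refine this.congr (.of_forall fun x => ?_)
  simp only [← Real.exp_nat_mul]
  push_cast
  ring_nf

theorem memLp_of_abs_le_exp {f : ℝ → ℝ} {C : ℝ}
    (hm : AEStronglyMeasurable f (volume.restrict (Ioi 0)))
    (h : ∀ x, 0 < x → |f x| ≤ C * Real.exp (-x)) : MemLp f 2 (volume.restrict (Ioi 0)) := by
  refine (memLp_exp_neg.const_mul C).of_le hm ?_
  filter_upwards [ae_restrict_mem measurableSet_Ioi] with x hx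
  exact (h x hx).trans (le_abs_self _)

theorem norm_toL2Ray_le {f : ℝ → ℝ} {C : ℝ} (hC : 0 ≤ C)
    (hm : AEStronglyMeasurable f (volume.restrict (Ioi 0)))
    (h : ∀ x, 0 < x → |f x| ≤ C * Real.exp (-x)) : ‖toL2Ray 0 f‖ ≤ C := by
  have hf := memLp_of_abs_le_exp hm h
  refine abs_le_of_sq_le_sq' ?_ hC |>.2
  rw [← real_inner_self_eq_norm_sq, inner_toL2Ray_toL2Ray hf hf]
  have h2 := exp_neg_integrableOn_Ioi 0 (b := 2) (by norm_num)
  have h3 : ∫ x in Ioi (0 : ℝ), Real.exp (-2 * x) = 1 / 2 := by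
    rw [integral_exp_mul_Ioi (by norm_num)]
    norm_num
  calc ∫ x in Ioi (0 : ℝ), f x * f x ≤ ∫ x in Ioi (0 : ℝ), C ^ 2 * Real.exp (-2 * x) := by
        refine setIntegral_mono_on (L2Ray.integrable_mul hf hf) (h2.const_mul _)
          measurableSet_Ioi fun x hx => ?_
        have := h x hx
        have h4 : Real.exp (-2 * x) = Real.exp (-x) ^ 2 := by
          rw [← Real.exp_nat_mul]; push_cast; ring_nf
        rw [h4, ← mul_pow, ← sq, ← sq_abs]
        gcongr
    _ = C ^ 2 * (1 / 2) := by rw [integral_const_mul, h3]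
    _ ≤ C ^ 2 := by nlinarith [sq_nonneg C]

/-- The `n`-th derivative of the curve `s ↦ A(s + ·)` in `L²(0, ∞)`. -/
def airyVec (lam : ℝ) (n : ℕ) (s : ℝ) : L2Ray 0 := toL2Ray 0 fun x => airyD lam n (s + x)

theorem memLp_airyD (lam : ℝ) (n : ℕ) (s : ℝ) :
    MemLp (fun x => airyD lam n (s + x)) 2 (volume.restrict (Ioi 0)) := by
  obtain ⟨C, hC, h⟩ := exists_abs_airyD_le lam n
  refine memLp_of_abs_le_exp (C := C * Real.exp (-s))
    ((continuous_airyD lam n).comp (by fun_prop)).aestronglyMeasurable fun x _ => ?_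
  refine (h _).trans (le_of_eq ?_)
  rw [neg_add, Real.exp_add]
  ring

theorem airyVec_coeFn (lam : ℝ) (n : ℕ) (s : ℝ) :
    airyVec lam n s =ᵐ[volume.restrict (Ioi 0)] fun x => airyD lam n (s + x) :=
  toL2Ray_coeFn (memLp_airyD lam n s)

theorem inner_airyVec (lam : ℝ) (n : ℕ) (s : ℝ) (f : L2Ray 0) :
    inner ℝ (airyVec lam n s) f = ∫ x in Ioi (0 : ℝ), airyD lam n (s + x) * f x :=
  inner_toL2Ray (memLp_airyD lam n s) f

theorem exists_norm_airyVec_le (lam : ℝ) (n : ℕ) :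
    ∃ C : ℝ, 0 < C ∧ ∀ s, ‖airyVec lam n s‖ ≤ C * Real.exp (-s) := by
  obtain ⟨C, hC, h⟩ := exists_abs_airyD_le lam n
  refine ⟨C, hC, fun s => norm_toL2Ray_le (by positivity)
    ((continuous_airyD lam n).comp (by fun_prop)).aestronglyMeasurable fun x _ => ?_⟩
  refine (h _).trans (le_of_eq ?_)
  rw [neg_add, Real.exp_add]
  ring

theorem exists_abs_airyD_taylor_le (lam : ℝ) (n : ℕ) :
    ∃ C : ℝ, 0 < C ∧ ∀ t h : ℝ, |h| ≤ 1 →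
      |airyD lam n (t + h) - airyD lam n t - h * airyD lam (n + 1) t|
        ≤ C * Real.exp (-t) * h ^ 2 := by
  obtain ⟨C, hC, hb⟩ := exists_abs_airyD_le lam (n + 2)
  refine ⟨C * Real.exp 1, by positivity, fun t h hh => ?_⟩
  have hconv : Convex ℝ (Metric.closedBall (0 : ℝ) |h|) := convex_closedBall _ _
  have h0 : (0 : ℝ) ∈ Metric.closedBall (0 : ℝ) |h| := by simp
  have h1 : h ∈ Metric.closedBall (0 : ℝ) |h| := by simp
  have hmem : ∀ x ∈ Metric.closedBall (0 : ℝ) |h|, |x| ≤ |h| := fun x hx => by simpa using hx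
  have hshift : ∀ m x, HasDerivAt (fun x => airyD lam m (t + x)) (airyD lam (m + 1) (t + x)) x :=
    fun m x => (hasDerivAt_airyD lam m (t + x)).comp_const_add t x
  have key1 : ∀ x ∈ Metric.closedBall (0 : ℝ) |h|,
      ‖airyD lam (n + 1) (t + x) - airyD lam (n + 1) (t + 0)‖
        ≤ C * Real.exp 1 * Real.exp (-t) * ‖x - 0‖ := by
    intro x hx
    refine Convex.norm_image_sub_le_of_norm_hasDerivWithin_le
      (f := fun x => airyD lam (n + 1) (t + x))
      (fun y _ => (hshift (n + 1) y).hasDerivWithinAt) (fun y hy => ?_) hconv h0 hx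
    refine (hb _).trans ?_
    rw [mul_assoc, ← Real.exp_add]
    gcongr
    have := abs_le.1 ((hmem y hy).trans hh)
    linarith [this.1]
  have key2 := Convex.norm_image_sub_le_of_norm_hasDerivWithin_le
      (f := fun x => airyD lam n (t + x) - x * airyD lam (n + 1) t)
      (f' := fun x => airyD lam (n + 1) (t + x) - 1 * airyD lam (n + 1) t)
      (C := C * Real.exp 1 * Real.exp (-t) * |h|)
      (fun y _ => ((hshift n y).sub ((hasDerivAt_id y).mul_const _)).hasDerivWithinAt)
      (fun y hy => ?_) hconv h0 h1
  · have e : airyD lam n (t + h) - h * airyD lam (n + 1) t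
        - (airyD lam n (t + 0) - 0 * airyD lam (n + 1) t)
        = airyD lam n (t + h) - airyD lam n t - h * airyD lam (n + 1) t := by simp; ring
    rw [e] at key2
    refine key2.trans (le_of_eq ?_)
    rw [sub_zero, Real.norm_eq_abs, ← sq_abs h]
    ring
  · have := key1 y hy
    rw [add_zero, sub_zero, Real.norm_eq_abs y] at this
    rw [one_mul]
    exact this.trans (mul_le_mul_of_nonneg_left (hmem y hy) (by positivity))

theorem hasDerivAt_airyVec (lam : ℝ) (n : ℕ) (s : ℝ) :
    HasDerivAt (airyVec lam n) (airyVec lam (n + 1) s) s := by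
  obtain ⟨C, hC, hb⟩ := exists_abs_airyD_taylor_le lam n
  rw [hasDerivAt_iff_isLittleO_nhds_zero]
  have hO : (fun h : ℝ => airyVec lam n (s + h) - airyVec lam n s - h • airyVec lam (n + 1) s)
      =O[𝓝 0] fun h => h ^ 2 := by
    refine IsBigO.of_bound (C * Real.exp (-s)) ?_
    filter_upwards [Metric.closedBall_mem_nhds (0 : ℝ) one_pos] with h hh
    have hh' : |h| ≤ 1 := by simpa using hh
    have heq : airyVec lam n (s + h) - airyVec lam n s - h • airyVec lam (n + 1) s
        = toL2Ray 0 fun x => airyD lam n (s + x + h) - airyD lam n (s + x)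
          - h * airyD lam (n + 1) (s + x) := by
      have hm : MemLp (fun x => airyD lam n (s + x + h) - airyD lam n (s + x)
          - h * airyD lam (n + 1) (s + x)) 2 (volume.restrict (Ioi 0)) := by
        have := (memLp_airyD lam n (s + h)).sub (memLp_airyD lam n s) |>.sub
          ((memLp_airyD lam (n + 1) s).const_mul h)
        refine this.congr_norm (by
          have := continuous_airyD lam n
          have := continuous_airyD lam (n + 1)
          exact Continuous.aestronglyMeasurable (by fun_prop)) (.of_forall fun x => ?_)
        simp [add_right_comm]
      apply Lp.ext
      filter_upwards [toL2Ray_coeFn hm, airyVec_coeFn lam n (s + h), airyVec_coeFn lam n s,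
        airyVec_coeFn lam (n + 1) s, Lp.coeFn_sub (airyVec lam n (s + h) - airyVec lam n s)
          (h • airyVec lam (n + 1) s), Lp.coeFn_sub (airyVec lam n (s + h)) (airyVec lam n s),
        Lp.coeFn_smul h (airyVec lam (n + 1) s)] with x h1 h2 h3 h4 h5 h6 h7
      rw [h1, h5, Pi.sub_apply, h6, Pi.sub_apply, h7, Pi.smul_apply, h2, h3, h4,
        add_right_comm s h x, smul_eq_mul]
    rw [heq, norm_pow, Real.norm_eq_abs, sq_abs]
    refine norm_toL2Ray_le (by positivity) (by
          have := continuous_airyD lam n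
          have := continuous_airyD lam (n + 1)
          exact Continuous.aestronglyMeasurable (by fun_prop)) fun x _ => ?_
    refine (hb _ h hh').trans (le_of_eq ?_)
    rw [neg_add, Real.exp_add]
    ring
  refine hO.trans_isLittleO ?_
  simpa using (isLittleO_pow_id (𝕜 := ℝ) (n := 2) (by norm_num))

theorem continuous_airyVec (lam : ℝ) (n : ℕ) : Continuous (airyVec lam n) :=
  continuous_iff_continuousAt.2 fun x => (hasDerivAt_airyVec lam n x).continuousAt

theorem tendsto_airyD_add_atTop (lam : ℝ) (n : ℕ) (s : ℝ) :
    Tendsto (fun x => airyD lam n (s + x)) atTop (𝓝 0) := by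
  obtain ⟨C, hC, h⟩ := exists_abs_airyD_le lam n
  have h1 : Tendsto (fun x : ℝ => C * Real.exp (-(s + x))) atTop (𝓝 (C * 0)) :=
    (Real.tendsto_exp_neg_atTop_nhds_zero.comp
      (tendsto_atTop_add_const_left _ s tendsto_id)).const_mul C
  rw [mul_zero] at h1
  exact squeeze_zero_norm (fun x => h _) h1

theorem tendsto_mul_airyD_sq_atTop (lam : ℝ) (s : ℝ) :
    Tendsto (fun x => (s + x) * airyD lam 0 (s + x) ^ 2) atTop (𝓝 0) := by
  have h := (tendsto_airyD_add_atTop lam 2 s).mul (tendsto_airyD_add_atTop lam 0 s)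
  rw [mul_zero] at h
  refine h.congr fun x => ?_
  rw [airyD_two]
  ring

/-- The Airy kernel is the Gram kernel `K(x, y) = ∫_0^∞ A(x + z) A(y + z) dz`. -/
theorem inner_airyVec_airyVec (lam x y : ℝ) :
    inner ℝ (airyVec lam 0 x) (airyVec lam 0 y) = airyKernel lam x y := by
  rw [airyVec, airyVec, inner_toL2Ray_toL2Ray (memLp_airyD lam 0 x) (memLp_airyD lam 0 y)]
  have hint := L2Ray.integrable_mul (memLp_airyD lam 0 x) (memLp_airyD lam 0 y)
  have hshift : ∀ m t z, HasDerivAt (fun z => airyD lam m (t + z)) (airyD lam (m + 1) (t + z)) z :=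
    fun m t z => (hasDerivAt_airyD lam m (t + z)).comp_const_add t z
  rw [airyKernel, deriv_airyA, ← airyD_zero]
  split_ifs with hxy
  · subst hxy
    have hd : ∀ z, HasDerivAt (fun z => (x + z) * airyD lam 0 (x + z) ^ 2
        - airyD lam 1 (x + z) ^ 2) (airyD lam 0 (x + z) * airyD lam 0 (x + z)) z := by
      intro z
      have h1 : HasDerivAt (fun z => x + z) 1 z := (hasDerivAt_id z).const_add x
      refine ((h1.mul ((hshift 0 x z).pow 2)).sub ((hshift 1 x z).pow 2)).congr_deriv ?_
      simp [airyD_two]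
      ring
    rw [integral_Ioi_of_hasDerivAt_of_tendsto (m := 0) (hd 0).continuousAt.continuousWithinAt
      (fun z _ => hd z) hint]
    · simp
    · have := (tendsto_mul_airyD_sq_atTop lam x).sub ((tendsto_airyD_add_atTop lam 1 x).pow 2)
      simpa using this
  · have hne : x - y ≠ 0 := sub_ne_zero.2 hxy
    have hd : ∀ z, HasDerivAt (fun z => (airyD lam 1 (x + z) * airyD lam 0 (y + z)
        - airyD lam 0 (x + z) * airyD lam 1 (y + z)) / (x - y))
        (airyD lam 0 (x + z) * airyD lam 0 (y + z)) z := by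
      intro z
      refine ((((hshift 1 x z).mul (hshift 0 y z)).sub
        ((hshift 0 x z).mul (hshift 1 y z))).div_const (x - y)).congr_deriv ?_
      rw [div_eq_iff hne]
      simp [airyD_two]
      ring
    rw [integral_Ioi_of_hasDerivAt_of_tendsto (m := 0) (hd 0).continuousAt.continuousWithinAt
      (fun z _ => hd z) hint]
    · simp
      ring
    · have := (((tendsto_airyD_add_atTop lam 1 x).mul (tendsto_airyD_add_atTop lam 0 y)).sub
        ((tendsto_airyD_add_atTop lam 0 x).mul (tendsto_airyD_add_atTop lam 1 y))).div_const (x - y)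
      simpa using this

/-! ### The Airy operator as the square of a Hankel operator -/

theorem exists_abs_inner_airyVec_le (lam : ℝ) (n : ℕ) :
    ∃ C : ℝ, 0 < C ∧ ∀ (s x : ℝ) (f : L2Ray 0),
      |inner ℝ (airyVec lam n (s + x)) f| ≤ C * Real.exp (-s) * ‖f‖ * Real.exp (-x) := by
  obtain ⟨C, hC, h⟩ := exists_norm_airyVec_le lam n
  refine ⟨C, hC, fun s x f => (abs_real_inner_le_norm _ _).trans ?_⟩
  calc _ ≤ (C * Real.exp (-(s + x))) * ‖f‖ := by gcongr; exact h _
    _ = _ := by rw [neg_add, Real.exp_add]; ring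

theorem continuous_inner_airyVec (lam : ℝ) (n : ℕ) (s : ℝ) (f : L2Ray 0) :
    Continuous fun x => inner ℝ (airyVec lam n (s + x)) f :=
  ((continuous_airyVec lam n).comp (by fun_prop)).inner continuous_const

theorem memLp_inner_airyVec (lam s : ℝ) (f : L2Ray 0) :
    MemLp (fun x => inner ℝ (airyVec lam 0 (s + x)) f) 2 (volume.restrict (Ioi 0)) := by
  obtain ⟨C, hC, h⟩ := exists_abs_inner_airyVec_le lam 0
  exact memLp_of_abs_le_exp (continuous_inner_airyVec lam 0 s f).aestronglyMeasurable
    fun x _ => h s x f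

/-- The Hankel operator on `L²(0, ∞)` with kernel `A(s + x + y)`. -/
def airyHankel (lam s : ℝ) : L2Ray 0 →L[ℝ] L2Ray 0 :=
  LinearMap.mkContinuousOfExistsBound
    { toFun := fun f => toL2Ray 0 fun x => inner ℝ (airyVec lam 0 (s + x)) f
      map_add' := fun f g => by
        apply Lp.ext
        filter_upwards [toL2Ray_coeFn (memLp_inner_airyVec lam s (f + g)),
          toL2Ray_coeFn (memLp_inner_airyVec lam s f), toL2Ray_coeFn (memLp_inner_airyVec lam s g),
          Lp.coeFn_add (toL2Ray 0 fun x => inner ℝ (airyVec lam 0 (s + x)) f)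
            (toL2Ray 0 fun x => inner ℝ (airyVec lam 0 (s + x)) g)] with x h1 h2 h3 h4
        rw [h1, h4, Pi.add_apply, h2, h3, inner_add_right]
      map_smul' := fun c f => by
        apply Lp.ext
        filter_upwards [toL2Ray_coeFn (memLp_inner_airyVec lam s (c • f)),
          toL2Ray_coeFn (memLp_inner_airyVec lam s f),
          Lp.coeFn_smul c (toL2Ray 0 fun x => inner ℝ (airyVec lam 0 (s + x)) f)] with x h1 h2 h3
        rw [h1, RingHom.id_apply, h3, Pi.smul_apply, h2, real_inner_smul_right, smul_eq_mul] }
    (by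
      obtain ⟨C, hC, h⟩ := exists_abs_inner_airyVec_le lam 0
      exact ⟨C * Real.exp (-s), fun f => norm_toL2Ray_le (by positivity)
        (continuous_inner_airyVec lam 0 s f).aestronglyMeasurable fun x _ => h s x f⟩)

theorem airyHankel_apply (lam s : ℝ) (f : L2Ray 0) :
    airyHankel lam s f = toL2Ray 0 fun x => inner ℝ (airyVec lam 0 (s + x)) f := rfl

theorem airyHankel_coeFn (lam s : ℝ) (f : L2Ray 0) :
    airyHankel lam s f =ᵐ[volume.restrict (Ioi 0)]
      fun x => inner ℝ (airyVec lam 0 (s + x)) f :=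
  toL2Ray_coeFn (memLp_inner_airyVec lam s f)

theorem exists_norm_airyHankel_le (lam : ℝ) :
    ∃ C : ℝ, 0 < C ∧ ∀ s, ‖airyHankel lam s‖ ≤ C * Real.exp (-s) := by
  obtain ⟨C, hC, h⟩ := exists_abs_inner_airyVec_le lam 0
  exact ⟨C, hC, fun s => ContinuousLinearMap.opNorm_le_bound _ (by positivity) fun f =>
    norm_toL2Ray_le (by positivity)
      (continuous_inner_airyVec lam 0 s f).aestronglyMeasurable fun x _ => h s x f⟩

theorem integrable_exp_neg_mul (f : L2Ray 0) :
    Integrable (fun x => Real.exp (-x) * f x) (volume.restrict (Ioi 0)) :=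
  L2Ray.integrable_mul memLp_exp_neg (Lp.memLp f)

theorem inner_airyHankel_left (lam s : ℝ) (f g : L2Ray 0) :
    inner ℝ (airyHankel lam s f) g = inner ℝ f (airyHankel lam s g) := by
  rw [real_inner_comm (airyHankel lam s g) f, airyHankel_apply, airyHankel_apply,
    inner_toL2Ray (memLp_inner_airyVec lam s f), inner_toL2Ray (memLp_inner_airyVec lam s g)]
  simp_rw [inner_airyVec, ← integral_mul_const]
  obtain ⟨C, hC, h⟩ := exists_abs_airyD_le lam 0
  rw [integral_integral_swap]
  · congr 1
    ext x
    congr 1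
    ext y
    rw [add_right_comm]
    ring
  · have hI := ((integrable_exp_neg_mul g).mul_prod (integrable_exp_neg_mul f)).norm.const_mul
      (C * Real.exp (-s))
    refine hI.mono' ?_ (.of_forall fun z => ?_)
    · have h1 : Continuous fun z : ℝ × ℝ => airyD lam 0 (s + z.1 + z.2) :=
        (continuous_airyD lam 0).comp (by fun_prop)
      exact (h1.aestronglyMeasurable.mul (Lp.aestronglyMeasurable f).comp_snd).mul
        (Lp.aestronglyMeasurable g).comp_fst
    · simp only [Function.uncurry, norm_mul, Real.norm_eq_abs, Real.abs_exp]
      have := h (s + z.1 + z.2)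
      rw [neg_add, neg_add, Real.exp_add, Real.exp_add] at this
      calc _ ≤ (C * (Real.exp (-s) * Real.exp (-z.1) * Real.exp (-z.2))) * |f z.2| * |g z.1| := by
            gcongr
        _ = _ := by ring

/-- The operator on `L²(0, ∞)` with kernel `K(s + x, s + y)`, as the square of a Hankel
operator. -/
def airyShiftOp (lam s : ℝ) : L2Ray 0 →L[ℝ] L2Ray 0 := airyHankel lam s * airyHankel lam s

theorem airyShiftOp_apply (lam s : ℝ) (f : L2Ray 0) :
    airyShiftOp lam s f = airyHankel lam s (airyHankel lam s f) := rfl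

theorem measurePreserving_shift (s : ℝ) :
    MeasurePreserving (fun x => s + x) (volume.restrict (Ioi (0 : ℝ)))
      (volume.restrict (Ioi s)) := by
  have := (measurePreserving_add_left (volume : Measure ℝ) s).restrict_preimage
    (measurableSet_Ioi (a := s))
  simpa using this

theorem setIntegral_Ioi_shift {E : Type*} [NormedAddCommGroup E] [NormedSpace ℝ E] (s : ℝ)
    (F : ℝ → E) : ∫ x in Ioi (0 : ℝ), F (s + x) = ∫ t in Ioi s, F t :=
  (measurePreserving_shift s).integral_comp (measurableEmbedding_addLeft s) F

theorem hasDerivAt_setIntegral_Ioi {E : Type*} [NormedAddCommGroup E] [NormedSpace ℝ E]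
    [CompleteSpace E] {F : ℝ → E} (hF : Continuous F) (hi : ∀ s, IntegrableOn F (Ioi s)) (s : ℝ) :
    HasDerivAt (fun s => ∫ t in Ioi s, F t) (-F s) s := by
  have h : (fun s => ∫ t in Ioi s, F t)
      = fun s => (∫ t in Ioi (0 : ℝ), F t) - ∫ t in (0 : ℝ)..s, F t := by
    ext s
    rw [intervalIntegral.integral_Ioi_sub_Ioi' (hi 0) (hi s) |>.symm]
    abel
  rw [h]
  exact (intervalIntegral.integral_hasDerivAt_right (hF.intervalIntegrable _ _)
    (hF.stronglyMeasurableAtFilter _ _) hF.continuousAt).const_sub _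

theorem integrableOn_Ioi_of_norm_le_exp {E : Type*} [NormedAddCommGroup E] {F : ℝ → E}
    (hF : Continuous F) {C b : ℝ} (hb : 0 < b) (h : ∀ t, ‖F t‖ ≤ C * Real.exp (-b * t)) (s : ℝ) :
    IntegrableOn F (Ioi s) :=
  ((exp_neg_integrableOn_Ioi s hb).const_mul C).mono' hF.aestronglyMeasurable (.of_forall h)

/-- The rank-one operator `f ↦ ⟨A(t + ·), f⟩ A(t + ·)` on `L²(0, ∞)`. -/
def airyRankOne (lam t : ℝ) : L2Ray 0 →L[ℝ] L2Ray 0 :=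
  InnerProductSpace.rankOne ℝ (airyVec lam 0 t) (airyVec lam 0 t)

theorem airyRankOne_apply (lam t : ℝ) (f : L2Ray 0) :
    airyRankOne lam t f = inner ℝ (airyVec lam 0 t) f • airyVec lam 0 t := rfl

theorem continuous_airyRankOne (lam : ℝ) : Continuous (airyRankOne lam) :=
  ((InnerProductSpace.rankOne ℝ).continuous.comp (continuous_airyVec lam 0)).clm_apply
    (continuous_airyVec lam 0)

theorem integrableOn_airyRankOne (lam s : ℝ) : IntegrableOn (airyRankOne lam) (Ioi s) := by
  obtain ⟨C, hC, h⟩ := exists_norm_airyVec_le lam 0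
  refine integrableOn_Ioi_of_norm_le_exp (continuous_airyRankOne lam) (C := C ^ 2) (b := 2)
    (by norm_num) (fun t => ?_) s
  rw [airyRankOne, InnerProductSpace.norm_rankOne]
  calc _ ≤ (C * Real.exp (-t)) * (C * Real.exp (-t)) := by gcongr <;> exact h t
    _ = C ^ 2 * (Real.exp (-t) * Real.exp (-t)) := by ring
    _ = _ := by rw [← Real.exp_add]; ring_nf

theorem inner_airyShiftOp_left (lam s : ℝ) (f g : L2Ray 0) :
    inner ℝ (airyShiftOp lam s f) g
      = ∫ t in Ioi s, inner ℝ (airyVec lam 0 t) f * inner ℝ (airyVec lam 0 t) g := by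
  rw [airyShiftOp_apply, inner_airyHankel_left, airyHankel_apply, airyHankel_apply,
    inner_toL2Ray_toL2Ray (memLp_inner_airyVec lam s f) (memLp_inner_airyVec lam s g)]
  exact setIntegral_Ioi_shift s
    fun t => inner ℝ (airyVec lam 0 t) f * inner ℝ (airyVec lam 0 t) g

/-- The Airy operator is a superposition of rank-one operators; hence its derivative in the
endpoint `s` has rank one. -/
theorem airyShiftOp_eq_integral (lam s : ℝ) :
    airyShiftOp lam s = ∫ t in Ioi s, airyRankOne lam t := by
  ext1 f
  refine ext_inner_right ℝ fun g => ?_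
  rw [inner_airyShiftOp_left, ContinuousLinearMap.integral_apply (integrableOn_airyRankOne lam s),
    real_inner_comm,
    ← integral_inner ((integrableOn_airyRankOne lam s).apply_continuousLinearMap f)]
  congr 1
  ext t
  rw [airyRankOne_apply, real_inner_smul_right, real_inner_comm g]

theorem hasDerivAt_airyShiftOp (lam s : ℝ) :
    HasDerivAt (airyShiftOp lam) (-airyRankOne lam s) s := by
  rw [funext (airyShiftOp_eq_integral lam)]
  exact hasDerivAt_setIntegral_Ioi (continuous_airyRankOne lam) (integrableOn_airyRankOne lam) s

/-- The class of `x ↦ K(s + x, s)` in `L²(0, ∞)`. -/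
def airyKernelVec (lam s : ℝ) : L2Ray 0 := airyHankel lam s (airyVec lam 0 s)

/-- The function `K(·, s)` as a superposition of translates of `A`, together with the integrability
on every ray that makes the integral meaningful. -/
theorem airyKernelVec_eq_integral (lam s : ℝ) :
    airyKernelVec lam s = ∫ t in Ioi s, airyD lam 0 t • airyVec lam 0 t ∧
      ∀ s, IntegrableOn (fun t => airyD lam 0 t • airyVec lam 0 t) (Ioi s) := by
  obtain ⟨C, hC, h⟩ := exists_norm_airyVec_le lam 0
  obtain ⟨C', hC', h'⟩ := exists_abs_airyD_le lam 0
  have hint : ∀ s, IntegrableOn (fun t => airyD lam 0 t • airyVec lam 0 t) (Ioi s) := by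
    refine integrableOn_Ioi_of_norm_le_exp
      ((continuous_airyD lam 0).smul (continuous_airyVec lam 0)) (C := C' * C) (b := 2)
      (by norm_num) (fun t => ?_)
    rw [norm_smul]
    calc _ ≤ (C' * Real.exp (-t)) * (C * Real.exp (-t)) := by
          gcongr
          · exact h' t
          · exact h t
      _ = C' * C * (Real.exp (-t) * Real.exp (-t)) := by ring
      _ = _ := by rw [← Real.exp_add]; ring_nf
  refine ⟨?_, hint⟩
  refine ext_inner_right ℝ fun g => ?_
  rw [airyKernelVec, inner_airyHankel_left, inner_airyVec, real_inner_comm,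
    ← integral_inner (hint s)]
  have : ∫ x in Ioi (0 : ℝ), airyD lam 0 (s + x) * airyHankel lam s g x
      = ∫ x in Ioi (0 : ℝ), airyD lam 0 (s + x) * inner ℝ (airyVec lam 0 (s + x)) g := by
    refine integral_congr_ae ?_
    filter_upwards [airyHankel_coeFn lam s g] with x hx
    rw [hx]
  rw [this, setIntegral_Ioi_shift s fun t => airyD lam 0 t * inner ℝ (airyVec lam 0 t) g]
  congr 1
  ext t
  rw [real_inner_smul_right, real_inner_comm g]

theorem hasDerivAt_airyKernelVec (lam s : ℝ) :
    HasDerivAt (airyKernelVec lam) (-(airyD lam 0 s • airyVec lam 0 s)) s := by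
  rw [funext fun s => (airyKernelVec_eq_integral lam s).1]
  exact hasDerivAt_setIntegral_Ioi ((continuous_airyD lam 0).smul (continuous_airyVec lam 0))
    (airyKernelVec_eq_integral lam s).2 s

theorem hasDerivAt_norm_sq_airyVec (lam s : ℝ) :
    HasDerivAt (fun s => inner ℝ (airyVec lam 0 s) (airyVec lam 0 s)) (-(airyD lam 0 s) ^ 2) s := by
  have h : (fun s => inner ℝ (airyVec lam 0 s) (airyVec lam 0 s))
      = fun s => airyD lam 1 s ^ 2 - s * airyD lam 0 s ^ 2 := by
    ext s
    rw [inner_airyVec_airyVec, airyKernel, if_pos rfl, deriv_airyA, airyD_zero]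
  rw [h]
  refine (((hasDerivAt_airyD lam 1 s).pow 2).sub
    ((hasDerivAt_id s).mul ((hasDerivAt_airyD lam 0 s).pow 2))).congr_deriv ?_
  simp [airyD_two]
  ring

/-! ### Differential equations in the endpoint -/

/-- The resolvent `(I - K)⁻¹`, transported to `L²(0, ∞)`. -/
def airyRes (lam s : ℝ) : L2Ray 0 →L[ℝ] L2Ray 0 := Ring.inverse (1 - airyShiftOp lam s)

theorem airyRes_left {lam s : ℝ} (h : IsUnit (1 - airyShiftOp lam s)) (f : L2Ray 0) :
    airyRes lam s (f - airyShiftOp lam s f) = f :=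
  congrArg (fun T : L2Ray 0 →L[ℝ] L2Ray 0 => T f) (Ring.inverse_mul_cancel _ h)

theorem airyRes_right {lam s : ℝ} (h : IsUnit (1 - airyShiftOp lam s)) (f : L2Ray 0) :
    airyRes lam s f - airyShiftOp lam s (airyRes lam s f) = f :=
  congrArg (fun T : L2Ray 0 →L[ℝ] L2Ray 0 => T f) (Ring.mul_inverse_cancel _ h)

theorem airyShiftOp_symm (lam s : ℝ) (f g : L2Ray 0) :
    inner ℝ (airyShiftOp lam s f) g = inner ℝ f (airyShiftOp lam s g) := by
  rw [airyShiftOp_apply, airyShiftOp_apply, inner_airyHankel_left, inner_airyHankel_left]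

theorem airyRes_symm {lam s : ℝ} (h : IsUnit (1 - airyShiftOp lam s)) (f g : L2Ray 0) :
    inner ℝ (airyRes lam s f) g = inner ℝ f (airyRes lam s g) := by
  conv_lhs => rw [← airyRes_right h g]
  conv_rhs => rw [← airyRes_right h f]
  rw [inner_sub_right, inner_sub_left, airyShiftOp_symm]

theorem airyRes_hankel {lam s : ℝ} (h : IsUnit (1 - airyShiftOp lam s)) (f : L2Ray 0) :
    airyRes lam s (airyHankel lam s f) = airyHankel lam s (airyRes lam s f) := by
  conv_lhs => rw [← airyRes_right h f, map_sub, airyShiftOp_apply, ← airyShiftOp_apply,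
    airyRes_left h]

/-- The class of `(I - K)⁻¹ A`, transported to `L²(0, ∞)`. -/
def airyQvec (lam s : ℝ) : L2Ray 0 := airyRes lam s (airyVec lam 0 s)

/-- The class of `(I - K)⁻¹ K(·, s)`, transported to `L²(0, ∞)`. -/
def airyPvec (lam s : ℝ) : L2Ray 0 := airyRes lam s (airyKernelVec lam s)

theorem isOpen_isUnit_airyShiftOp (lam : ℝ) : IsOpen {s | IsUnit (1 - airyShiftOp lam s)} := by
  have hc : Continuous fun s => 1 - airyShiftOp lam s :=
    continuous_const.sub
      (continuous_iff_continuousAt.2 fun s => (hasDerivAt_airyShiftOp lam s).continuousAt)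
  exact Units.isOpen.preimage hc

theorem hasDerivAt_ringInverse_one_sub {R : Type*} [NormedRing R] [NormedAlgebra ℝ R]
    [CompleteSpace R] {T : ℝ → R} {T' : R} {s : ℝ} (h : IsUnit (1 - T s))
    (hT : HasDerivAt T T' s) :
    HasDerivAt (fun s => Ring.inverse (1 - T s))
      (Ring.inverse (1 - T s) * T' * Ring.inverse (1 - T s)) s := by
  have h1 := hT.const_sub 1
  have h2 := hasFDerivAt_ringInverse (𝕜 := ℝ) h.unit
  rw [h.unit_spec] at h2
  have hinv : ((h.unit⁻¹ : Rˣ) : R) = Ring.inverse (1 - T s) := by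
    rw [← Ring.inverse_unit, h.unit_spec]
  rw [hinv] at h2
  refine (h2.comp_hasDerivAt s h1).congr_deriv ?_
  simp

theorem hasDerivAt_ringInverse_one_sub_apply {E : Type*} [NormedAddCommGroup E]
    [NormedSpace ℝ E] [CompleteSpace E] {T : ℝ → E →L[ℝ] E} {T' : E →L[ℝ] E} {y : ℝ → E} {y' : E}
    {s : ℝ} (h : IsUnit (1 - T s)) (hT : HasDerivAt T T' s) (hy : HasDerivAt y y' s) :
    HasDerivAt (fun s => Ring.inverse (1 - T s) (y s))
      (Ring.inverse (1 - T s) (T' (Ring.inverse (1 - T s) (y s)))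
        + Ring.inverse (1 - T s) y') s :=
  (hasDerivAt_ringInverse_one_sub h hT).clm_apply hy

/-- Differentiation through the resolvent: its derivative in `s` is the rank-one operator
`-Q ⊗ Q`. -/
theorem hasDerivAt_airyRes_apply {lam s : ℝ} (h : IsUnit (1 - airyShiftOp lam s))
    {y : ℝ → L2Ray 0} {y' : L2Ray 0} (hy : HasDerivAt y y' s) :
    HasDerivAt (fun s => airyRes lam s (y s))
      (airyRes lam s y' - inner ℝ (airyQvec lam s) (y s) • airyQvec lam s) s := by
  refine (hasDerivAt_ringInverse_one_sub_apply h (hasDerivAt_airyShiftOp lam s) hy).congr_deriv ?_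
  change airyRes lam s (-(airyRankOne lam s (airyRes lam s (y s)))) + airyRes lam s y' = _
  rw [airyRankOne_apply, map_neg, map_smul, ← airyRes_symm h, neg_add_eq_sub]
  rfl

/-- `q`, in terms of the vectors in `L²(0, ∞)`. -/
def scalarQ (lam s : ℝ) : ℝ := airyD lam 0 s + inner ℝ (airyVec lam 0 s) (airyPvec lam s)

/-- `(A, (I - K)⁻¹ A)`. -/
def scalarU (lam s : ℝ) : ℝ := inner ℝ (airyVec lam 0 s) (airyQvec lam s)

/-- `(A', (I - K)⁻¹ A)`. -/
def scalarV (lam s : ℝ) : ℝ := inner ℝ (airyVec lam 1 s) (airyQvec lam s)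

/-- The derivative at `x = s` of the continuous function `(I - K)⁻¹ A`. -/
def scalarQ' (lam s : ℝ) : ℝ := airyD lam 1 s + inner ℝ (airyVec lam 1 s) (airyPvec lam s)

/-- `R(s, s)`, in terms of the vectors in `L²(0, ∞)`. -/
def scalarR (lam s : ℝ) : ℝ :=
  inner ℝ (airyVec lam 0 s) (airyVec lam 0 s) + inner ℝ (airyKernelVec lam s) (airyPvec lam s)

theorem inner_airyKernelVec_airyQvec {lam s : ℝ} (h : IsUnit (1 - airyShiftOp lam s)) :
    inner ℝ (airyKernelVec lam s) (airyQvec lam s)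
      = inner ℝ (airyVec lam 0 s) (airyPvec lam s) := by
  rw [airyQvec, airyPvec, ← airyRes_symm h, real_inner_comm]

/-- The two expressions for the diagonal of the resolvent kernel agree, because `K` is the square
of a Hankel operator that maps `A(s + ·)` to `K(s + ·, s)`. -/
theorem scalarR_eq_scalarU {lam s : ℝ} (h : IsUnit (1 - airyShiftOp lam s)) :
    scalarR lam s = scalarU lam s := by
  have h1 : airyQvec lam s = airyVec lam 0 s + airyHankel lam s (airyPvec lam s) := by
    have := airyRes_right h (airyVec lam 0 s)
    rw [sub_eq_iff_eq_add] at this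
    rw [airyQvec, this, airyPvec, airyKernelVec, airyRes_hankel h, ← airyShiftOp_apply, ← this]
  rw [scalarR, scalarU, h1, inner_add_right, airyKernelVec, inner_airyHankel_left]

theorem hasDerivAt_airyQvec {lam s : ℝ} (h : IsUnit (1 - airyShiftOp lam s)) :
    HasDerivAt (airyQvec lam)
      (airyRes lam s (airyVec lam 1 s) - scalarU lam s • airyQvec lam s) s := by
  have := hasDerivAt_airyRes_apply h (hasDerivAt_airyVec lam 0 s)
  rwa [real_inner_comm] at this

theorem hasDerivAt_airyPvec {lam s : ℝ} (h : IsUnit (1 - airyShiftOp lam s)) :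
    HasDerivAt (airyPvec lam) (-(scalarQ lam s • airyQvec lam s)) s := by
  refine (hasDerivAt_airyRes_apply h (hasDerivAt_airyKernelVec lam s)).congr_deriv ?_
  rw [real_inner_comm, inner_airyKernelVec_airyQvec h, map_neg, map_smul, scalarQ, ← airyQvec]
  module

theorem hasDerivAt_scalarR {lam s : ℝ} (h : IsUnit (1 - airyShiftOp lam s)) :
    HasDerivAt (scalarR lam) (-(scalarQ lam s) ^ 2) s := by
  refine ((hasDerivAt_norm_sq_airyVec lam s).add
    ((hasDerivAt_airyKernelVec lam s).inner ℝ (hasDerivAt_airyPvec h))).congr_deriv ?_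
  rw [inner_neg_right, inner_neg_left, real_inner_smul_right, real_inner_smul_left,
    inner_airyKernelVec_airyQvec h, scalarQ]
  ring

theorem hasDerivAt_scalarU {lam s : ℝ} (h : IsUnit (1 - airyShiftOp lam s)) :
    HasDerivAt (scalarU lam) (2 * scalarV lam s - scalarU lam s ^ 2) s := by
  refine ((hasDerivAt_airyVec lam 0 s).inner ℝ (hasDerivAt_airyQvec h)).congr_deriv ?_
  rw [inner_sub_right, real_inner_smul_right, ← airyRes_symm h, scalarV, scalarU, ← airyQvec,
    real_inner_comm (airyVec lam (0 + 1) s)]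
  ring

/-- The first integral `u² - 2 v = q²`. It follows from computing the derivative of `R(s, s)`
in two ways. -/
theorem two_mul_scalarV {lam s : ℝ} (h : IsUnit (1 - airyShiftOp lam s)) :
    2 * scalarV lam s = scalarU lam s ^ 2 - scalarQ lam s ^ 2 := by
  have hev : scalarR lam =ᶠ[𝓝 s] scalarU lam := by
    filter_upwards [(isOpen_isUnit_airyShiftOp lam).mem_nhds h] with x hx
    exact scalarR_eq_scalarU hx
  have := (hasDerivAt_scalarR h).unique ((hasDerivAt_scalarU h).congr_of_eventuallyEq hev)
  linarith

theorem hasDerivAt_scalarQ {lam s : ℝ} (h : IsUnit (1 - airyShiftOp lam s)) :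
    HasDerivAt (scalarQ lam) (scalarQ' lam s - scalarQ lam s * scalarU lam s) s := by
  refine ((hasDerivAt_airyD lam 0 s).add
    ((hasDerivAt_airyVec lam 0 s).inner ℝ (hasDerivAt_airyPvec h))).congr_deriv ?_
  rw [inner_neg_right, real_inner_smul_right, scalarQ', scalarU]
  ring

/-- The operator `K` is given by the kernel `K(s + x, s + y)`, which is the function
`H A(s + x + ·)` of `y`; see `airyHankel_airyVec`. -/
theorem airyShiftOp_coeFn (lam s : ℝ) (f : L2Ray 0) :
    airyShiftOp lam s f =ᵐ[volume.restrict (Ioi 0)]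
      fun x => inner ℝ (airyHankel lam s (airyVec lam 0 (s + x))) f := by
  filter_upwards [airyHankel_coeFn lam s (airyHankel lam s f)] with x hx
  rw [airyShiftOp_apply, hx, inner_airyHankel_left]

theorem airyHankel_airyVec (lam s x : ℝ) :
    airyHankel lam s (airyVec lam 0 x) = toL2Ray 0 fun y => airyKernel lam x (s + y) := by
  rw [airyHankel_apply]
  simp_rw [real_inner_comm (airyVec lam 0 x), inner_airyVec_airyVec]

theorem memLp_airyKernel (lam s x : ℝ) :
    MemLp (fun y => airyKernel lam x (s + y)) 2 (volume.restrict (Ioi 0)) := by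
  simp_rw [← inner_airyVec_airyVec, ← real_inner_comm (airyVec lam 0 x)]
  exact memLp_inner_airyVec lam s _

theorem inner_airyHankel_airyVec (lam s x : ℝ) (f : L2Ray 0) :
    inner ℝ (airyHankel lam s (airyVec lam 0 x)) f
      = ∫ y in Ioi (0 : ℝ), airyKernel lam x (s + y) * f y := by
  rw [airyHankel_airyVec, inner_toL2Ray (memLp_airyKernel lam s x)]

theorem sub_mul_airyKernel (lam x y : ℝ) :
    (x - y) * airyKernel lam x y
      = airyD lam 0 x * airyD lam 1 y - airyD lam 1 x * airyD lam 0 y := by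
  rw [airyKernel, deriv_airyA, airyD_zero]
  split_ifs with h
  · subst h; ring
  · rw [mul_div_cancel₀ _ (sub_ne_zero.2 h)]

theorem airyPvec_eq_airyHankel {lam s : ℝ} (h : IsUnit (1 - airyShiftOp lam s)) :
    airyPvec lam s = airyHankel lam s (airyQvec lam s) :=
  airyRes_hankel h _

theorem memLp_id_mul_airyPvec {lam s : ℝ} (h : IsUnit (1 - airyShiftOp lam s)) :
    MemLp (fun x => x * airyPvec lam s x) 2 (volume.restrict (Ioi 0)) := by
  rw [airyPvec_eq_airyHankel h]
  obtain ⟨C, hC, hb⟩ := exists_abs_inner_airyVec_le lam 0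
  set D := C * Real.exp (-s) * ‖airyQvec lam s‖
  have hexp : MemLp (fun x => (2 * D) * Real.exp (-(1 / 2) * x)) 2 (volume.restrict (Ioi 0)) := by
    refine MemLp.const_mul ?_ _
    rw [memLp_two_iff_integrable_sq (by fun_prop)]
    refine (integrableOn_exp_neg_Ioi 0).congr (.of_forall fun x => ?_)
    simp only [← Real.exp_nat_mul]
    push_cast
    ring_nf
  refine hexp.of_le (aestronglyMeasurable_id.mul (Lp.aestronglyMeasurable _)) ?_
  filter_upwards [airyHankel_coeFn lam s (airyQvec lam s), ae_restrict_mem measurableSet_Ioi]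
    with x h1 hx
  have hx' : 0 < x := hx
  rw [h1, norm_mul, Real.norm_of_nonneg hx'.le]
  have h2 : x ≤ 2 * Real.exp (1 / 2 * x) := by
    have := Real.add_one_le_exp (1 / 2 * x)
    linarith
  calc _ ≤ (2 * Real.exp (1 / 2 * x)) * (D * Real.exp (-x)) := by
        gcongr
        exact hb s x _
    _ = 2 * D * (Real.exp (1 / 2 * x) * Real.exp (-x)) := by ring
    _ = 2 * D * Real.exp (-(1 / 2) * x) := by rw [← Real.exp_add]; ring_nf
    _ ≤ _ := le_abs_self _

/-- The class of `x ↦ x P(x)` in `L²(0, ∞)`. -/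
def airyMPvec (lam s : ℝ) : L2Ray 0 := toL2Ray 0 fun x => x * airyPvec lam s x

/-- The commutator of the multiplication by `x` with the resolvent, applied to `K(·, s)`. -/
theorem airyMPvec_eq {lam s : ℝ} (h : IsUnit (1 - airyShiftOp lam s)) :
    airyMPvec lam s
      = airyRes lam s (scalarQ' lam s • airyVec lam 0 s - scalarQ lam s • airyVec lam 1 s) := by
  rw [← airyRes_left h (airyMPvec lam s)]
  congr 1
  have h1 := airyRes_right h (airyKernelVec lam s)
  rw [← airyPvec, sub_eq_iff_eq_add] at h1
  have hM := memLp_id_mul_airyPvec h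
  apply Lp.ext
  filter_upwards [airyShiftOp_coeFn lam s (airyPvec lam s),
    airyHankel_coeFn lam s (airyVec lam 0 s),
    Lp.coeFn_add (airyKernelVec lam s) (airyShiftOp lam s (airyPvec lam s)),
    airyShiftOp_coeFn lam s (airyMPvec lam s), toL2Ray_coeFn hM,
    Lp.coeFn_sub (airyMPvec lam s) (airyShiftOp lam s (airyMPvec lam s)),
    Lp.coeFn_sub (scalarQ' lam s • airyVec lam 0 s) (scalarQ lam s • airyVec lam 1 s),
    Lp.coeFn_smul (scalarQ' lam s) (airyVec lam 0 s),
    Lp.coeFn_smul (scalarQ lam s) (airyVec lam 1 s),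
    airyVec_coeFn lam 0 s, airyVec_coeFn lam 1 s]
    with x h2 h3 h4 h5 h6 h7 h8 h9 h10 h11 h12
  rw [← h1, Pi.add_apply, h2, airyKernelVec, h3, inner_airyVec_airyVec,
    inner_airyHankel_airyVec] at h4
  rw [h7, h8, Pi.sub_apply, Pi.sub_apply, h9, h10, Pi.smul_apply, Pi.smul_apply, h11, h12, h5,
    airyMPvec, h6, h4, inner_airyHankel_airyVec, smul_eq_mul, smul_eq_mul]
  have h13 : ∫ y in Ioi (0 : ℝ), airyKernel lam (s + x) (s + y) *
      toL2Ray 0 (fun x => x * airyPvec lam s x) y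
      = ∫ y in Ioi (0 : ℝ), airyKernel lam (s + x) (s + y) * (y * airyPvec lam s y) := by
    refine integral_congr_ae ?_
    filter_upwards [toL2Ray_coeFn hM] with y hy
    rw [hy]
  have i1 := L2Ray.integrable_mul (memLp_airyKernel lam s (s + x)) (Lp.memLp (airyPvec lam s))
  have i2 := L2Ray.integrable_mul (memLp_airyKernel lam s (s + x)) hM
  have i3 := L2Ray.integrable_mul (memLp_airyD lam 0 s) (Lp.memLp (airyPvec lam s))
  have i4 := L2Ray.integrable_mul (memLp_airyD lam 1 s) (Lp.memLp (airyPvec lam s))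
  -- The kernel of the commutator of `K` with the multiplication by `x` has rank two.
  have h14 : x * (∫ y in Ioi (0 : ℝ), airyKernel lam (s + x) (s + y) * airyPvec lam s y)
      - ∫ y in Ioi (0 : ℝ), airyKernel lam (s + x) (s + y) * (y * airyPvec lam s y)
      = airyD lam 0 (s + x) * inner ℝ (airyVec lam 1 s) (airyPvec lam s)
        - airyD lam 1 (s + x) * inner ℝ (airyVec lam 0 s) (airyPvec lam s) := by
    rw [inner_airyVec, inner_airyVec, ← integral_const_mul, ← integral_const_mul,
      ← integral_const_mul, ← integral_sub (i1.const_mul x) i2,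
      ← integral_sub (i4.const_mul _) (i3.const_mul _)]
    congr 1
    ext y
    have := sub_mul_airyKernel lam (s + x) (s + y)
    linear_combination airyPvec lam s y * this
  have h15 := sub_mul_airyKernel lam (s + x) s
  rw [h13, scalarQ', scalarQ]
  linear_combination h14 + h15

/-- The derivative of `scalarQ'`. Its term `⟨A''(s + ·), P⟩` is reduced by the Airy equation and
`airyMPvec_eq`. -/
theorem hasDerivAt_scalarQ' {lam s : ℝ} (h : IsUnit (1 - airyShiftOp lam s)) :
    HasDerivAt (scalarQ' lam)
      (s * scalarQ lam s + scalarQ' lam s * scalarU lam s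
        - 2 * scalarQ lam s * scalarV lam s) s := by
  refine ((hasDerivAt_airyD lam 1 s).add
    ((hasDerivAt_airyVec lam 1 s).inner ℝ (hasDerivAt_airyPvec h))).congr_deriv ?_
  have hM := memLp_id_mul_airyPvec h
  have h1 : inner ℝ (airyVec lam 2 s) (airyPvec lam s)
      = s * inner ℝ (airyVec lam 0 s) (airyPvec lam s)
        + inner ℝ (airyVec lam 0 s) (airyMPvec lam s) := by
    have h2 : inner ℝ (airyVec lam 0 s) (airyMPvec lam s)
        = ∫ x in Ioi (0 : ℝ), airyD lam 0 (s + x) * (x * airyPvec lam s x) :=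
      inner_toL2Ray_toL2Ray (memLp_airyD lam 0 s) hM
    have i1 := L2Ray.integrable_mul (memLp_airyD lam 0 s) (Lp.memLp (airyPvec lam s))
    rw [h2, inner_airyVec, inner_airyVec, ← integral_const_mul,
      ← integral_add (i1.const_mul s) (L2Ray.integrable_mul (memLp_airyD lam 0 s) hM)]
    congr 1
    ext x
    rw [airyD_two]
    ring
  rw [h1, airyMPvec_eq h, ← airyRes_symm h, inner_sub_right, real_inner_smul_right,
    real_inner_smul_right, inner_neg_right, real_inner_smul_right, ← airyQvec,
    real_inner_comm (airyVec lam 0 s) (airyQvec lam s),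
    real_inner_comm (airyVec lam 1 s) (airyQvec lam s), airyD_two, scalarV, scalarU, scalarQ]
  ring

/-- The second Painlevé equation, as a first-order equation for the derivative of `q`. -/
theorem hasDerivAt_deriv_scalarQ {lam s : ℝ} (h : IsUnit (1 - airyShiftOp lam s)) :
    HasDerivAt (fun s => scalarQ' lam s - scalarQ lam s * scalarU lam s)
      (s * scalarQ lam s + 2 * scalarQ lam s ^ 3) s := by
  refine ((hasDerivAt_scalarQ' h).sub
    ((hasDerivAt_scalarQ h).mul (hasDerivAt_scalarU h))).congr_deriv ?_
  linear_combination (-2 * scalarQ lam s) * two_mul_scalarV h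

/-! ### Transfer to the half-line with endpoint zero -/

theorem map_shift_restrict_Ioi (s : ℝ) :
    (volume.restrict (Ioi (0 : ℝ))).map (fun x => s + x) = volume.restrict (Ioi s) :=
  (measurePreserving_shift s).map_eq

theorem ae_restrict_Ioi_iff_shift (s : ℝ) (p : ℝ → Prop) :
    (∀ᵐ t ∂(volume.restrict (Ioi s)), p t) ↔ ∀ᵐ x ∂(volume.restrict (Ioi (0 : ℝ))), p (s + x) := by
  rw [← map_shift_restrict_Ioi s, (measurableEmbedding_addLeft s).ae_map_iff]

theorem memLp_Ioi_iff_shift (s : ℝ) (g : ℝ → ℝ) :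
    MemLp g 2 (volume.restrict (Ioi s)) ↔
      MemLp (fun x => g (s + x)) 2 (volume.restrict (Ioi (0 : ℝ))) := by
  rw [← map_shift_restrict_Ioi s, (measurableEmbedding_addLeft s).memLp_map_measure_iff]
  rfl

theorem measurePreserving_shift_neg (s : ℝ) :
    MeasurePreserving (fun x => -s + x) (volume.restrict (Ioi s))
      (volume.restrict (Ioi (0 : ℝ))) := by
  have := (measurePreserving_add_left (volume : Measure ℝ) (-s)).restrict_preimage
    (measurableSet_Ioi (a := (0 : ℝ)))
  simpa using this

/-- The translation `f ↦ f(s + ·)` from `L²(s, ∞)` onto `L²(0, ∞)`. -/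
def rayShift (s : ℝ) : L2Ray s ≃L[ℝ] L2Ray 0 :=
  (LinearIsometryEquiv.ofSurjective
    (Lp.compMeasurePreservingₗᵢ ℝ (fun x => s + x) (measurePreserving_shift s))
    (fun g => ⟨Lp.compMeasurePreserving (fun x => -s + x) (measurePreserving_shift_neg s) g, by
      apply Lp.ext
      have h1 := Lp.coeFn_compMeasurePreserving
        (Lp.compMeasurePreserving (fun x => -s + x) (measurePreserving_shift_neg s) g)
        (measurePreserving_shift s)
      have h2 := (ae_restrict_Ioi_iff_shift s _).1
        (Lp.coeFn_compMeasurePreserving g (measurePreserving_shift_neg s))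
      filter_upwards [h1, h2] with x h1 h2
      simp only [Function.comp] at h1 h2
      rw [neg_add_cancel_left] at h2
      rw [← h2, ← h1]
      rfl⟩)).toContinuousLinearEquiv

theorem rayShift_coeFn (s : ℝ) (f : L2Ray s) :
    rayShift s f =ᵐ[volume.restrict (Ioi 0)] fun x => f (s + x) :=
  Lp.coeFn_compMeasurePreserving f (measurePreserving_shift s)

theorem rayShift_toL2Ray {s : ℝ} {g : ℝ → ℝ}
    (h : MemLp (fun x => g (s + x)) 2 (volume.restrict (Ioi 0))) :
    rayShift s (toL2Ray s g) = toL2Ray 0 fun x => g (s + x) := by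
  apply Lp.ext
  filter_upwards [rayShift_coeFn s (toL2Ray s g), toL2Ray_coeFn h,
    (ae_restrict_Ioi_iff_shift s _).1 (toL2Ray_coeFn ((memLp_Ioi_iff_shift s g).2 h))]
    with x h1 h2 h3
  rw [h1, h2, h3]

theorem setIntegral_Ioi_mul_coeFn (s : ℝ) (k : ℝ → ℝ) (f : L2Ray s) :
    ∫ y in Ioi s, k y * f y = ∫ y in Ioi (0 : ℝ), k (s + y) * rayShift s f y := by
  rw [← setIntegral_Ioi_shift]
  refine integral_congr_ae ?_
  filter_upwards [rayShift_coeFn s f] with x hx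
  rw [hx]

theorem rayShift_symm_airyShiftOp_coeFn (lam s : ℝ) (f : L2Ray s) :
    (rayShift s).symm (airyShiftOp lam s (rayShift s f)) =ᵐ[volume.restrict (Ioi s)]
      fun x => ∫ y in Ioi s, airyKernel lam x y * f y := by
  refine (ae_restrict_Ioi_iff_shift s _).2 ?_
  filter_upwards [rayShift_coeFn s ((rayShift s).symm (airyShiftOp lam s (rayShift s f))),
    airyShiftOp_coeFn lam s (rayShift s f)] with x h1 h2
  rw [← h1, ContinuousLinearEquiv.apply_symm_apply, h2, inner_airyHankel_airyVec,
    setIntegral_Ioi_mul_coeFn s]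

theorem rayShift_airyOp (lam s : ℝ) (f : L2Ray s) :
    rayShift s (airyOp lam s f) = airyShiftOp lam s (rayShift s f) := by
  have hex : ∃ T : L2Ray s →L[ℝ] L2Ray s, ∀ f : L2Ray s,
      T f =ᵐ[volume.restrict (Ioi s)] fun x => ∫ y in Ioi s, airyKernel lam x y * f y :=
    ⟨(rayShift s).symm.conjContinuousAlgEquiv (airyShiftOp lam s), fun f =>
      rayShift_symm_airyShiftOp_coeFn lam s f⟩
  rw [← (rayShift s).eq_symm_apply]
  symm
  apply Lp.ext
  rw [airyOp, integralOp, dif_pos hex]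
  exact (rayShift_symm_airyShiftOp_coeFn lam s f).trans (hex.choose_spec f).symm

theorem airyOp_coeFn (lam s : ℝ) (f : L2Ray s) :
    airyOp lam s f =ᵐ[volume.restrict (Ioi s)]
      fun x => ∫ y in Ioi s, airyKernel lam x y * f y := by
  rw [← (rayShift s).symm_apply_apply (airyOp lam s f), rayShift_airyOp]
  exact rayShift_symm_airyShiftOp_coeFn lam s f

theorem conj_one_sub_airyOp (lam s : ℝ) :
    (rayShift s).conjContinuousAlgEquiv (1 - airyOp lam s) = 1 - airyShiftOp lam s := by
  rw [map_sub, map_one]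
  congr 1
  ext1 f
  rw [ContinuousLinearEquiv.conjContinuousAlgEquiv_apply_apply, rayShift_airyOp,
    ContinuousLinearEquiv.apply_symm_apply]

theorem isUnit_one_sub_airyOp_iff (lam s : ℝ) :
    IsUnit (1 - airyOp lam s) ↔ IsUnit (1 - airyShiftOp lam s) := by
  rw [← conj_one_sub_airyOp]
  exact (MulEquiv.isUnit_map (rayShift s).conjContinuousAlgEquiv).symm

theorem rayShift_airyResolvent {lam s : ℝ} (h : IsUnit (1 - airyShiftOp lam s)) (f : L2Ray s) :
    rayShift s (airyResolvent lam s f) = airyRes lam s (rayShift s f) := by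
  have h' := (isUnit_one_sub_airyOp_iff lam s).2 h
  have h1 : airyResolvent lam s f - airyOp lam s (airyResolvent lam s f) = f :=
    congrArg (fun T : L2Ray s →L[ℝ] L2Ray s => T f) (Ring.mul_inverse_cancel _ h')
  rw [← airyRes_left h (rayShift s (airyResolvent lam s f)), ← rayShift_airyOp, ← map_sub, h1]

theorem resolventApply_eq {lam s : ℝ} (h : IsUnit (1 - airyShiftOp lam s)) {g : ℝ → ℝ}
    (hg : MemLp (fun x => g (s + x)) 2 (volume.restrict (Ioi 0))) (x : ℝ) :
    resolventApply lam s g x = g x + inner ℝ (airyHankel lam s (airyVec lam 0 x))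
      (airyRes lam s (toL2Ray 0 fun x => g (s + x))) := by
  rw [resolventApply, inner_airyHankel_airyVec, ← rayShift_toL2Ray hg, ← rayShift_airyResolvent h,
    ← setIntegral_Ioi_mul_coeFn]

theorem airyQ_eq_scalarQ {lam s : ℝ} (h : IsUnit (1 - airyShiftOp lam s)) :
    airyQ lam s = scalarQ lam s := by
  rw [airyQ, resolventApply_eq h (by simpa [airyD_zero] using memLp_airyD lam 0 s), scalarQ,
    ← inner_airyKernelVec_airyQvec h, ← airyD_zero]
  rfl

theorem airyKernel_comm (lam x y : ℝ) : airyKernel lam x y = airyKernel lam y x := by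
  rw [← inner_airyVec_airyVec, real_inner_comm, inner_airyVec_airyVec]

theorem resolventKernel_eq {lam s : ℝ} (h : IsUnit (1 - airyShiftOp lam s)) (x y : ℝ) :
    resolventKernel lam s x y = inner ℝ (airyVec lam 0 x) (airyVec lam 0 y)
      + inner ℝ (airyHankel lam s (airyVec lam 0 x))
        (airyRes lam s (airyHankel lam s (airyVec lam 0 y))) := by
  rw [resolventKernel, resolventApply_eq h, inner_airyVec_airyVec, airyHankel_airyVec lam s y]
  · simp_rw [airyKernel_comm lam _ y]
  · simp_rw [airyKernel_comm lam _ y]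
    exact memLp_airyKernel lam s y

theorem airyR_eq_scalarR {lam s : ℝ} (h : IsUnit (1 - airyShiftOp lam s)) :
    airyR lam s = scalarR lam s := by
  rw [airyR, resolventKernel_eq h, scalarR]
  rfl

theorem continuous_resolventKernel {lam s : ℝ} (h : IsUnit (1 - airyShiftOp lam s)) :
    Continuous (Function.uncurry (resolventKernel lam s)) := by
  have hc := continuous_airyVec lam 0
  have : Function.uncurry (resolventKernel lam s) = fun z : ℝ × ℝ =>
      inner ℝ (airyVec lam 0 z.1) (airyVec lam 0 z.2)
      + inner ℝ (airyHankel lam s (airyVec lam 0 z.1))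
        (airyRes lam s (airyHankel lam s (airyVec lam 0 z.2))) := by
    ext z
    exact resolventKernel_eq h z.1 z.2
  rw [this]
  fun_prop

/-- `R(x, y)` is the kernel of `K (I - K)⁻¹`. -/
theorem airyOp_airyResolvent_coeFn {lam s : ℝ} (h : IsUnit (1 - airyShiftOp lam s))
    (f : L2Ray s) : airyOp lam s (airyResolvent lam s f) =ᵐ[volume.restrict (Ioi s)]
      fun x => ∫ y in Ioi s, resolventKernel lam s x y * f y := by
  filter_upwards [airyOp_coeFn lam s (airyResolvent lam s f)] with x hx
  rw [hx, setIntegral_Ioi_mul_coeFn s, setIntegral_Ioi_mul_coeFn s, rayShift_airyResolvent h,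
    ← inner_airyHankel_airyVec, ← airyRes_symm h]
  -- `R(x, s + y)` is the value at `y` of `H` applied to the vector `w`.
  set w := airyVec lam 0 x
    + airyHankel lam s (airyRes lam s (airyHankel lam s (airyVec lam 0 x))) with hw
  have h1 : airyRes lam s (airyHankel lam s (airyVec lam 0 x)) = airyHankel lam s w := by
    have h2 := airyRes_right h (airyHankel lam s (airyVec lam 0 x))
    rw [sub_eq_iff_eq_add] at h2
    rw [hw, map_add, ← airyShiftOp_apply, ← h2]
  rw [h1, L2Ray.inner_eq]
  refine integral_congr_ae ?_
  filter_upwards [airyHankel_coeFn lam s w] with y hy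
  rw [hy, resolventKernel_eq h, hw, inner_add_right, real_inner_comm (airyVec lam 0 x),
    ← airyRes_symm h, ← inner_airyHankel_left,
    real_inner_comm (airyHankel lam s (airyVec lam 0 (s + y)))]

/-! ### Plancherel's identity and a contour shift -/

theorem Lp.ae_eq_of_integral_schwartz_smul {F : ℝ → ℂ} (hF : LocallyIntegrable F)
    (g : Lp ℂ 2 (volume : Measure ℝ))
    (h : ∀ w : SchwartzMap ℝ ℂ, ∫ x, w x • g x = ∫ x, w x • F x) : g =ᵐ[volume] F := by
  refine ae_eq_of_integral_contDiff_smul_eq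
    ((Lp.memLp g).locallyIntegrable (by norm_num)) hF fun w hw hwc => ?_
  have hwc' : HasCompactSupport (Complex.ofRealCLM ∘ w) := hwc.comp_left rfl
  have hw' : ContDiff ℝ (⊤ : ℕ∞) (Complex.ofRealCLM ∘ w) := by fun_prop
  obtain ⟨ψ, hψ⟩ : ∃ ψ : SchwartzMap ℝ ℂ, ∀ x, ψ x = (w x : ℂ) :=
    ⟨hwc'.toSchwartzMap hw', fun x => by simp⟩
  have h4 := h ψ
  simp_rw [hψ, Complex.coe_smul] at h4
  exact h4

theorem SchwartzMap.integral_fourier_smul_eq_integral_smul_fourier {f : ℝ → ℂ}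
    (hf : Integrable f) (w : SchwartzMap ℝ ℂ) :
    ∫ x, (FourierTransform.fourier w : SchwartzMap ℝ ℂ) x • f x
      = ∫ x, w x • FourierTransform.fourier f x := by
  have h3 := VectorFourier.integral_fourierIntegral_smul_eq_flip (L := innerₗ ℝ)
    (μ := volume) (ν := volume) Real.continuous_fourierChar (by fun_prop) w.integrable hf
  rw [flip_innerₗ] at h3
  rw [SchwartzMap.fourier_coe]
  exact h3

/-- The `L²` Fourier transform of a function in `L¹ ∩ L²` is given by the Fourier integral. -/
theorem coeFn_fourier_toLp {f : ℝ → ℂ} (hf : Integrable f) (hf2 : MemLp f 2) :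
    (FourierTransform.fourier (hf2.toLp f) : Lp ℂ 2 (volume : Measure ℝ)) =ᵐ[volume]
      FourierTransform.fourier f := by
  have hc : Continuous (FourierTransform.fourier f) :=
    VectorFourier.fourierIntegral_continuous Real.continuous_fourierChar
      (L := innerₗ ℝ) (by fun_prop) hf
  refine Lp.ae_eq_of_integral_schwartz_smul hc.locallyIntegrable _ fun ψ => ?_
  rw [← SchwartzMap.integral_fourier_smul_eq_integral_smul_fourier hf,
    ← Lp.toTemperedDistribution_apply, ← Lp.fourier_toTemperedDistribution_eq,
    TemperedDistribution.fourier_apply, Lp.toTemperedDistribution_apply]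
  refine integral_congr_ae ?_
  filter_upwards [hf2.coeFn_toLp] with x hx
  rw [hx]

/-- **Plancherel's identity** for functions in `L¹ ∩ L²`. -/
theorem memLp_fourier_and_integral_norm_sq {f : ℝ → ℂ} (hf : Integrable f) (hf2 : MemLp f 2) :
    MemLp (FourierTransform.fourier f) 2 ∧
      ∫ x, ‖FourierTransform.fourier f x‖ ^ 2 = ∫ x, ‖f x‖ ^ 2 := by
  have h := coeFn_fourier_toLp hf hf2
  refine ⟨(Lp.memLp _).ae_eq h, ?_⟩
  have hn : ∀ g : Lp ℂ 2 (volume : Measure ℝ),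
      ((‖g‖ ^ 2 : ℝ) : ℂ) = ((∫ x, ‖g x‖ ^ 2 : ℝ) : ℂ) := by
    intro g
    have := inner_self_eq_norm_sq_to_K (𝕜 := ℂ) g
    rw [L2.inner_def] at this
    rw [← integral_complex_ofReal]
    push_cast
    rw [← RCLike.ofReal_eq_complex_ofReal, ← this]
    congr 1
    ext x
    rw [inner_self_eq_norm_sq_to_K]
  have h1 := hn (FourierTransform.fourier (hf2.toLp f))
  have h2 := hn (hf2.toLp f)
  rw [Lp.norm_fourier_eq] at h1
  have h3 := Complex.ofReal_inj.1 (h1.symm.trans h2)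
  calc _ = ∫ x, ‖(FourierTransform.fourier (hf2.toLp f) : Lp ℂ 2 (volume : Measure ℝ)) x‖ ^ 2 :=
        integral_congr_ae (by filter_upwards [h] with x hx; rw [hx])
    _ = _ := h3
    _ = _ := integral_congr_ae (by filter_upwards [hf2.coeFn_toLp] with x hx; rw [hx])

/-- The integral over the contour `Re w = c` that represents the Airy function. -/
def airyContour (c x : ℝ) : ℂ :=
  ∫ t : ℝ, Complex.exp ((c + t * Complex.I) ^ 3 / 3 - x * (c + t * Complex.I))

theorem integrable_one_add_sq_mul_gaussian {a : ℝ} (ha : 0 < a) :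
    Integrable fun t : ℝ => (1 + t ^ 2) * Real.exp (-a * t ^ 2) := by
  have h := (integrable_exp_neg_mul_sq (half_pos ha)).const_mul (1 + 2 / a)
  refine h.mono' (by fun_prop) (.of_forall fun t => ?_)
  rw [Real.norm_of_nonneg (by positivity)]
  have h1 : 1 + t ^ 2 ≤ (1 + 2 / a) * Real.exp (a / 2 * t ^ 2) := by
    have h2 := Real.add_one_le_exp (a / 2 * t ^ 2)
    have h3 : 0 ≤ a / 2 * t ^ 2 := by positivity
    have h4 : t ^ 2 = 2 / a * (a / 2 * t ^ 2) := by field_simp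
    have h5 : 0 < 2 / a := by positivity
    calc 1 + t ^ 2 ≤ Real.exp (a / 2 * t ^ 2) + 2 / a * Real.exp (a / 2 * t ^ 2) := by
          nlinarith
      _ = _ := by ring
  calc _ ≤ ((1 + 2 / a) * Real.exp (a / 2 * t ^ 2)) * Real.exp (-a * t ^ 2) := by gcongr
    _ = (1 + 2 / a) * (Real.exp (a / 2 * t ^ 2) * Real.exp (-a * t ^ 2)) := by ring
    _ = _ := by rw [← Real.exp_add]; ring_nf

theorem continuous_airyContour_integrand (c x : ℝ) :
    Continuous fun t : ℝ =>
      Complex.exp ((c + t * Complex.I) ^ 3 / 3 - x * (c + t * Complex.I)) := by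
  fun_prop

theorem integrable_airyContour {c : ℝ} (hc : 0 < c) (x : ℝ) :
    Integrable fun t : ℝ =>
      Complex.exp ((c + t * Complex.I) ^ 3 / 3 - x * (c + t * Complex.I)) := by
  refine ((integrable_exp_neg_mul_sq hc).const_mul (Real.exp (c ^ 3 / 3 - x * c))).mono'
    (continuous_airyContour_integrand c x).aestronglyMeasurable (.of_forall fun t => ?_)
  rw [norm_cexp_cube_sub, ← Real.exp_add]
  simp
  ring_nf
  rfl

/-- The contour integral does not depend on `c`: its derivative in `c` is the integral of a total
derivative along the contour. -/
theorem hasDerivAt_airyContour {c : ℝ} (hc : 0 < c) (x : ℝ) :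
    HasDerivAt (fun c => airyContour c x) 0 c := by
  set b := 3 * c / 2
  have hb : 0 < b := by positivity
  set M := Real.exp (b ^ 3 / 3 + |x| * b) * (2 * b ^ 2 + 2 + |x|)
  have hbound : ∀ (t y : ℝ), y ∈ Ioo (c / 2) b →
      ‖((y + t * Complex.I) ^ 2 - x) *
        Complex.exp ((y + t * Complex.I) ^ 3 / 3 - x * (y + t * Complex.I))‖
      ≤ M * ((1 + t ^ 2) * Real.exp (-(c / 2) * t ^ 2)) := by
    intro t y hy
    have hy0 : 0 < y := lt_trans (by positivity) hy.1
    rw [norm_mul, norm_cexp_cube_sub]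
    have h1 : ‖((y + t * Complex.I) ^ 2 - x : ℂ)‖ ≤ (2 * b ^ 2 + 2 + |x|) * (1 + t ^ 2) := by
      have h2 : ‖(y + t * Complex.I : ℂ)‖ ^ 2 = y ^ 2 + t ^ 2 := by
        rw [← Complex.normSq_eq_norm_sq, Complex.normSq_add_mul_I]
      calc _ ≤ ‖(y + t * Complex.I : ℂ) ^ 2‖ + ‖(x : ℂ)‖ := norm_sub_le _ _
        _ = y ^ 2 + t ^ 2 + |x| := by rw [norm_pow, h2, Complex.norm_real, Real.norm_eq_abs]
        _ ≤ _ := by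
          have : y ^ 2 ≤ b ^ 2 := by gcongr; exact hy.2.le
          nlinarith [abs_nonneg x, sq_nonneg t, mul_nonneg (sq_nonneg b) (sq_nonneg t),
            mul_nonneg (abs_nonneg x) (sq_nonneg t)]
    have h3 : Real.exp (y ^ 3 / 3 - y * t ^ 2 - (x : ℂ).re * y + (x : ℂ).im * t)
        ≤ Real.exp (b ^ 3 / 3 + |x| * b) * Real.exp (-(c / 2) * t ^ 2) := by
      rw [← Real.exp_add]
      refine Real.exp_le_exp.2 ?_
      simp only [Complex.ofReal_re, Complex.ofReal_im, zero_mul, add_zero]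
      have h4 : y ^ 3 ≤ b ^ 3 := by gcongr; exact hy.2.le
      have h5 : -(x * y) ≤ |x| * b := by
        calc -(x * y) ≤ |x * y| := neg_le_abs _
          _ = |x| * y := by rw [abs_mul, abs_of_pos hy0]
          _ ≤ |x| * b := by gcongr; exact hy.2.le
      have h6 : c / 2 * t ^ 2 ≤ y * t ^ 2 := by gcongr; exact hy.1.le
      linarith
    calc _ ≤ ((2 * b ^ 2 + 2 + |x|) * (1 + t ^ 2)) *
          (Real.exp (b ^ 3 / 3 + |x| * b) * Real.exp (-(c / 2) * t ^ 2)) := by gcongr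
      _ = _ := by ring
  have hcb : c ∈ Ioo (c / 2) b := ⟨by linarith, by simp only [b]; linarith⟩
  have hgi := (integrable_one_add_sq_mul_gaussian (half_pos hc)).const_mul M
  have hcont : ∀ y : ℝ, Continuous fun t : ℝ => ((y + t * Complex.I) ^ 2 - x : ℂ) *
      Complex.exp ((y + t * Complex.I) ^ 3 / 3 - x * (y + t * Complex.I)) := fun y => by fun_prop
  have h0 : ∫ t : ℝ, ((c + t * Complex.I) ^ 2 - x : ℂ) *
      Complex.exp ((c + t * Complex.I) ^ 3 / 3 - x * (c + t * Complex.I)) = 0 := by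
    have hd : ∀ t : ℝ, HasDerivAt (fun t : ℝ =>
        Complex.exp ((c + t * Complex.I) ^ 3 / 3 - x * (c + t * Complex.I)))
        (Complex.I * (((c + t * Complex.I) ^ 2 - x : ℂ) *
          Complex.exp ((c + t * Complex.I) ^ 3 / 3 - x * (c + t * Complex.I)))) t := by
      intro t
      have h0 : HasDerivAt (fun t : ℝ => (c + t * Complex.I : ℂ)) Complex.I t := by
        simpa using ((Complex.ofRealCLM.hasDerivAt (x := t)).mul_const Complex.I).const_add (c : ℂ)
      refine (((h0.fun_pow 3).div_const 3).fun_sub (h0.const_mul (x : ℂ))).cexp.congr_deriv ?_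
      push_cast
      ring
    have h0 := integral_eq_zero_of_hasDerivAt_of_integrable hd
      ((hgi.mono' (hcont c).aestronglyMeasurable
        (.of_forall fun t => hbound t c hcb)).const_mul Complex.I) (integrable_airyContour hc x)
    rw [integral_const_mul] at h0
    exact (mul_eq_zero.1 h0).resolve_left Complex.I_ne_zero
  have key := (hasDerivAt_integral_of_dominated_loc_of_deriv_le (𝕜 := ℝ) (E := ℂ) (x₀ := c)
    (F := fun (y : ℝ) (t : ℝ) =>
      Complex.exp ((y + t * Complex.I) ^ 3 / 3 - x * (y + t * Complex.I)))
    (F' := fun (y : ℝ) (t : ℝ) => ((y + t * Complex.I) ^ 2 - x : ℂ) *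
      Complex.exp ((y + t * Complex.I) ^ 3 / 3 - x * (y + t * Complex.I)))
    (μ := volume) (s := Ioo (c / 2) b) (Ioo_mem_nhds hcb.1 hcb.2)
    (.of_forall fun y => (continuous_airyContour_integrand y x).aestronglyMeasurable)
    (integrable_airyContour hc x) (hcont c).aestronglyMeasurable
    (.of_forall fun t y hy => hbound t y hy) hgi
    (.of_forall fun t y _ => by
      have h0 : HasDerivAt (fun y : ℝ => (y + t * Complex.I : ℂ)) 1 y := by
        simpa using (Complex.ofRealCLM.hasDerivAt (x := y)).add_const (t * Complex.I : ℂ)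
      refine (((h0.fun_pow 3).div_const 3).fun_sub (h0.const_mul (x : ℂ))).cexp.congr_deriv ?_
      push_cast
      ring)).2
  rw [h0] at key
  exact key

/-- The contour in the definition of the Airy function may be moved to `Re w = c`, `c > 0`. -/
theorem airyContour_eq {c : ℝ} (hc : 0 < c) (x : ℝ) : airyContour c x = airyMoment 0 x := by
  have h1 : airyContour 1 x = airyMoment 0 x := by
    simp [airyContour, airyMoment]
  rw [← h1]
  exact isOpen_Ioi.is_const_of_deriv_eq_zero isPreconnected_Ioi
    (fun y hy => (hasDerivAt_airyContour hy x).differentiableAt.differentiableWithinAt)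
    (fun y hy => (hasDerivAt_airyContour hy x).deriv) (mem_Ioi.2 hc) (mem_Ioi.2 one_pos)

/-! ### The bound `lam` for the quadratic form of the Airy operator -/

/-- The integrand of the Laplace transform of `f` on the line `Re w = c`, extended by `0`. -/
def dampedExt (c : ℝ) (f : L2Ray 0) : ℝ → ℂ :=
  (Ioi (0 : ℝ)).indicator fun y => ((Real.exp (-c * y) * f y : ℝ) : ℂ)

theorem memLp_exp_neg_mul {c : ℝ} (hc : 0 < c) :
    MemLp (fun x => Real.exp (-c * x)) 2 (volume.restrict (Ioi 0)) := by
  rw [memLp_two_iff_integrable_sq (by fun_prop)]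
  refine (exp_neg_integrableOn_Ioi 0 (b := 2 * c) (by positivity)).congr (.of_forall fun x => ?_)
  simp only [← Real.exp_nat_mul]
  push_cast
  ring_nf

theorem integrable_exp_neg_mul_coeFn {c : ℝ} (hc : 0 < c) (f : L2Ray 0) :
    Integrable (fun y => Real.exp (-c * y) * f y) (volume.restrict (Ioi 0)) :=
  L2Ray.integrable_mul (memLp_exp_neg_mul hc) (Lp.memLp f)

theorem integrable_dampedExt {c : ℝ} (hc : 0 < c) (f : L2Ray 0) : Integrable (dampedExt c f) := by
  rw [dampedExt, integrable_indicator_iff measurableSet_Ioi]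
  exact (integrable_exp_neg_mul_coeFn hc f).ofReal

theorem memLp_dampedExt {c : ℝ} (hc : 0 < c) (f : L2Ray 0) : MemLp (dampedExt c f) 2 := by
  rw [dampedExt, memLp_indicator_iff_restrict measurableSet_Ioi]
  refine (Lp.memLp f).of_le (integrable_exp_neg_mul_coeFn hc f).ofReal.aestronglyMeasurable ?_
  filter_upwards [ae_restrict_mem measurableSet_Ioi] with y hy
  rw [Complex.norm_real, norm_mul, Real.norm_of_nonneg (Real.exp_pos _).le]
  have : Real.exp (-c * y) ≤ 1 := Real.exp_le_one_iff.2 (by nlinarith [mem_Ioi.1 hy])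
  exact mul_le_of_le_one_left (norm_nonneg _) this

theorem integral_norm_sq_dampedExt_le {c : ℝ} (hc : 0 < c) (f : L2Ray 0) :
    ∫ y, ‖dampedExt c f y‖ ^ 2 ≤ ‖f‖ ^ 2 := by
  have h1 : (fun y => ‖dampedExt c f y‖ ^ 2)
      = (Ioi (0 : ℝ)).indicator fun y => (Real.exp (-c * y) * f y) ^ 2 := by
    ext y
    by_cases hy : y ∈ Ioi (0 : ℝ)
    · rw [dampedExt, indicator_of_mem hy, indicator_of_mem hy, Complex.norm_real, Real.norm_eq_abs,
        sq_abs]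
    · rw [dampedExt, indicator_of_notMem hy, indicator_of_notMem hy]
      simp
  rw [h1, integral_indicator measurableSet_Ioi, ← real_inner_self_eq_norm_sq, L2Ray.inner_eq]
  refine integral_mono_of_nonneg (.of_forall fun y => sq_nonneg _)
    (L2Ray.integrable_mul (Lp.memLp f) (Lp.memLp f)) ?_
  filter_upwards [ae_restrict_mem measurableSet_Ioi] with y hy
  have : Real.exp (-c * y) ≤ 1 := Real.exp_le_one_iff.2 (by nlinarith [mem_Ioi.1 hy])
  rw [mul_pow, ← sq]
  exact mul_le_of_le_one_left (sq_nonneg _) (pow_le_one₀ (Real.exp_pos _).le this)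

/-- The Laplace transform of `f` at the point `c + i t`. -/
def lineLaplace (c : ℝ) (f : L2Ray 0) (t : ℝ) : ℂ :=
  ∫ y in Ioi (0 : ℝ), Complex.exp (-(y * (c + t * Complex.I))) * f y

theorem fourier_dampedExt (c : ℝ) (f : L2Ray 0) (x : ℝ) :
    FourierTransform.fourier (dampedExt c f) x = lineLaplace c f (2 * π * x) := by
  rw [Real.fourier_real_eq_integral_exp_smul, lineLaplace, ← integral_indicator measurableSet_Ioi]
  congr 1
  ext y
  by_cases hy : y ∈ Ioi (0 : ℝ)
  · rw [dampedExt, indicator_of_mem hy, indicator_of_mem hy, smul_eq_mul]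
    push_cast
    rw [← mul_assoc, ← Complex.exp_add]
    congr 2
    ring
  · rw [dampedExt, indicator_of_notMem hy, indicator_of_notMem hy, smul_zero]

theorem continuous_fourier_dampedExt {c : ℝ} (hc : 0 < c) (f : L2Ray 0) :
    Continuous (FourierTransform.fourier (dampedExt c f)) :=
  VectorFourier.fourierIntegral_continuous Real.continuous_fourierChar
      (L := innerₗ ℝ) (by fun_prop) (integrable_dampedExt hc f)

theorem continuous_lineLaplace {c : ℝ} (hc : 0 < c) (f : L2Ray 0) :
    Continuous (lineLaplace c f) := by
  have h : lineLaplace c f = fun t => FourierTransform.fourier (dampedExt c f) ((2 * π)⁻¹ * t) := by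
    ext t
    rw [fourier_dampedExt, mul_inv_cancel_left₀ (by positivity)]
  rw [h]
  exact (continuous_fourier_dampedExt hc f).comp (by fun_prop)

theorem exists_norm_lineLaplace_le (c : ℝ) (f : L2Ray 0) :
    ∃ B : ℝ, 0 < B ∧ ∀ t, ‖lineLaplace c f t‖ ≤ B := by
  refine ⟨1 + ∫ y in Ioi (0 : ℝ), Real.exp (-c * y) * |f y|, ?_, fun t => ?_⟩
  · have : 0 ≤ ∫ y in Ioi (0 : ℝ), Real.exp (-c * y) * |f y| :=
      integral_nonneg fun y => by positivity
    linarith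
  · refine (norm_integral_le_integral_norm _).trans ?_
    have : ∀ y : ℝ, ‖Complex.exp (-(y * (c + t * Complex.I))) * f y‖
        = Real.exp (-c * y) * |f y| := by
      intro y
      rw [norm_mul, Complex.norm_exp, Complex.norm_real, Real.norm_eq_abs]
      congr 2
      simp
      ring
    simp_rw [this]
    linarith

theorem ofReal_airyD_zero_eq_airyContour (lam : ℝ) {c : ℝ} (hc : 0 < c) (x : ℝ) :
    (airyD lam 0 x : ℂ) = √lam * (2 * π)⁻¹ * airyContour c x := by
  rw [airyContour_eq hc, airyD]
  conv_rhs => rw [← ofReal_re_airyMoment]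
  push_cast
  ring

/-- Pairing with the Airy function, as a contour integral against the Laplace transform. -/
theorem inner_airyVec_eq_integral_lineLaplace (lam : ℝ) {c : ℝ} (hc : 0 < c) (x : ℝ)
    (f : L2Ray 0) :
    ((inner ℝ (airyVec lam 0 x) f : ℝ) : ℂ) = √lam * (2 * π)⁻¹ *
      ∫ t : ℝ, Complex.exp ((c + t * Complex.I) ^ 3 / 3 - x * (c + t * Complex.I))
        * lineLaplace c f t := by
  rw [inner_airyVec, ← integral_complex_ofReal]
  simp_rw [Complex.ofReal_mul, ofReal_airyD_zero_eq_airyContour lam hc, mul_assoc]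
  rw [integral_const_mul, integral_const_mul]
  congr 2
  simp_rw [airyContour, lineLaplace, ← integral_const_mul, ← integral_mul_const]
  rw [integral_integral_swap]
  · congr 1
    ext t
    congr 1
    ext y
    rw [← mul_assoc, ← Complex.exp_add]
    congr 2
    push_cast
    ring
  · have hI := ((integrable_exp_neg_mul_coeFn hc f).norm.mul_prod
      (integrable_airyContour hc x).norm)
    refine hI.mono' ?_ (.of_forall fun z => ?_)
    · have h1 : Continuous fun z : ℝ × ℝ => Complex.exp ((c + z.2 * Complex.I) ^ 3 / 3
          - ((x + z.1 : ℝ) : ℂ) * (c + z.2 * Complex.I)) := by fun_prop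
      exact h1.aestronglyMeasurable.mul
        (Complex.continuous_ofReal.comp_aestronglyMeasurable (Lp.aestronglyMeasurable f).comp_fst)
    · simp only [Function.uncurry, norm_mul, norm_cexp_cube_sub, Complex.norm_real,
        Real.norm_eq_abs, Real.abs_exp]
      apply le_of_eq
      rw [mul_right_comm, ← Real.exp_add]
      congr 2
      simp
      ring

/-- The Airy transform is an isometry up to the factor `√lam`: Bessel's inequality. The contour
is moved to the imaginary axis, where `exp(w³/3)` is unimodular. -/
theorem setIntegral_inner_airyVec_sq_le {lam : ℝ} (hlam : 0 ≤ lam) (s : ℝ) (f : L2Ray 0) :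
    ∫ x in Ioi s, inner ℝ (airyVec lam 0 x) f * inner ℝ (airyVec lam 0 x) f ≤ lam * ‖f‖ ^ 2 := by
  have key : ∀ c : ℝ, 0 < c → (∫ x in Ioi s, inner ℝ (airyVec lam 0 x) f *
      inner ℝ (airyVec lam 0 x) f) ≤ Real.exp (2 * c ^ 3 / 3 - 2 * c * s) * (lam * ‖f‖ ^ 2) := by
    intro c hc
    set F := FourierTransform.fourier (dampedExt c f) with hF
    set G : ℝ → ℂ := fun t => Complex.exp ((c + t * Complex.I) ^ 3 / 3) with hG
    have hGn : ∀ t, ‖G t‖ = Real.exp (c ^ 3 / 3 - c * t ^ 2) := by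
      intro t
      have := norm_cexp_cube_sub c t 0
      simpa using this
    have hGc : Continuous G := by fun_prop
    set h : ℝ → ℂ := fun v => G (2 * π * v) * F v with hh
    have hFc : Continuous F := continuous_fourier_dampedExt hc f
    have hhc : Continuous h := (hGc.comp (by fun_prop)).mul hFc
    obtain ⟨B, hB, hLB⟩ := exists_norm_lineLaplace_le c f
    have hFB : ∀ v, ‖F v‖ ≤ B := fun v => by rw [hF, fourier_dampedExt]; exact hLB _
    have hh1 : Integrable h := by
      have hg := (integrable_exp_neg_mul_sq (b := c * (2 * π) ^ 2) (by positivity)).const_mul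
        (Real.exp (c ^ 3 / 3) * B)
      refine hg.mono' hhc.aestronglyMeasurable (.of_forall fun v => ?_)
      rw [hh, norm_mul, hGn]
      calc _ ≤ Real.exp (c ^ 3 / 3 - c * (2 * π * v) ^ 2) * B := by gcongr; exact hFB v
        _ = B * Real.exp (c ^ 3 / 3 + -(c * (2 * π) ^ 2) * v ^ 2) := by ring_nf
        _ = _ := by rw [Real.exp_add]; ring
    have hFP := memLp_fourier_and_integral_norm_sq (integrable_dampedExt hc f)
      (memLp_dampedExt hc f)
    have hhF : ∀ v, ‖h v‖ ≤ Real.exp (c ^ 3 / 3) * ‖F v‖ := by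
      intro v
      rw [hh, norm_mul, hGn]
      gcongr
      have : 0 ≤ c * (2 * π * v) ^ 2 := by positivity
      linarith
    have hh2 : MemLp h 2 := by
      refine (hFP.1.const_mul (Real.exp (c ^ 3 / 3) : ℂ)).of_le hhc.aestronglyMeasurable
        (.of_forall fun v => ?_)
      refine (hhF v).trans (le_of_eq ?_)
      rw [norm_mul, Complex.norm_real, Real.norm_of_nonneg (Real.exp_pos _).le]
    have hhP := memLp_fourier_and_integral_norm_sq hh1 hh2
    have hrepr : ∀ x : ℝ, ((Real.exp (c * x) * inner ℝ (airyVec lam 0 x) f : ℝ) : ℂ)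
        = √lam * FourierTransform.fourier h x := by
      intro x
      rw [Complex.ofReal_mul, inner_airyVec_eq_integral_lineLaplace lam hc,
        Real.fourier_real_eq_integral_exp_smul]
      have hsub := Measure.integral_comp_mul_left (fun t : ℝ =>
        Complex.exp ((c + t * Complex.I) ^ 3 / 3 - x * (c + t * Complex.I)) * lineLaplace c f t)
        (2 * π)
      rw [abs_of_pos (by positivity)] at hsub
      have hsub' : (((2 * π)⁻¹ : ℝ) : ℂ) * ∫ t : ℝ,
          Complex.exp ((c + t * Complex.I) ^ 3 / 3 - x * (c + t * Complex.I)) * lineLaplace c f t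
          = ∫ v : ℝ, Complex.exp ((c + (2 * π * v : ℝ) * Complex.I) ^ 3 / 3
            - x * (c + (2 * π * v : ℝ) * Complex.I)) * lineLaplace c f (2 * π * v) := by
        rw [hsub, Complex.real_smul]
      rw [mul_assoc, hsub', mul_left_comm, ← integral_const_mul]
      congr 2
      ext v
      rw [hh, hG, smul_eq_mul, hF]
      beta_reduce
      rw [fourier_dampedExt, ← mul_assoc, ← mul_assoc, Complex.ofReal_exp,
        ← Complex.exp_add, ← Complex.exp_add]
      congr 2
      push_cast
      ring
    have hrepr2 : ∀ x : ℝ, Real.exp (2 * c * x) * (inner ℝ (airyVec lam 0 x) f *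
        inner ℝ (airyVec lam 0 x) f) = lam * ‖FourierTransform.fourier h x‖ ^ 2 := by
      intro x
      have := congrArg (fun z : ℂ => ‖z‖ ^ 2) (hrepr x)
      simp only [norm_mul, Complex.norm_real, Real.norm_eq_abs, mul_pow, sq_abs,
        Real.sq_sqrt hlam] at this
      rw [← this, ← Real.exp_nat_mul]
      push_cast
      ring_nf
    have hint : Integrable fun x => lam * ‖FourierTransform.fourier h x‖ ^ 2 := by
      have := hhP.1.integrable_norm_pow (p := 2) (by norm_num)
      simpa using this.const_mul lam
    calc ∫ x in Ioi s, inner ℝ (airyVec lam 0 x) f * inner ℝ (airyVec lam 0 x) f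
        ≤ ∫ x in Ioi s, Real.exp (-(2 * c * s)) *
          (lam * ‖FourierTransform.fourier h x‖ ^ 2) := by
          refine integral_mono_of_nonneg (.of_forall fun x => mul_self_nonneg _)
            (hint.integrableOn.const_mul _) ?_
          filter_upwards [ae_restrict_mem measurableSet_Ioi] with x hx
          rw [← hrepr2, ← mul_assoc, ← Real.exp_add]
          refine le_mul_of_one_le_left (mul_self_nonneg _) (Real.one_le_exp ?_)
          have := mem_Ioi.1 hx
          nlinarith
      _ = Real.exp (-(2 * c * s)) * ∫ x in Ioi s, lam * ‖FourierTransform.fourier h x‖ ^ 2 :=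
          integral_const_mul _ _
      _ ≤ Real.exp (-(2 * c * s)) * ∫ x, lam * ‖FourierTransform.fourier h x‖ ^ 2 := by
          refine mul_le_mul_of_nonneg_left ?_ (Real.exp_pos _).le
          exact setIntegral_le_integral hint
            (.of_forall fun x => mul_nonneg hlam (sq_nonneg _))
      _ = Real.exp (-(2 * c * s)) * (lam * ∫ v, ‖h v‖ ^ 2) := by
          rw [integral_const_mul, hhP.2]
      _ ≤ Real.exp (-(2 * c * s)) * (lam * ∫ v, Real.exp (2 * c ^ 3 / 3) * ‖F v‖ ^ 2) := by
          gcongr ?_ * (lam * ?_)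
          refine integral_mono_of_nonneg (.of_forall fun x => by positivity)
            ((by simpa using hFP.1.integrable_norm_pow (p := 2) (by norm_num) :
              Integrable fun v => ‖F v‖ ^ 2).const_mul _) (.of_forall fun v => ?_)
          calc ‖h v‖ ^ 2 ≤ (Real.exp (c ^ 3 / 3) * ‖F v‖) ^ 2 := by gcongr; exact hhF v
            _ = _ := by rw [mul_pow, ← Real.exp_nat_mul]; push_cast; ring_nf
      _ = Real.exp (-(2 * c * s)) * (lam * (Real.exp (2 * c ^ 3 / 3) *
            ∫ v, ‖dampedExt c f v‖ ^ 2)) := by rw [integral_const_mul, hFP.2]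
      _ ≤ Real.exp (-(2 * c * s)) * (lam * (Real.exp (2 * c ^ 3 / 3) * ‖f‖ ^ 2)) := by
          gcongr
          exact integral_norm_sq_dampedExt_le hc f
      _ = (Real.exp (2 * c ^ 3 / 3) * Real.exp (-(2 * c * s))) * (lam * ‖f‖ ^ 2) := by ring
      _ = _ := by rw [← Real.exp_add]; ring_nf
  have hlim : Tendsto (fun c : ℝ => Real.exp (2 * c ^ 3 / 3 - 2 * c * s) * (lam * ‖f‖ ^ 2))
      (𝓝[>] 0) (𝓝 (lam * ‖f‖ ^ 2)) := by
    have : Continuous fun c : ℝ => Real.exp (2 * c ^ 3 / 3 - 2 * c * s) * (lam * ‖f‖ ^ 2) := by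
      fun_prop
    have h2 := this.tendsto 0
    simp only [ne_eq, OfNat.ofNat_ne_zero, not_false_eq_true, zero_pow, mul_zero, zero_div,
      zero_mul, sub_zero, Real.exp_zero, one_mul] at h2
    exact h2.mono_left nhdsWithin_le_nhds
  refine ge_of_tendsto hlim ?_
  filter_upwards [self_mem_nhdsWithin] with c hc
  exact key c hc

/-! ### Invertibility for `lam ≤ 1` -/

theorem eq_zero_of_forall_ofReal_Ioo {F : ℂ → ℂ} (hF : Differentiable ℂ F) {a b : ℝ} (hab : a < b)
    (h : ∀ x ∈ Ioo a b, F (x : ℝ) = 0) (z : ℂ) : F z = 0 := by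
  have han : AnalyticOnNhd ℂ F univ := fun w _ => hF.analyticAt w
  set x₀ := (a + b) / 2
  have hx₀ : x₀ ∈ Ioo a b := ⟨by simp only [x₀]; linarith, by simp only [x₀]; linarith⟩
  have hfreq : ∃ᶠ w in 𝓝[≠] (x₀ : ℂ), F w = 0 := by
    have ht : Tendsto (fun x : ℝ => (x : ℂ)) (𝓝[≠] x₀) (𝓝[≠] (x₀ : ℂ)) := by
      refine tendsto_nhdsWithin_iff.2 ⟨(Complex.continuous_ofReal.tendsto x₀).mono_left
        nhdsWithin_le_nhds, ?_⟩
      filter_upwards [self_mem_nhdsWithin] with x hx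
      simpa using hx
    refine ht.frequently (Eventually.frequently ?_)
    filter_upwards [mem_nhdsWithin_of_mem_nhds (Ioo_mem_nhds hx₀.1 hx₀.2)] with x hx
    exact h x hx
  exact han.eqOn_zero_of_preconnected_of_frequently_eq_zero isPreconnected_univ (mem_univ _) hfreq
    (mem_univ z)

/-- Pairing with a translate of the Airy function extends to an entire function of the
translation. -/
theorem differentiable_integral_airy_mul {L : ℝ → ℂ} (hL : Continuous L) {B : ℝ}
    (hB : ∀ t, ‖L t‖ ≤ B) : Differentiable ℂ fun z : ℂ =>
      ∫ t : ℝ, Complex.exp ((1 + t * Complex.I) ^ 3 / 3 - z * (1 + t * Complex.I)) * L t := by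
  intro z
  have hB0 : 0 ≤ B := (norm_nonneg _).trans (hB 0)
  have hc : ∀ (n : ℕ) (w : ℂ), Continuous fun t : ℝ => ((1 + t * Complex.I : ℂ) ^ n *
      Complex.exp ((1 + t * Complex.I) ^ 3 / 3 - w * (1 + t * Complex.I))) * L t :=
    fun n w => (continuous_airyMoment_integrand n w).mul hL
  have hbd : ∀ (n : ℕ) (R t : ℝ) (w : ℂ), ‖w‖ ≤ R → ‖((1 + t * Complex.I : ℂ) ^ n *
      Complex.exp ((1 + t * Complex.I) ^ 3 / 3 - w * (1 + t * Complex.I))) * L t‖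
      ≤ (n ! * Real.exp (4 / 3 + R + (R + 1) ^ 2 / 2) * B) * Real.exp (-(1 / 2) * t ^ 2) := by
    intro n R t w hw
    rw [norm_mul]
    calc _ ≤ (n ! * Real.exp (4 / 3 + R + (R + 1) ^ 2 / 2) * Real.exp (-(1 / 2) * t ^ 2)) * B := by
          gcongr
          · exact norm_airyMoment_integrand_le n R t w hw
          · exact hB t
      _ = _ := by ring
  refine (hasDerivAt_integral_of_dominated_loc_of_deriv_le (𝕜 := ℂ) (E := ℂ)
    (F := fun (w : ℂ) (t : ℝ) =>
      Complex.exp ((1 + t * Complex.I) ^ 3 / 3 - w * (1 + t * Complex.I)) * L t)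
    (F' := fun (w : ℂ) (t : ℝ) => -(((1 + t * Complex.I : ℂ) ^ 1 *
      Complex.exp ((1 + t * Complex.I) ^ 3 / 3 - w * (1 + t * Complex.I))) * L t))
    (μ := volume) (s := Metric.ball z 1) (Metric.ball_mem_nhds z one_pos) ?_ ?_ ?_
    (.of_forall fun t w hw => ?_)
    (integrable_gaussian_half (1 ! * Real.exp (4 / 3 + (‖z‖ + 1) + ((‖z‖ + 1) + 1) ^ 2 / 2) * B))
    (.of_forall fun t w _ => ?_)).2.differentiableAt
  · exact .of_forall fun w => (by simpa using hc 0 w : Continuous _).aestronglyMeasurable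
  · refine (integrable_gaussian_half
      (0 ! * Real.exp (4 / 3 + ‖z‖ + (‖z‖ + 1) ^ 2 / 2) * B)).mono'
      (by simpa using hc 0 z : Continuous _).aestronglyMeasurable (.of_forall fun t => ?_)
    simpa using hbd 0 ‖z‖ t z le_rfl
  · exact (hc 1 z).neg.aestronglyMeasurable
  · rw [norm_neg]
    refine hbd 1 _ t w ?_
    have : ‖w - z‖ < 1 := by simpa [dist_eq_norm] using hw
    calc ‖w‖ = ‖z + (w - z)‖ := by ring_nf
      _ ≤ _ := (norm_add_le _ _).trans (by linarith)
  · refine ((((hasDerivAt_id w).mul_const (1 + t * Complex.I : ℂ)).const_sub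
      ((1 + t * Complex.I : ℂ) ^ 3 / 3)).cexp.mul_const (L t)).congr_deriv ?_
    simp only [id]
    ring

/-- Unique continuation: a vector orthogonal to all translates `A(x + ·)`, `x < s`, is orthogonal
to every translate. -/
theorem inner_airyVec_eq_zero_of_forall_lt (lam : ℝ) {s : ℝ} (f : L2Ray 0)
    (h : ∀ x < s, inner ℝ (airyVec lam 0 x) f = 0) (x : ℝ) :
    inner ℝ (airyVec lam 0 x) f = 0 := by
  obtain ⟨B, hB, hLB⟩ := exists_norm_lineLaplace_le 1 f
  have hd := (differentiable_integral_airy_mul (continuous_lineLaplace one_pos f) hLB).const_mul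
    (√lam * (2 * π)⁻¹ : ℂ)
  have hrep : ∀ x : ℝ, ((inner ℝ (airyVec lam 0 x) f : ℝ) : ℂ) = √lam * (2 * π)⁻¹ *
      ∫ t : ℝ, Complex.exp ((1 + t * Complex.I) ^ 3 / 3 - x * (1 + t * Complex.I))
        * lineLaplace 1 f t := by
    intro x
    have := inner_airyVec_eq_integral_lineLaplace lam one_pos x f
    rw [Complex.ofReal_one] at this
    exact this
  have := eq_zero_of_forall_ofReal_Ioo hd (sub_one_lt s)
    (fun y hy => by rw [← hrep, h y hy.2, Complex.ofReal_zero]) x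
  rw [← hrep] at this
  exact_mod_cast this

theorem isCompactOperator_airyRankOne (lam t : ℝ) : IsCompactOperator (airyRankOne lam t) := by
  rw [airyRankOne, InnerProductSpace.rankOne_def']
  exact (isCompactOperator_of_locallyCompactSpace_rng
    (ContinuousLinearMap.toSpanSingleton ℝ (airyVec lam 0 t))).comp_clm _

theorem integral_mem_of_isClosed_submodule {B X : Type*} [NormedAddCommGroup B] [NormedSpace ℝ B]
    [CompleteSpace B] [TopologicalSpace X] [SecondCountableTopology X] [MeasurableSpace X]
    [OpensMeasurableSpace X] {μ : Measure X} (V : Submodule ℝ B) (hV : IsClosed (V : Set B))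
    {F : X → B} (hFc : Continuous F) (hF : Integrable F μ) (h : ∀ x, F x ∈ V) :
    ∫ x, F x ∂μ ∈ V := by
  have : CompleteSpace V := hV.completeSpace_coe
  set G : X → V := fun x => ⟨F x, h x⟩
  have hGc : Continuous G := hFc.subtype_mk h
  have hG : Integrable G μ := by
    refine hF.norm.mono' ?_ (.of_forall fun x => le_rfl)
    exact (V.subtypeₗᵢ.isometry.isEmbedding.aestronglyMeasurable_comp_iff).1
      hF.aestronglyMeasurable
  have := V.subtypeL.integral_comp_comm hG
  change ∫ x, F x ∂μ = _ at this
  rw [this]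
  exact (∫ x, G x ∂μ).2

theorem isCompactOperator_airyShiftOp (lam s : ℝ) : IsCompactOperator (airyShiftOp lam s) := by
  rw [airyShiftOp_eq_integral]
  exact integral_mem_of_isClosed_submodule (compactOperator (RingHom.id ℝ) (L2Ray 0) (L2Ray 0))
    isClosed_setOfPred_isCompactOperator (continuous_airyRankOne lam)
    (integrableOn_airyRankOne lam s) (isCompactOperator_airyRankOne lam)

/-- For `lam ≤ 1` the number `1` is not an eigenvalue of the Airy operator: an eigenvector would
be orthogonal to all `A(t + ·)` with `t < s`, hence to all translates of `A`. -/
theorem eq_zero_of_airyShiftOp_apply_eq_self {lam : ℝ} (h0 : 0 ≤ lam) (h1 : lam ≤ 1) {s : ℝ}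
    {f : L2Ray 0} (hf : airyShiftOp lam s f = f) : f = 0 := by
  set F : ℝ → ℝ := fun x => inner ℝ (airyVec lam 0 x) f * inner ℝ (airyVec lam 0 x) f
  have hFc : Continuous F := ((continuous_airyVec lam 0).inner continuous_const).mul
    ((continuous_airyVec lam 0).inner continuous_const)
  have hs : ∫ x in Ioi s, F x = ‖f‖ ^ 2 := by
    rw [← real_inner_self_eq_norm_sq]
    conv_rhs => rw [← hf, hf]
    conv_rhs => enter [2]; rw [← hf]
    exact (inner_airyShiftOp_left lam s f f).symm
  have hFi : ∀ x, IntegrableOn F (Ioi x) := by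
    obtain ⟨C, hC, h⟩ := exists_norm_airyVec_le lam 0
    refine integrableOn_Ioi_of_norm_le_exp hFc (C := (C * ‖f‖) ^ 2) (b := 2) (by norm_num)
      fun t => ?_
    have h3 : |inner ℝ (airyVec lam 0 t) f| ≤ (C * Real.exp (-t)) * ‖f‖ :=
      (abs_real_inner_le_norm _ _).trans (by gcongr; exact h t)
    calc ‖F t‖ = |inner ℝ (airyVec lam 0 t) f| * |inner ℝ (airyVec lam 0 t) f| := norm_mul _ _
      _ ≤ ((C * Real.exp (-t)) * ‖f‖) * ((C * Real.exp (-t)) * ‖f‖) := by gcongr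
      _ = (C * ‖f‖) ^ 2 * (Real.exp (-t) * Real.exp (-t)) := by ring
      _ = _ := by rw [← Real.exp_add]; ring_nf
  -- The mass of `F` on `(x, ∞)` is at most `‖f‖²` for every `x`, and it is `‖f‖²` for `x = s`.
  have hconst : ∀ x ≤ s, ∫ t in Ioi x, F t = ‖f‖ ^ 2 := by
    intro x hx
    refine le_antisymm ((setIntegral_inner_airyVec_sq_le h0 x f).trans
      (mul_le_of_le_one_left (sq_nonneg _) h1)) ?_
    rw [← hs]
    exact setIntegral_mono_set (hFi x) (.of_forall fun t => mul_self_nonneg _)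
      (Ioi_subset_Ioi hx).eventuallyLE
  have hzero : ∀ x < s, F x = 0 := by
    intro x hx
    have hd := hasDerivAt_setIntegral_Ioi hFc hFi x
    have hev : (fun x => ∫ t in Ioi x, F t) =ᶠ[𝓝 x] fun _ => ‖f‖ ^ 2 := by
      filter_upwards [Iio_mem_nhds hx] with y hy
      exact hconst y (le_of_lt hy)
    have := hd.unique ((hasDerivAt_const x (‖f‖ ^ 2)).congr_of_eventuallyEq hev)
    linarith
  have hall := inner_airyVec_eq_zero_of_forall_lt lam f fun x hx => mul_self_eq_zero.1 (hzero x hx)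
  have : ∫ x in Ioi s, F x = 0 := by simp [F, hall]
  rw [hs] at this
  simpa using this

/-- The Fredholm alternative for the compact operator `K`. -/
theorem isUnit_one_sub_airyShiftOp_of_le_one {lam : ℝ} (h0 : 0 ≤ lam) (h1 : lam ≤ 1) (s : ℝ) :
    IsUnit (1 - airyShiftOp lam s) := by
  rcases (isCompactOperator_airyShiftOp lam s).hasEigenvalue_or_mem_resolventSet
    (one_ne_zero (α := ℝ)) with h | h
  · obtain ⟨f, hf⟩ := h.exists_hasEigenvector
    have := hf.apply_eq_smul
    rw [one_smul] at this
    exact absurd (eq_zero_of_airyShiftOp_apply_eq_self h0 h1 this) hf.2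
  · rw [spectrum.mem_resolventSet_iff] at h
    simpa using h

/-! ### Behaviour at infinity -/

theorem tendsto_norm_airyHankel (lam : ℝ) : Tendsto (fun s => ‖airyHankel lam s‖) atTop (𝓝 0) := by
  obtain ⟨C, hC, h⟩ := exists_norm_airyHankel_le lam
  have h1 : Tendsto (fun x : ℝ => C * Real.exp (-x)) atTop (𝓝 (C * 0)) :=
    Real.tendsto_exp_neg_atTop_nhds_zero.const_mul C
  rw [mul_zero] at h1
  exact squeeze_zero (fun _ => norm_nonneg _) h h1

theorem eventually_norm_airyShiftOp_le (lam : ℝ) :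
    ∀ᶠ s in atTop, ‖airyShiftOp lam s‖ ≤ 1 / 2 := by
  have h := (tendsto_norm_airyHankel lam).mul (tendsto_norm_airyHankel lam)
  rw [mul_zero] at h
  filter_upwards [h.eventually_le_const (by norm_num : (0 : ℝ) < 1 / 2)] with s hs
  exact (norm_mul_le _ _).trans hs

theorem isUnit_one_sub_airyShiftOp_of_norm_le {lam s : ℝ} (h : ‖airyShiftOp lam s‖ ≤ 1 / 2) :
    IsUnit (1 - airyShiftOp lam s) :=
  isUnit_one_sub_of_norm_lt_one (h.trans_lt (by norm_num))

theorem norm_airyRes_apply_le {lam s : ℝ} (h : ‖airyShiftOp lam s‖ ≤ 1 / 2) (f : L2Ray 0) :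
    ‖airyRes lam s f‖ ≤ 2 * ‖f‖ := by
  have h1 := airyRes_right (isUnit_one_sub_airyShiftOp_of_norm_le h) f
  rw [sub_eq_iff_eq_add] at h1
  have h2 : ‖airyShiftOp lam s (airyRes lam s f)‖ ≤ 1 / 2 * ‖airyRes lam s f‖ :=
    (airyShiftOp lam s).le_of_opNorm_le h _
  have h3 : ‖airyRes lam s f‖ ≤ ‖f‖ + ‖airyShiftOp lam s (airyRes lam s f)‖ := by
    conv_lhs => rw [h1]
    exact norm_add_le _ _
  linarith

theorem exists_abs_scalars_le_exp_neg (lam : ℝ) : ∃ C : ℝ, 0 < C ∧ ∀ᶠ s in atTop,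
    |scalarQ lam s| ≤ C * Real.exp (-s) ∧ |scalarQ' lam s| ≤ C * Real.exp (-s) ∧
    |scalarU lam s| ≤ C * Real.exp (-s) ∧ |scalarR lam s| ≤ C * Real.exp (-s) := by
  obtain ⟨C₁, p₁, h₁⟩ := exists_abs_airyD_le lam 0
  obtain ⟨C₂, p₂, h₂⟩ := exists_abs_airyD_le lam 1
  obtain ⟨C₃, p₃, h₃⟩ := exists_norm_airyVec_le lam 0
  obtain ⟨C₄, p₄, h₄⟩ := exists_norm_airyVec_le lam 1
  obtain ⟨C₅, p₅, h₅⟩ := exists_norm_airyHankel_le lam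
  set M := 1 + C₁ + C₂ + C₃ + C₄ + C₅ with hM
  have hM1 : 1 ≤ M := by linarith
  refine ⟨3 * M ^ 4, by positivity, ?_⟩
  filter_upwards [eventually_norm_airyShiftOp_le lam, eventually_ge_atTop 0] with s hs hs0
  have hw0 : M * Real.exp (-s) ≤ M :=
    mul_le_of_le_one_right (by linarith) (Real.exp_le_one_iff.2 (by linarith))
  have hw : ∀ c : ℝ, c ≤ M → c * Real.exp (-s) ≤ M * Real.exp (-s) := fun c hc =>
    mul_le_mul_of_nonneg_right hc (Real.exp_pos _).le
  have a0 : |airyD lam 0 s| ≤ M * Real.exp (-s) := (h₁ s).trans (hw _ (by linarith))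
  have a1 : |airyD lam 1 s| ≤ M * Real.exp (-s) := (h₂ s).trans (hw _ (by linarith))
  have v0 : ‖airyVec lam 0 s‖ ≤ M * Real.exp (-s) := (h₃ s).trans (hw _ (by linarith))
  have v1 : ‖airyVec lam 1 s‖ ≤ M * Real.exp (-s) := (h₄ s).trans (hw _ (by linarith))
  have v0' : ‖airyVec lam 0 s‖ ≤ M := v0.trans hw0
  have hH : ‖airyHankel lam s‖ ≤ M := (h₅ s).trans ((hw _ (by linarith)).trans hw0)
  have hκ : ‖airyKernelVec lam s‖ ≤ M ^ 2 :=
    ((airyHankel lam s).le_opNorm _).trans (by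
      rw [pow_two]; exact mul_le_mul hH v0' (norm_nonneg _) (by linarith))
  have hκ' : ‖airyKernelVec lam s‖ ≤ M * (M * Real.exp (-s)) :=
    ((airyHankel lam s).le_opNorm _).trans (mul_le_mul hH v0 (norm_nonneg _) (by linarith))
  have hQ : ‖airyQvec lam s‖ ≤ 2 * M := (norm_airyRes_apply_le hs _).trans (by linarith)
  have hP : ‖airyPvec lam s‖ ≤ 2 * M ^ 2 := (norm_airyRes_apply_le hs _).trans (by linarith)
  have hi : ∀ {x y : L2Ray 0} {a b : ℝ}, ‖x‖ ≤ a → ‖y‖ ≤ b → |inner ℝ x y| ≤ a * b :=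
    fun hx hy => (abs_real_inner_le_norm _ _).trans
      (mul_le_mul hx hy (norm_nonneg _) ((norm_nonneg _).trans hx))
  have e0 := Real.exp_pos (-s)
  have hpow : ∀ k ≤ 4, M ^ k * Real.exp (-s) ≤ M ^ 4 * Real.exp (-s) := fun k hk =>
    mul_le_mul_of_nonneg_right (pow_le_pow_right₀ hM1 hk) e0.le
  have k0 : 0 ≤ M ^ 4 * Real.exp (-s) := by positivity
  have k1 := hpow 1 (by norm_num)
  have k2 := hpow 2 (by norm_num)
  have k3 := hpow 3 (by norm_num)
  refine ⟨?_, ?_, ?_, ?_⟩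
  · refine (abs_add_le _ _).trans ((add_le_add a0 (hi v0 hP)).trans ?_)
    linarith
  · refine (abs_add_le _ _).trans ((add_le_add a1 (hi v1 hP)).trans ?_)
    linarith
  · refine (hi v0 hQ).trans ?_
    linarith
  · refine (abs_add_le _ _).trans ((add_le_add (hi v0 v0') (hi hκ' hP)).trans ?_)
    linarith

theorem airyD_zero_mul_airyD_one_nonpos (lam : ℝ) {x : ℝ} (hx : 0 ≤ x) :
    airyD lam 0 x * airyD lam 1 x ≤ 0 := by
  have hd : ∀ t, HasDerivAt (fun t => airyD lam 0 t * airyD lam 1 t)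
      (airyD lam 1 t ^ 2 + t * airyD lam 0 t ^ 2) t := fun t => by
    refine ((hasDerivAt_airyD lam 0 t).mul (hasDerivAt_airyD lam 1 t)).congr_deriv ?_
    rw [zero_add, airyD_two]
    ring
  have hmono : MonotoneOn (fun t => airyD lam 0 t * airyD lam 1 t) (Ici 0) := by
    refine monotoneOn_of_hasDerivWithinAt_nonneg (convex_Ici 0)
      (fun t _ => (hd t).continuousAt.continuousWithinAt) (fun t _ => (hd t).hasDerivWithinAt) ?_
    intro t ht
    rw [interior_Ici] at ht
    have : 0 < t := ht
    positivity
  have hlim : Tendsto (fun t => airyD lam 0 t * airyD lam 1 t) atTop (𝓝 0) := by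
    simpa using (tendsto_airyD_add_atTop lam 0 0).mul (tendsto_airyD_add_atTop lam 1 0)
  refine ge_of_tendsto hlim ?_
  filter_upwards [eventually_ge_atTop x] with y hy
  exact hmono hx (hx.trans hy) hy

/-- On the half-line where the Airy equation is `A'' = x A` with `x ≥ 0`, the modulus of a solution
that decays at infinity is decreasing. -/
theorem abs_airyD_zero_le {lam x y : ℝ} (hx : 0 ≤ x) (hxy : x ≤ y) :
    |airyD lam 0 y| ≤ |airyD lam 0 x| := by
  have hanti : AntitoneOn (fun t => airyD lam 0 t ^ 2) (Ici 0) := by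
    refine antitoneOn_of_hasDerivWithinAt_nonpos (convex_Ici 0)
      ((continuous_airyD lam 0).pow 2).continuousOn
      (fun t _ => ((hasDerivAt_airyD lam 0 t).fun_pow 2).hasDerivWithinAt) ?_
    intro t ht
    rw [interior_Ici] at ht
    have := airyD_zero_mul_airyD_one_nonpos lam (le_of_lt ht)
    simp only [Nat.cast_ofNat, Nat.add_one_sub_one, pow_one, zero_add]
    linarith
  exact sq_le_sq.1 (hanti hx (hx.trans hxy) hxy)

theorem exists_norm_airyVec_sq_le (lam : ℝ) :
    ∃ C : ℝ, 0 < C ∧ ∀ s, 0 ≤ s → ‖airyVec lam 0 s‖ ^ 2 ≤ C * |airyD lam 0 s| := by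
  obtain ⟨C, hC, h⟩ := exists_abs_airyD_le lam 0
  refine ⟨C, hC, fun s hs => ?_⟩
  rw [← real_inner_self_eq_norm_sq, airyVec,
    inner_toL2Ray_toL2Ray (memLp_airyD lam 0 s) (memLp_airyD lam 0 s)]
  have h1 : ∫ x in Ioi (0 : ℝ), airyD lam 0 (s + x) * airyD lam 0 (s + x)
      ≤ ∫ x in Ioi (0 : ℝ), |airyD lam 0 s| * (C * Real.exp (-x)) := by
    refine setIntegral_mono_on (L2Ray.integrable_mul (memLp_airyD lam 0 s) (memLp_airyD lam 0 s))
      (((integrableOn_exp_neg_Ioi 0).const_mul C).const_mul _) measurableSet_Ioi fun x hx => ?_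
    have hx' : 0 < x := hx
    refine (le_abs_self _).trans ?_
    rw [abs_mul]
    refine mul_le_mul (abs_airyD_zero_le hs (by linarith)) ((h _).trans ?_) (abs_nonneg _)
      (abs_nonneg _)
    exact mul_le_mul_of_nonneg_left (Real.exp_le_exp.2 (by linarith)) hC.le
  refine h1.trans (le_of_eq ?_)
  rw [integral_const_mul, integral_const_mul, integral_exp_neg_Ioi_zero]
  ring

/-- Since `q - A = ⟨A, H Q⟩` on the half-line, it is bounded by `2 ‖H‖ ‖A(s + ·)‖²`, where `‖H‖`
tends to zero and the other factor is `O(A(s))` by monotonicity. -/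
theorem isEquivalent_scalarQ (lam : ℝ) : scalarQ lam ~[atTop] airyA lam := by
  obtain ⟨C, hC, h⟩ := exists_norm_airyVec_sq_le lam
  rw [← airyD_zero]
  have hb : ∀ᶠ s in atTop, ‖(scalarQ lam - airyD lam 0) s‖
      ≤ ‖airyHankel lam s‖ * (2 * C) * ‖airyD lam 0 s‖ := by
    filter_upwards [eventually_norm_airyShiftOp_le lam, eventually_ge_atTop 0] with s hs hs0
    have h1 : (scalarQ lam - airyD lam 0) s
        = inner ℝ (airyVec lam 0 s) (airyHankel lam s (airyQvec lam s)) := by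
      rw [Pi.sub_apply, scalarQ, add_sub_cancel_left,
        airyPvec_eq_airyHankel (isUnit_one_sub_airyShiftOp_of_norm_le hs)]
    rw [h1]
    have h2 : ‖airyHankel lam s (airyQvec lam s)‖ ≤ ‖airyHankel lam s‖ * (2 * ‖airyVec lam 0 s‖) :=
      ((airyHankel lam s).le_opNorm _).trans
        (mul_le_mul_of_nonneg_left (norm_airyRes_apply_le hs _) (norm_nonneg _))
    calc _ ≤ ‖airyVec lam 0 s‖ * (‖airyHankel lam s‖ * (2 * ‖airyVec lam 0 s‖)) :=
          (abs_real_inner_le_norm _ _).trans (mul_le_mul_of_nonneg_left h2 (norm_nonneg _))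
      _ = ‖airyHankel lam s‖ * 2 * ‖airyVec lam 0 s‖ ^ 2 := by ring
      _ ≤ ‖airyHankel lam s‖ * 2 * (C * |airyD lam 0 s|) :=
          mul_le_mul_of_nonneg_left (h s hs0) (by positivity)
      _ = _ := by rw [Real.norm_eq_abs]; ring
  refine isLittleO_iff.2 fun c hc => ?_
  have h0 := (tendsto_norm_airyHankel lam).mul_const (2 * C)
  rw [zero_mul] at h0
  filter_upwards [hb, h0.eventually_le_const hc] with s hs hs'
  exact hs.trans (mul_le_mul_of_nonneg_right hs' (norm_nonneg _))

/-- The Hamiltonian of the second Painlevé equation along `q`; it equals `R`. -/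
theorem scalarR_eq_hamiltonian {lam s : ℝ} (h : ∀ x, s ≤ x → IsUnit (1 - airyShiftOp lam x)) :
    scalarR lam s
      = (scalarQ' lam s - scalarQ lam s * scalarU lam s) ^ 2 - s * scalarQ lam s ^ 2
        - scalarQ lam s ^ 4 := by
  set F : ℝ → ℝ := fun s => scalarR lam s
    - ((scalarQ' lam s - scalarQ lam s * scalarU lam s) ^ 2 - s * scalarQ lam s ^ 2
      - scalarQ lam s ^ 4) with hF
  have hd : ∀ x, s ≤ x → HasDerivAt F 0 x := fun x hx => by
    refine ((hasDerivAt_scalarR (h x hx)).fun_sub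
      (((hasDerivAt_deriv_scalarQ (h x hx)).fun_pow 2).fun_sub
      ((hasDerivAt_id x).fun_mul ((hasDerivAt_scalarQ (h x hx)).fun_pow 2)) |>.fun_sub
      ((hasDerivAt_scalarQ (h x hx)).fun_pow 4))).congr_deriv ?_
    simp only [id]
    push_cast
    ring
  have hconst : ∀ x, s ≤ x → F x = F s := fun x hx => by
    refine constant_of_has_deriv_right_zero (a := s) (b := x)
      (fun y hy => (hd y hy.1).continuousAt.continuousWithinAt)
      (fun y hy => (hd y hy.1).hasDerivWithinAt) x ⟨hx, le_rfl⟩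
  obtain ⟨C, hC, hb⟩ := exists_abs_scalars_le_exp_neg lam
  have he : Tendsto (fun s : ℝ => C * Real.exp (-s)) atTop (𝓝 0) := by
    simpa using Real.tendsto_exp_neg_atTop_nhds_zero.const_mul C
  have t1 : Tendsto (scalarQ lam) atTop (𝓝 0) :=
    squeeze_zero_norm' (hb.mono fun s hs => hs.1) he
  have t2 : Tendsto (scalarQ' lam) atTop (𝓝 0) :=
    squeeze_zero_norm' (hb.mono fun s hs => hs.2.1) he
  have t3 : Tendsto (scalarU lam) atTop (𝓝 0) :=
    squeeze_zero_norm' (hb.mono fun s hs => hs.2.2.1) he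
  have t4 : Tendsto (scalarR lam) atTop (𝓝 0) :=
    squeeze_zero_norm' (hb.mono fun s hs => hs.2.2.2) he
  have t5 : Tendsto (fun s => s * scalarQ lam s) atTop (𝓝 0) := by
    have hx : Tendsto (fun s : ℝ => C * (s ^ 1 * Real.exp (-s))) atTop (𝓝 0) := by
      simpa using (Real.tendsto_pow_mul_exp_neg_atTop_nhds_zero 1).const_mul C
    refine squeeze_zero_norm' ?_ hx
    filter_upwards [hb, eventually_ge_atTop 0] with x hx hx0
    rw [norm_mul, Real.norm_eq_abs, abs_of_nonneg hx0, Real.norm_eq_abs]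
    nlinarith [mul_le_mul_of_nonneg_left hx.1 hx0]
  have hlim : Tendsto F atTop (𝓝 0) := by
    have := t4.sub ((((t2.sub (t1.mul t3)).pow 2).sub (t5.mul t1)).sub (t1.pow 4))
    simp only [mul_zero, sub_zero, ne_eq, OfNat.ofNat_ne_zero, not_false_eq_true, zero_pow] at this
    refine this.congr fun x => ?_
    simp only [hF]
    ring
  have h0 : F s = 0 := by
    refine tendsto_nhds_unique (tendsto_const_nhds.congr' ?_) hlim
    filter_upwards [eventually_ge_atTop s] with x hx
    exact (hconst x hx).symm
  exact sub_eq_zero.1 h0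

/-! ### Regularity and the third-order equation -/

theorem contDiffAt_succ_of_hasDerivAt {f f' : ℝ → ℝ} {s : ℝ} {n : ℕ}
    (h : ∀ᶠ x in 𝓝 s, HasDerivAt f (f' x) x) (hf' : ContDiffAt ℝ n f' s) :
    ContDiffAt ℝ (n + 1 : ℕ) f s := by
  push_cast
  refine contDiffAt_succ_iff_hasFDerivAt.2
    ⟨fun x => ContinuousLinearMap.toSpanSingletonCLE (𝕜 := ℝ) (f' x), ⟨_, h, fun x hx => ?_⟩, ?_⟩
  · exact (hx : HasDerivAt f (f' x) x).hasFDerivAt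
  · exact (ContinuousLinearMap.toSpanSingletonCLE (𝕜 := ℝ) (E := ℝ)).contDiff.contDiffAt.comp s hf'

theorem eventually_isUnit_one_sub_airyShiftOp {lam s : ℝ} (h : IsUnit (1 - airyShiftOp lam s)) :
    ∀ᶠ x in 𝓝 s, IsUnit (1 - airyShiftOp lam x) :=
  (isOpen_isUnit_airyShiftOp lam).mem_nhds h

theorem contDiffAt_two_scalarQ {lam s : ℝ} (h : IsUnit (1 - airyShiftOp lam s)) :
    ContDiffAt ℝ 2 (scalarQ lam) s := by
  have hU := eventually_isUnit_one_sub_airyShiftOp h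
  have hq : ∀ᶠ x in 𝓝 s,
      HasDerivAt (scalarQ lam) (scalarQ' lam x - scalarQ lam x * scalarU lam x) x :=
    hU.mono fun x hx => hasDerivAt_scalarQ hx
  have h0 : ContDiffAt ℝ (0 : ℕ) (fun x => x * scalarQ lam x + 2 * scalarQ lam x ^ 3) s := by
    refine contDiffAt_zero.2 ⟨_, hU, fun x hx => ContinuousAt.continuousWithinAt ?_⟩
    have := (hasDerivAt_scalarQ hx).continuousAt
    fun_prop
  have h1 := contDiffAt_succ_of_hasDerivAt (hU.mono fun x hx => hasDerivAt_deriv_scalarQ hx) h0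
  exact_mod_cast contDiffAt_succ_of_hasDerivAt hq h1

theorem contDiffAt_three_scalarR {lam s : ℝ} (h : IsUnit (1 - airyShiftOp lam s)) :
    ContDiffAt ℝ 3 (scalarR lam) s := by
  have h2 : ContDiffAt ℝ (2 : ℕ) (fun x => -(scalarQ lam x) ^ 2) s := by
    exact_mod_cast ((contDiffAt_two_scalarQ h).pow 2).neg
  exact_mod_cast contDiffAt_succ_of_hasDerivAt
    ((eventually_isUnit_one_sub_airyShiftOp h).mono fun x hx => hasDerivAt_scalarR hx) h2

theorem deriv_deriv_scalarQ {lam s : ℝ} (h : IsUnit (1 - airyShiftOp lam s)) :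
    deriv (deriv (scalarQ lam)) s = s * scalarQ lam s + 2 * scalarQ lam s ^ 3 := by
  have : deriv (scalarQ lam) =ᶠ[𝓝 s] fun x => scalarQ' lam x - scalarQ lam x * scalarU lam x :=
    (eventually_isUnit_one_sub_airyShiftOp h).mono fun x hx => (hasDerivAt_scalarQ hx).deriv
  rw [this.deriv_eq, (hasDerivAt_deriv_scalarQ h).deriv]

/-- Since `R' = -q²`, the quotient `R'' / R'` is `2 q' / q`, and the equation is the Painlevé
equation for `q` combined with the first integral `scalarR_eq_hamiltonian`. -/
theorem third_order_scalarR {lam s : ℝ} (h : ∀ x, s ≤ x → IsUnit (1 - airyShiftOp lam x))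
    (h0 : deriv (scalarR lam) s ≠ 0) :
    1 / 2 * deriv (fun x => deriv (deriv (scalarR lam)) x / deriv (scalarR lam) x) s
      - scalarR lam s / deriv (scalarR lam) s + deriv (scalarR lam) s = 0 := by
  have hU := eventually_isUnit_one_sub_airyShiftOp (h s le_rfl)
  have hR : ∀ᶠ x in 𝓝 s, deriv (scalarR lam) x = -(scalarQ lam x) ^ 2 :=
    hU.mono fun x hx => (hasDerivAt_scalarR hx).deriv
  have hquot : (fun x => deriv (deriv (scalarR lam)) x / deriv (scalarR lam) x)
      =ᶠ[𝓝 s] fun x => 2 * (scalarQ' lam x - scalarQ lam x * scalarU lam x) / scalarQ lam x := by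
    filter_upwards [hR.eventually_nhds, hU] with x hx hux
    rw [Filter.EventuallyEq.deriv_eq hx, hx.self_of_nhds,
      ((hasDerivAt_scalarQ hux).fun_pow 2).fun_neg.deriv]
    rcases eq_or_ne (scalarQ lam x) 0 with hz | hz
    · simp [hz]
    · field_simp
      push_cast
      ring
  rw [hR.self_of_nhds] at h0 ⊢
  have hq0 : scalarQ lam s ≠ 0 := fun hz => h0 (by simp [hz])
  rw [hquot.deriv_eq, (((hasDerivAt_deriv_scalarQ (h s le_rfl)).const_mul 2).fun_div
    (hasDerivAt_scalarQ (h s le_rfl)) hq0).deriv, scalarR_eq_hamiltonian h]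
  field_simp
  ring

/-! ### Hadamard's inequality and bordered determinants -/

/-- **Hadamard's inequality** for the rows of a real matrix. -/
theorem abs_det_le_prod_norm_row {n : ℕ} (M : Matrix (Fin n) (Fin n) ℝ) :
    |M.det| ≤ ∏ i, ‖WithLp.toLp 2 (M i)‖ := by
  set b := EuclideanSpace.basisFun (Fin n) ℝ
  have : Fact (Module.finrank ℝ (EuclideanSpace ℝ (Fin n)) = n) := ⟨by simp⟩
  have h := b.toBasis.orientation.abs_volumeForm_apply_le fun i => WithLp.toLp 2 (M i)
  rw [Orientation.volumeForm_robust' _ b, Module.Basis.det_apply] at h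
  convert h using 2
  rw [← Matrix.det_transpose]
  congr 1

/-- Hadamard's inequality for a matrix whose entries are dominated by those of a matrix of rank
one. -/
theorem abs_det_le_of_abs_le {n : ℕ} {M : Matrix (Fin n) (Fin n) ℝ} {B : ℝ} {r c : Fin n → ℝ}
    (hB : 0 ≤ B) (hr : ∀ i, 0 ≤ r i) (hc : ∀ j, 0 < c j) (h : ∀ i j, |M i j| ≤ B * r i * c j) :
    |M.det| ≤ (B * √n) ^ n * ((∏ i, r i) * ∏ j, c j) := by
  set N : Matrix (Fin n) (Fin n) ℝ := Matrix.of fun i j => M i j / c j with hN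
  have hM : M = Matrix.of fun i j => c j * N i j := by
    ext i j
    simp [hN, mul_div_cancel₀ _ (hc j).ne']
  have hrow : ∀ i, ‖WithLp.toLp 2 (N i)‖ ≤ B * √n * r i := fun i => by
    rw [EuclideanSpace.norm_eq]
    refine Real.sqrt_le_iff.2 ⟨mul_nonneg (by positivity) (hr i), ?_⟩
    calc ∑ j, ‖N i j‖ ^ 2 ≤ ∑ _j : Fin n, (B * r i) ^ 2 := by
          refine Finset.sum_le_sum fun j _ => ?_
          gcongr
          rw [Real.norm_eq_abs, hN, Matrix.of_apply, abs_div, abs_of_pos (hc j),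
            div_le_iff₀ (hc j)]
          exact h i j
      _ = _ := by
          simp only [Finset.sum_const, Finset.card_univ, Fintype.card_fin, nsmul_eq_mul, mul_pow]
          rw [Real.sq_sqrt (by positivity)]
          ring
  rw [hM, Matrix.det_mul_row, abs_mul, Finset.abs_prod]
  have h1 : |N.det| ≤ ∏ i, B * √n * r i :=
    (abs_det_le_prod_norm_row N).trans
      (Finset.prod_le_prod (fun _ _ => norm_nonneg _) fun i _ => hrow i)
  rw [Finset.prod_mul_distrib] at h1
  simp only [Finset.prod_const, Finset.card_univ, Fintype.card_fin] at h1
  have h2 : ∏ j, |c j| = ∏ j, c j := Finset.prod_congr rfl fun j _ => abs_of_pos (hc j)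
  rw [h2, mul_comm]
  calc _ ≤ ((B * √n) ^ n * ∏ i, r i) * ∏ j, c j :=
        mul_le_mul_of_nonneg_right h1 (Finset.prod_nonneg fun j _ => (hc j).le)
    _ = _ := by ring

theorem hasDerivAt_det {n : ℕ} {M : ℝ → Matrix (Fin n) (Fin n) ℝ} {M' : Matrix (Fin n) (Fin n) ℝ}
    {s : ℝ} (h : ∀ i j, HasDerivAt (fun s => M s i j) (M' i j) s) :
    HasDerivAt (fun s => (M s).det) (∑ i, ((M s).updateRow i (M' i)).det) s := by
  let f : ContinuousMultilinearMap ℝ (fun _ : Fin n => Fin n → ℝ) ℝ :=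
    { (Matrix.detRowAlternating (R := ℝ) (n := Fin n)).toMultilinearMap with
      cont := Continuous.matrix_det (A := fun M : Fin n → Fin n → ℝ => Matrix.of M)
        continuous_id }
  have h1 : HasDerivAt (fun s => (fun i j => M s i j : Fin n → Fin n → ℝ)) (fun i j => M' i j) s :=
    hasDerivAt_pi.2 fun i => hasDerivAt_pi.2 fun j => h i j
  refine ((f.hasFDerivAt (x := fun i j => M s i j)).comp_hasDerivAt s h1).congr_deriv ?_
  rw [ContinuousMultilinearMap.linearDeriv_apply]
  rfl

/-- The bordered Fredholm matrix: the matrix `k(tᵢ, tⱼ)` with the row `a(x), a(t₁), …` on top and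
the column `a(x), k(t₁, x), …` on the left. -/
def borderedMatrix (k : ℝ → ℝ → ℝ) (a : ℝ → ℝ) {n : ℕ} (x : ℝ) (t : Fin n → ℝ) :
    Matrix (Fin (n + 1)) (Fin (n + 1)) ℝ :=
  Matrix.of fun i j => Fin.cases (a ((Fin.cons x t : Fin (n + 1) → ℝ) j))
    (fun i => k (t i) ((Fin.cons x t : Fin (n + 1) → ℝ) j)) i

/-- The matrix `k(tᵢ, tⱼ)` of the Fredholm series. -/
def fredholmMatrix (k : ℝ → ℝ → ℝ) {n : ℕ} (t : Fin n → ℝ) : Matrix (Fin n) (Fin n) ℝ :=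
  Matrix.of fun i j => k (t i) (t j)

/-- Moving row and column `i` of the Fredholm matrix, with its row `i` replaced, to the front gives
the bordered matrix in the remaining variables. -/
theorem det_updateRow_fredholmMatrix (k : ℝ → ℝ → ℝ) (a : ℝ → ℝ) {n : ℕ} (i : Fin (n + 1))
    (y : ℝ) (τ : Fin n → ℝ) :
    ((fredholmMatrix k (i.insertNth y τ : Fin (n + 1) → ℝ)).updateRow i
      fun j => a ((i.insertNth y τ : Fin (n + 1) → ℝ) j)).det = (borderedMatrix k a y τ).det := by
  rw [← Matrix.det_submatrix_equiv_self i.cycleRange.symm]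
  congr 1
  ext p q
  have hz : ∀ q, (i.insertNth y τ : Fin (n + 1) → ℝ) (i.cycleRange.symm q)
      = (Fin.cons y τ : Fin (n + 1) → ℝ) q :=
    fun q => congrFun (Fin.insertNth_comp_cycleRange_symm i y τ) q
  rw [Matrix.submatrix_apply]
  refine Fin.cases ?_ (fun p => ?_) p
  · rw [Fin.cycleRange_symm_zero, Matrix.updateRow_self, hz]
    rfl
  · rw [Matrix.updateRow_ne (by rw [Fin.cycleRange_symm_succ]; exact Fin.succAbove_ne i p)]
    simp only [fredholmMatrix, borderedMatrix, Matrix.of_apply, hz, Fin.cons_succ, Fin.cases_succ]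

/-- Expansion of the bordered determinant along its first column. -/
theorem det_borderedMatrix (k : ℝ → ℝ → ℝ) (a : ℝ → ℝ) {n : ℕ} (x : ℝ) (t : Fin n → ℝ) :
    (borderedMatrix k a x t).det = a x * (fredholmMatrix k t).det
      - ∑ i, k (t i) x * ((fredholmMatrix k t).updateRow i fun j => a (t j)).det := by
  rw [Matrix.det_succ_column_zero, Fin.sum_univ_succ, sub_eq_add_neg, ← Finset.sum_neg_distrib]
  congr 1
  · have : (borderedMatrix k a x t).submatrix (Fin.succAbove 0) Fin.succ = fredholmMatrix k t := by
      ext p q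
      simp [borderedMatrix, fredholmMatrix]
    rw [this]
    simp [borderedMatrix]
  · refine Finset.sum_congr rfl fun i _ => ?_
    obtain ⟨m, rfl⟩ : ∃ m, n = m + 1 := ⟨n - 1, by have := i.2; omega⟩
    have : (borderedMatrix k a x t).submatrix i.succ.succAbove Fin.succ
        = ((fredholmMatrix k t).updateRow i fun j => a (t j)).submatrix i.cycleRange.symm id := by
      ext p q
      rw [Matrix.submatrix_apply, Matrix.submatrix_apply]
      refine Fin.cases ?_ (fun p => ?_) p
      · rw [Fin.cycleRange_symm_zero, Matrix.updateRow_self]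
        simp [borderedMatrix]
      · rw [Matrix.updateRow_ne (by rw [Fin.cycleRange_symm_succ]; exact Fin.succAbove_ne i p),
          Fin.cycleRange_symm_succ, Fin.succ_succAbove_succ]
        simp [borderedMatrix, fredholmMatrix]
    rw [this, Matrix.det_permute, Equiv.Perm.sign_symm, Fin.sign_cycleRange]
    have h1 : borderedMatrix k a x t i.succ 0 = k (t i) x := by simp [borderedMatrix]
    rw [h1, Fin.val_succ, pow_succ]
    have h2 : ((-1 : ℝ) ^ (i : ℕ)) * (-1) ^ (i : ℕ) = 1 := by
      rw [← mul_pow]; simp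
    push_cast
    linear_combination (-(k (t i) x)) *
      (((fredholmMatrix k t).updateRow i fun j => a (t j)).det) * h2

/-! ### Terms of the Fredholm series -/

/-- The product measure on `(0, ∞)ⁿ`. -/
abbrev rayPi (n : ℕ) : Measure (Fin n → ℝ) := Measure.pi fun _ => volume.restrict (Ioi 0)

/-- The integral in the `n`-th term of the Fredholm series on `(0, ∞)`. -/
def fredholmTerm (k : ℝ → ℝ → ℝ) (n : ℕ) : ℝ := ∫ t, (fredholmMatrix k t).det ∂(rayPi n)

/-- The integral in the `n`-th term of the bordered Fredholm series on `(0, ∞)`. -/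
def fredholmMinor (k : ℝ → ℝ → ℝ) (a : ℝ → ℝ) (n : ℕ) (x : ℝ) : ℝ :=
  ∫ t, (borderedMatrix k a x t).det ∂(rayPi n)

/-- The weight `∏ exp(-2 tᵢ)`. -/
def expWeight {n : ℕ} (t : Fin n → ℝ) : ℝ := (∏ i, Real.exp (-t i)) * ∏ i, Real.exp (-t i)

theorem expWeight_eq {n : ℕ} (t : Fin n → ℝ) : expWeight t = ∏ i, Real.exp (-2 * t i) := by
  rw [expWeight, ← Finset.prod_mul_distrib]
  refine Finset.prod_congr rfl fun i _ => ?_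
  rw [← Real.exp_add]
  ring_nf

theorem integrable_expWeight (n : ℕ) : Integrable (fun t : Fin n → ℝ => expWeight t) (rayPi n) := by
  simp_rw [expWeight_eq]
  exact Integrable.fintype_prod fun _ => exp_neg_integrableOn_Ioi 0 (by norm_num)

theorem integral_expWeight_le_one (n : ℕ) : ∫ t : Fin n → ℝ, expWeight t ∂(rayPi n) ≤ 1 := by
  simp_rw [expWeight_eq]
  rw [integral_fintype_prod_eq_pow (fun x : ℝ => Real.exp (-2 * x))]
  refine pow_le_one₀ (integral_nonneg fun _ => (Real.exp_pos _).le) ?_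
  have := integral_exp_mul_Ioi (a := -2) (by norm_num) 0
  rw [this]
  norm_num

theorem abs_integral_le_of_abs_le_expWeight {n : ℕ} {F : (Fin n → ℝ) → ℝ} {C : ℝ} (hC : 0 ≤ C)
    (h : ∀ t, |F t| ≤ C * expWeight t) : |∫ t, F t ∂(rayPi n)| ≤ C := by
  have h1 := norm_integral_le_of_norm_le ((integrable_expWeight n).const_mul C)
    (f := F) (.of_forall fun t => h t)
  rw [integral_const_mul] at h1
  exact h1.trans (mul_le_of_le_one_right hC (integral_expWeight_le_one n))

/-- A continuous kernel `k`, with the bound `B exp(-x - y)`. -/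
structure ExpKernel (k : ℝ → ℝ → ℝ) (B : ℝ) : Prop where
  continuous : Continuous (Function.uncurry k)
  nonneg : 0 ≤ B
  bound : ∀ x y, |k x y| ≤ B * Real.exp (-x) * Real.exp (-y)

/-- A continuous function `a`, with the bound `B exp(-x)`. -/
structure ExpFun (a : ℝ → ℝ) (B : ℝ) : Prop where
  continuous : Continuous a
  bound : ∀ x, |a x| ≤ B * Real.exp (-x)

section

variable {k : ℝ → ℝ → ℝ} {a : ℝ → ℝ} {B : ℝ}

theorem ExpKernel.continuous_det (hk : ExpKernel k B) (n : ℕ) :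
    Continuous fun t : Fin n → ℝ => (fredholmMatrix k t).det := by
  refine Continuous.matrix_det (continuous_matrix fun i j => ?_)
  exact hk.continuous.comp (by fun_prop : Continuous fun t : Fin n → ℝ => (t i, t j))

theorem ExpKernel.abs_det_le (hk : ExpKernel k B) {n : ℕ} (t : Fin n → ℝ) :
    |(fredholmMatrix k t).det| ≤ (B * √n) ^ n * expWeight t :=
  abs_det_le_of_abs_le hk.nonneg (fun _ => (Real.exp_pos _).le) (fun _ => Real.exp_pos _)
    fun i j => hk.bound (t i) (t j)

theorem ExpKernel.integrable_det (hk : ExpKernel k B) (n : ℕ) :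
    Integrable (fun t : Fin n → ℝ => (fredholmMatrix k t).det) (rayPi n) :=
  ((integrable_expWeight n).const_mul _).mono' (hk.continuous_det n).aestronglyMeasurable
    (.of_forall hk.abs_det_le)

theorem ExpKernel.abs_fredholmTerm_le (hk : ExpKernel k B) (n : ℕ) :
    |fredholmTerm k n| ≤ (B * √n) ^ n :=
  abs_integral_le_of_abs_le_expWeight (pow_nonneg (mul_nonneg hk.nonneg (Real.sqrt_nonneg _)) _)
    hk.abs_det_le

theorem ExpKernel.continuous_det_borderedMatrix (hk : ExpKernel k B) (ha : ExpFun a B) (n : ℕ) :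
    Continuous fun p : ℝ × (Fin n → ℝ) => (borderedMatrix k a p.1 p.2).det := by
  have hz : ∀ j : Fin (n + 1), Continuous fun p : ℝ × (Fin n → ℝ) =>
      (Fin.cons p.1 p.2 : Fin (n + 1) → ℝ) j := fun j => by
    refine Fin.cases ?_ (fun j => ?_) j
    · simpa using continuous_fst
    · simp only [Fin.cons_succ]
      fun_prop
  refine Continuous.matrix_det (continuous_matrix fun i j => ?_)
  refine Fin.cases ?_ (fun i => ?_) i
  · exact ha.continuous.comp (hz j)
  · exact hk.continuous.comp
      ((by fun_prop : Continuous fun p : ℝ × (Fin n → ℝ) => p.2 i).prodMk (hz j))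

theorem ExpKernel.abs_det_borderedMatrix_le (hk : ExpKernel k B) (ha : ExpFun a B) {n : ℕ} (x : ℝ)
    (t : Fin n → ℝ) : |(borderedMatrix k a x t).det|
      ≤ (B * √(n + 1)) ^ (n + 1) * Real.exp (-x) * expWeight t := by
  have := abs_det_le_of_abs_le (M := borderedMatrix k a x t) (B := B)
    (r := Fin.cons 1 fun i => Real.exp (-t i))
    (c := fun j => Real.exp (-(Fin.cons x t : Fin (n + 1) → ℝ) j)) hk.nonneg
    (fun i => by
      refine Fin.cases ?_ (fun i => ?_) i
      · simp
      · simpa using (Real.exp_pos _).le)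
    (fun j => Real.exp_pos _)
    (fun i j => by
      refine Fin.cases ?_ (fun i => ?_) i
      · simpa [borderedMatrix] using ha.bound _
      · simpa [borderedMatrix] using hk.bound _ _)
  refine this.trans (le_of_eq ?_)
  rw [Fin.prod_univ_succ, Fin.prod_univ_succ]
  simp only [Fin.cons_zero, Fin.cons_succ, expWeight]
  push_cast
  ring

theorem ExpKernel.abs_fredholmMinor_le (hk : ExpKernel k B) (ha : ExpFun a B) (n : ℕ) (x : ℝ) :
    |fredholmMinor k a n x| ≤ (B * √(n + 1)) ^ (n + 1) * Real.exp (-x) :=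
  abs_integral_le_of_abs_le_expWeight
    (mul_nonneg (pow_nonneg (mul_nonneg hk.nonneg (Real.sqrt_nonneg _)) _) (Real.exp_pos _).le)
    (hk.abs_det_borderedMatrix_le ha x)

theorem ExpKernel.stronglyMeasurable_fredholmMinor (hk : ExpKernel k B) (ha : ExpFun a B) (n : ℕ) :
    StronglyMeasurable (fredholmMinor k a n) :=
  (hk.continuous_det_borderedMatrix ha n).stronglyMeasurable.integral_prod_right'

theorem ExpKernel.integrable_mul_det_updateRow (hk : ExpKernel k B) (ha : ExpFun a B)
    {f : ℝ → ℝ} {C : ℝ} (hf : ExpFun f C) {n : ℕ} (i : Fin n) :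
    Integrable (fun t : Fin n → ℝ =>
      f (t i) * ((fredholmMatrix k t).updateRow i fun j => a (t j)).det) (rayPi n) := by
  have hcont : Continuous fun t : Fin n → ℝ =>
      ((fredholmMatrix k t).updateRow i fun j => a (t j)).det := by
    refine Continuous.matrix_det (Continuous.matrix_updateRow i (continuous_matrix fun i j => ?_)
      (continuous_pi fun j => ha.continuous.comp (continuous_apply j)))
    exact hk.continuous.comp (by fun_prop : Continuous fun t : Fin n → ℝ => (t i, t j))
  refine ((integrable_expWeight n).const_mul (C * (B * √n) ^ n)).mono'
    ((hf.continuous.comp (continuous_apply i)).mul hcont).aestronglyMeasurable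
    (.of_forall fun t => ?_)
  have h1 := abs_det_le_of_abs_le (M := (fredholmMatrix k t).updateRow i fun j => a (t j)) (B := B)
    (r := fun p => if p = i then 1 else Real.exp (-t p)) (c := fun j => Real.exp (-t j)) hk.nonneg
    (fun p => by positivity) (fun j => Real.exp_pos _)
    (fun p q => by
      rcases eq_or_ne p i with rfl | hp
      · simpa using ha.bound _
      · simpa [hp, fredholmMatrix] using hk.bound _ _)
  have h2 : Real.exp (-t i) * ∏ p, (if p = i then 1 else Real.exp (-t p))
      = ∏ p, Real.exp (-t p) := by
    rw [← Finset.mul_prod_erase _ _ (Finset.mem_univ i),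
      ← Finset.mul_prod_erase _ (fun p => Real.exp (-t p)) (Finset.mem_univ i)]
    simp only [if_true, one_mul]
    congr 1
    exact Finset.prod_congr rfl fun p hp => if_neg (Finset.ne_of_mem_erase hp)
  rw [Real.norm_eq_abs, abs_mul]
  refine (mul_le_mul (hf.bound _) h1 (abs_nonneg _) ((abs_nonneg _).trans (hf.bound _))).trans
    (le_of_eq ?_)
  rw [expWeight]
  linear_combination (C * (B * √n) ^ n * ∏ j, Real.exp (-t j)) * h2

/-- Integration of the first-row minors: by symmetry, each of them contributes the same. -/
theorem ExpKernel.integral_mul_det_updateRow (hk : ExpKernel k B) (ha : ExpFun a B)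
    {f : ℝ → ℝ} {C : ℝ} (hf : ExpFun f C) {n : ℕ} (i : Fin (n + 1)) :
    ∫ t, f (t i) * ((fredholmMatrix k t).updateRow i fun j => a (t j)).det ∂(rayPi (n + 1))
      = ∫ y in Ioi (0 : ℝ), f y * fredholmMinor k a n y := by
  have hmp := (measurePreserving_piFinSuccAbove
    (fun _ : Fin (n + 1) => volume.restrict (Ioi (0 : ℝ))) i).symm
  have hi := hk.integrable_mul_det_updateRow ha hf i
  rw [← hmp.integrable_comp_emb (MeasurableEquiv.measurableEmbedding _)] at hi
  rw [← hmp.integral_comp']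
  refine (integral_prod _ hi).trans (integral_congr_ae (.of_forall fun y => ?_))
  simp only [fredholmMinor, Function.comp]
  rw [← integral_const_mul]
  refine integral_congr_ae (.of_forall fun τ => ?_)
  have he : (MeasurableEquiv.piFinSuccAbove (fun _ : Fin (n + 1) => ℝ) i).symm (y, τ)
      = (i.insertNth y τ : Fin (n + 1) → ℝ) := rfl
  simp only [he, Fin.insertNth_apply_same]
  rw [det_updateRow_fredholmMatrix]

theorem ExpKernel.fredholmMinor_zero (x : ℝ) :
    fredholmMinor k a 0 x = a x * fredholmTerm k 0 := by
  simp_rw [fredholmMinor, fredholmTerm, det_borderedMatrix]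
  simp [fredholmMatrix, mul_comm]

/-- The recursion of the bordered determinants, an integrated form of `det_borderedMatrix`. -/
theorem ExpKernel.fredholmMinor_succ (hk : ExpKernel k B) (ha : ExpFun a B) (n : ℕ) (x : ℝ) :
    fredholmMinor k a (n + 1) x = a x * fredholmTerm k (n + 1)
      - (n + 1) * ∫ y in Ioi (0 : ℝ), k y x * fredholmMinor k a n y := by
  have hf : ExpFun (fun y => k y x) (B * Real.exp (-x)) :=
    ⟨hk.continuous.comp (by fun_prop : Continuous fun y : ℝ => (y, x)), fun y =>
      (hk.bound y x).trans (le_of_eq (by ring))⟩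
  rw [fredholmMinor, fredholmTerm]
  simp_rw [det_borderedMatrix]
  rw [integral_sub ((hk.integrable_det _).const_mul _)
    (integrable_finsetSum _ fun i _ => hk.integrable_mul_det_updateRow ha hf i),
    integral_const_mul, integral_finsetSum _ fun i _ => hk.integrable_mul_det_updateRow ha hf i]
  simp_rw [hk.integral_mul_det_updateRow ha hf]
  simp

end

/-- The series of Hadamard's bounds for the terms of a Fredholm series converges. -/
theorem summable_hadamard {B : ℝ} (hB : 0 ≤ B) :
    Summable fun n : ℕ => (B * √n) ^ n / (n ! : ℝ) := by
  -- since `nⁿ ≤ eⁿ n!`, the terms are at most `(B √e)ⁿ / √(n!)`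
  have h1 := (Real.summable_pow_div_factorial ((2 * B) ^ 2 * Real.exp 1)).add
    (summable_geometric_of_lt_one (by norm_num : (0 : ℝ) ≤ 1 / 4) (by norm_num))
  refine Summable.of_nonneg_of_le (fun n => by positivity) (fun n => ?_) h1
  have hn : (n : ℝ) ^ n ≤ Real.exp n * n ! := by
    have := Real.pow_div_factorial_le_exp (n : ℝ) (by positivity) n
    rwa [div_le_iff₀ (by positivity)] at this
  have hf : (0 : ℝ) < n ! := by positivity
  have h4 : ((B * √n) ^ n / (n ! : ℝ)) ^ 2 ≤ (B ^ 2 * Real.exp 1) ^ n / (n ! : ℝ) := by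
    rw [div_pow, div_le_div_iff₀ (by positivity) hf]
    calc ((B * √n) ^ n) ^ 2 * (n ! : ℝ) = (B ^ 2) ^ n * (√n ^ 2) ^ n * n ! := by ring
      _ = (B ^ 2) ^ n * (n : ℝ) ^ n * n ! := by rw [Real.sq_sqrt (by positivity)]
      _ ≤ (B ^ 2) ^ n * (Real.exp n * n !) * n ! := by gcongr
      _ = _ := by
        rw [mul_pow, ← Real.exp_nat_mul, mul_one]
        ring
  set X := (B * √n) ^ n / (n ! : ℝ)
  have hX : 0 ≤ X := by positivity
  have h5 : X ≤ 4 ^ n * X ^ 2 + (1 / 4) ^ n := by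
    have h6 : (4 : ℝ) ^ n * (1 / 4) ^ n = 1 := by rw [← mul_pow]; norm_num
    have h7 : (0 : ℝ) < 4 ^ n := by positivity
    have h8 : (1 / 4 : ℝ) ^ n = 1 / 4 ^ n := by rw [div_pow, one_pow]
    rw [h8, ← sub_nonneg]
    have h9 : 4 ^ n * X ^ 2 + 1 / 4 ^ n - X
        = ((2 * 4 ^ n * X - 1) ^ 2 + 3) / (4 * 4 ^ n) := by
      field_simp
      ring
    rw [h9]
    positivity
  refine h5.trans (add_le_add_left ?_ _)
  calc 4 ^ n * X ^ 2 ≤ 4 ^ n * ((B ^ 2 * Real.exp 1) ^ n / (n ! : ℝ)) := by gcongr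
    _ = _ := by
      rw [mul_div_assoc', ← mul_pow]
      ring_nf

theorem summable_hadamard_succ {B : ℝ} (hB : 0 ≤ B) :
    Summable fun n : ℕ => (B * √(n + 1)) ^ (n + 1) / (n ! : ℝ) := by
  have h := (summable_nat_add_iff 1).2 (summable_hadamard (by positivity : 0 ≤ 2 * B))
  refine Summable.of_nonneg_of_le (fun n => by positivity) (fun n => ?_) h
  rw [Nat.factorial_succ, div_le_div_iff₀ (by positivity) (by positivity)]
  have h2 : ((n + 1 : ℕ) : ℝ) ≤ 2 ^ (n + 1) := by exact_mod_cast (Nat.lt_two_pow_self).le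
  push_cast at h2 ⊢
  calc (B * √(n + 1)) ^ (n + 1) * ((n + 1) * (n ! : ℝ))
      ≤ (B * √(n + 1)) ^ (n + 1) * (2 ^ (n + 1) * (n ! : ℝ)) := by gcongr
    _ = _ := by ring

/-! ### The derivative of the Fredholm determinant -/

/-- The Airy kernel, translated from `(s, ∞)` to `(0, ∞)`. -/
def shiftKernel (lam s x y : ℝ) : ℝ := airyKernel lam (s + x) (s + y)

/-- The function `A`, translated from `(s, ∞)` to `(0, ∞)`. -/
def shiftFun (lam s x : ℝ) : ℝ := airyD lam 0 (s + x)

theorem shiftKernel_eq_inner (lam s x y : ℝ) : shiftKernel lam s x y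
    = inner ℝ (airyVec lam 0 (s + x)) (airyVec lam 0 (s + y)) :=
  (inner_airyVec_airyVec lam _ _).symm

theorem continuous_shiftKernel (lam s : ℝ) : Continuous (Function.uncurry (shiftKernel lam s)) := by
  have h : Function.uncurry (shiftKernel lam s) = fun p : ℝ × ℝ =>
      inner ℝ (airyVec lam 0 (s + p.1)) (airyVec lam 0 (s + p.2)) :=
    funext fun p => shiftKernel_eq_inner lam s p.1 p.2
  rw [h]
  exact ((continuous_airyVec lam 0).comp (by fun_prop)).inner
    ((continuous_airyVec lam 0).comp (by fun_prop))

theorem exists_expKernel_shiftKernel (lam : ℝ) : ∃ C : ℝ, 0 < C ∧ ∀ s,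
    ExpKernel (shiftKernel lam s) (C * Real.exp (-2 * s)) ∧
    ExpKernel (fun x y => shiftFun lam s x * shiftFun lam s y) (C * Real.exp (-2 * s)) ∧
    ExpFun (shiftFun lam s) (C * Real.exp (-s)) := by
  obtain ⟨C₁, p₁, h₁⟩ := exists_abs_airyD_le lam 0
  obtain ⟨C₂, p₂, h₂⟩ := exists_norm_airyVec_le lam 0
  have hexp : ∀ s x y : ℝ, Real.exp (-(s + x)) * Real.exp (-(s + y))
      = Real.exp (-2 * s) * Real.exp (-x) * Real.exp (-y) := fun s x y => by
    rw [← Real.exp_add, ← Real.exp_add, ← Real.exp_add]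
    ring_nf
  have hcont : ∀ s, Continuous (shiftFun lam s) := fun s =>
    (continuous_airyD lam 0).comp (by fun_prop)
  refine ⟨C₁ ^ 2 + C₂ ^ 2 + C₁, by positivity, fun s => ⟨⟨continuous_shiftKernel lam s,
    by positivity, fun x y => ?_⟩, ⟨?_, by positivity, fun x y => ?_⟩, ⟨hcont s, fun x => ?_⟩⟩⟩
  · rw [shiftKernel_eq_inner]
    calc _ ≤ ‖airyVec lam 0 (s + x)‖ * ‖airyVec lam 0 (s + y)‖ := abs_real_inner_le_norm _ _
      _ ≤ (C₂ * Real.exp (-(s + x))) * (C₂ * Real.exp (-(s + y))) :=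
        mul_le_mul (h₂ _) (h₂ _) (norm_nonneg _) (by positivity)
      _ = C₂ ^ 2 * (Real.exp (-2 * s) * Real.exp (-x) * Real.exp (-y)) := by rw [← hexp]; ring
      _ ≤ (C₁ ^ 2 + C₂ ^ 2 + C₁) * (Real.exp (-2 * s) * Real.exp (-x) * Real.exp (-y)) :=
        mul_le_mul_of_nonneg_right (by nlinarith) (by positivity)
      _ = _ := by ring
  · exact ((hcont s).comp continuous_fst).mul ((hcont s).comp continuous_snd)
  · rw [abs_mul]
    calc _ ≤ (C₁ * Real.exp (-(s + x))) * (C₁ * Real.exp (-(s + y))) :=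
        mul_le_mul (h₁ _) (h₁ _) (abs_nonneg _) (by positivity)
      _ = C₁ ^ 2 * (Real.exp (-2 * s) * Real.exp (-x) * Real.exp (-y)) := by rw [← hexp]; ring
      _ ≤ (C₁ ^ 2 + C₂ ^ 2 + C₁) * (Real.exp (-2 * s) * Real.exp (-x) * Real.exp (-y)) :=
        mul_le_mul_of_nonneg_right (by nlinarith) (by positivity)
      _ = _ := by ring
  · calc _ ≤ C₁ * Real.exp (-(s + x)) := h₁ _
      _ = C₁ * (Real.exp (-s) * Real.exp (-x)) := by rw [← Real.exp_add]; ring_nf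
      _ ≤ (C₁ ^ 2 + C₂ ^ 2 + C₁) * (Real.exp (-s) * Real.exp (-x)) :=
        mul_le_mul_of_nonneg_right (by nlinarith) (by positivity)
      _ = _ := by ring

theorem ExpKernel.mono {k : ℝ → ℝ → ℝ} {B B' : ℝ} (h : ExpKernel k B) (hB : B ≤ B') :
    ExpKernel k B' :=
  ⟨h.continuous, h.nonneg.trans hB, fun x y => (h.bound x y).trans (by gcongr)⟩

theorem ExpFun.mono {a : ℝ → ℝ} {B B' : ℝ} (h : ExpFun a B) (hB : B ≤ B') : ExpFun a B' :=
  ⟨h.continuous, fun x => (h.bound x).trans (by gcongr)⟩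

theorem exists_expKernel_expFun (lam s : ℝ) : ∃ B : ℝ, 0 ≤ B ∧
    ExpKernel (shiftKernel lam s) B ∧ ExpFun (shiftFun lam s) B := by
  obtain ⟨C, hC, h⟩ := exists_expKernel_shiftKernel lam
  exact ⟨C * Real.exp (-2 * s) + C * Real.exp (-s), by positivity,
    (h s).1.mono (le_add_of_nonneg_right (by positivity)),
    (h s).2.2.mono (le_add_of_nonneg_left (by positivity))⟩

/-- The class in `L²(0, ∞)` of a bordered Fredholm term. -/
def fredholmVec (lam s : ℝ) (n : ℕ) : L2Ray 0 :=
  toL2Ray 0 (fredholmMinor (shiftKernel lam s) (shiftFun lam s) n)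

theorem memLp_fredholmMinor (lam s : ℝ) (n : ℕ) :
    MemLp (fredholmMinor (shiftKernel lam s) (shiftFun lam s) n) 2 (volume.restrict (Ioi 0)) := by
  obtain ⟨B, hB, hk, ha⟩ := exists_expKernel_expFun lam s
  exact memLp_of_abs_le_exp (hk.stronglyMeasurable_fredholmMinor ha n).aestronglyMeasurable
    fun x _ => hk.abs_fredholmMinor_le ha n x

theorem fredholmVec_zero (lam s : ℝ) :
    fredholmVec lam s 0 = fredholmTerm (shiftKernel lam s) 0 • airyVec lam 0 s := by
  apply Lp.ext
  filter_upwards [toL2Ray_coeFn (memLp_fredholmMinor lam s 0), airyVec_coeFn lam 0 s,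
    Lp.coeFn_smul (fredholmTerm (shiftKernel lam s) 0) (airyVec lam 0 s)] with x h1 h2 h3
  rw [fredholmVec, h1, h3, Pi.smul_apply, h2, ExpKernel.fredholmMinor_zero, smul_eq_mul, mul_comm]
  rfl

theorem fredholmVec_succ (lam s : ℝ) (n : ℕ) :
    fredholmVec lam s (n + 1) = fredholmTerm (shiftKernel lam s) (n + 1) • airyVec lam 0 s
      - ((n : ℝ) + 1) • airyShiftOp lam s (fredholmVec lam s n) := by
  obtain ⟨B, hB, hk, ha⟩ := exists_expKernel_expFun lam s
  apply Lp.ext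
  filter_upwards [toL2Ray_coeFn (memLp_fredholmMinor lam s (n + 1)), airyVec_coeFn lam 0 s,
    Lp.coeFn_sub (fredholmTerm (shiftKernel lam s) (n + 1) • airyVec lam 0 s)
      (((n : ℝ) + 1) • airyShiftOp lam s (fredholmVec lam s n)),
    Lp.coeFn_smul (fredholmTerm (shiftKernel lam s) (n + 1)) (airyVec lam 0 s),
    Lp.coeFn_smul ((n : ℝ) + 1) (airyShiftOp lam s (fredholmVec lam s n)),
    airyShiftOp_coeFn lam s (fredholmVec lam s n)] with x h1 h2 h3 h4 h5 h6
  rw [h3, Pi.sub_apply, h4, h5, Pi.smul_apply, Pi.smul_apply, h2, h6, fredholmVec, h1,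
    hk.fredholmMinor_succ ha, smul_eq_mul, smul_eq_mul, inner_airyHankel_airyVec]
  have : ∫ y in Ioi (0 : ℝ), shiftKernel lam s y x
        * fredholmMinor (shiftKernel lam s) (shiftFun lam s) n y
      = ∫ y in Ioi (0 : ℝ), airyKernel lam (s + x) (s + y)
        * toL2Ray 0 (fredholmMinor (shiftKernel lam s) (shiftFun lam s) n) y := by
    refine integral_congr_ae ?_
    filter_upwards [toL2Ray_coeFn (memLp_fredholmMinor lam s n)] with y hy
    rw [hy, shiftKernel, airyKernel_comm]
  rw [this, mul_comm (fredholmTerm _ _)]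
  rfl

/-- The Fredholm series on `(0, ∞)` of the translated Airy kernel. -/
def fredholmSeries (lam s : ℝ) : ℝ :=
  ∑' n : ℕ, (-1) ^ n / (n ! : ℝ) * fredholmTerm (shiftKernel lam s) n

theorem abs_neg_one_pow_div_factorial (n : ℕ) : |(-1 : ℝ) ^ n / (n ! : ℝ)| = 1 / (n ! : ℝ) := by
  rw [abs_div, abs_pow, abs_neg, abs_one, one_pow, Nat.abs_cast]

theorem summable_fredholmSeries (lam s : ℝ) :
    Summable fun n : ℕ => (-1) ^ n / (n ! : ℝ) * fredholmTerm (shiftKernel lam s) n := by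
  obtain ⟨B, hB, hk, -⟩ := exists_expKernel_expFun lam s
  refine Summable.of_norm_bounded (summable_hadamard hB) fun n => ?_
  rw [Real.norm_eq_abs, abs_mul, abs_neg_one_pow_div_factorial, one_div_mul_eq_div]
  exact div_le_div_of_nonneg_right (hk.abs_fredholmTerm_le n) (by positivity)

theorem summable_fredholmVec (lam s : ℝ) :
    Summable fun n : ℕ => ((-1) ^ n / (n ! : ℝ)) • fredholmVec lam s n := by
  obtain ⟨B, hB, hk, ha⟩ := exists_expKernel_expFun lam s
  refine Summable.of_norm_bounded (summable_hadamard_succ hB) fun n => ?_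
  rw [norm_smul, Real.norm_eq_abs, abs_neg_one_pow_div_factorial, one_div_mul_eq_div]
  refine div_le_div_of_nonneg_right ?_ (by positivity)
  exact norm_toL2Ray_le (by positivity)
    (hk.stronglyMeasurable_fredholmMinor ha n).aestronglyMeasurable
    fun x _ => hk.abs_fredholmMinor_le ha n x

theorem neg_one_pow_div_factorial_succ (n : ℕ) :
    (-1 : ℝ) ^ (n + 1) / ((n + 1)! : ℝ) * (n + 1) = -((-1) ^ n / (n ! : ℝ)) := by
  rw [Nat.factorial_succ]
  push_cast
  field_simp
  ring

/-- **Fredholm's formula** for the solution of `f - K f = A`: the bordered series is the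
determinant times the solution. -/
theorem tsum_fredholmVec {lam s : ℝ} (h : IsUnit (1 - airyShiftOp lam s)) :
    ∑' n : ℕ, ((-1) ^ n / (n ! : ℝ)) • fredholmVec lam s n
      = fredholmSeries lam s • airyQvec lam s := by
  set c : ℕ → ℝ := fun n => (-1) ^ n / (n ! : ℝ) with hc
  set S := ∑' n : ℕ, c n • fredholmVec lam s n with hS
  have h1 : HasSum (fun n => c n • fredholmVec lam s n) S := (summable_fredholmVec lam s).hasSum
  have h2 : HasSum (fun n => c n • airyShiftOp lam s (fredholmVec lam s n))
      (airyShiftOp lam s S) := by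
    simpa using (airyShiftOp lam s).hasSum h1
  have h3 : HasSum (fun n => (c n * fredholmTerm (shiftKernel lam s) n) • airyVec lam 0 s)
      (fredholmSeries lam s • airyVec lam 0 s) :=
    (summable_fredholmSeries lam s).hasSum.smul_const _
  have h4 := (hasSum_nat_add_iff' 1).2 h1
  have h5 := ((hasSum_nat_add_iff' 1).2 h3).add h2
  have h6 : (fun n => (c (n + 1) * fredholmTerm (shiftKernel lam s) (n + 1)) • airyVec lam 0 s
      + c n • airyShiftOp lam s (fredholmVec lam s n))
      = fun n => c (n + 1) • fredholmVec lam s (n + 1) := by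
    ext1 n
    have := neg_one_pow_div_factorial_succ n
    rw [fredholmVec_succ, smul_sub, smul_smul, smul_smul, hc]
    simp only
    rw [this, neg_smul, sub_neg_eq_add]
  rw [h6] at h5
  have h7 := h4.unique h5
  simp only [Finset.sum_range_one, fredholmVec_zero, smul_smul] at h7
  have h8 : S - airyShiftOp lam s S = fredholmSeries lam s • airyVec lam 0 s := by
    rw [sub_eq_iff_eq_add, ← sub_left_inj, h7]
    abel
  rw [airyQvec, ← map_smul, ← h8, airyRes_left h]

/-- In the endpoint, the translated Airy kernel has a derivative of rank one. -/
theorem hasDerivAt_shiftKernel (lam s x y : ℝ) :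
    HasDerivAt (fun s => shiftKernel lam s x y) (-(shiftFun lam s x * shiftFun lam s y)) s := by
  have hv : ∀ x n, HasDerivAt (fun s => airyVec lam n (s + x)) (airyVec lam (n + 1) (s + x)) s :=
    fun x n => (hasDerivAt_airyVec lam n (s + x)).comp_add_const s x
  simp_rw [shiftKernel_eq_inner]
  refine ((hv x 0).inner ℝ (hv y 0)).congr_deriv ?_
  have hshift : ∀ m t z, HasDerivAt (fun z => airyD lam m (t + z)) (airyD lam (m + 1) (t + z)) z :=
    fun m t z => (hasDerivAt_airyD lam m (t + z)).comp_const_add t z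
  rw [airyVec, airyVec, airyVec, airyVec,
    inner_toL2Ray_toL2Ray (memLp_airyD lam 0 _) (memLp_airyD lam _ _),
    inner_toL2Ray_toL2Ray (memLp_airyD lam _ _) (memLp_airyD lam 0 _),
    ← integral_add (L2Ray.integrable_mul (memLp_airyD lam 0 _) (memLp_airyD lam _ _))
      (L2Ray.integrable_mul (memLp_airyD lam _ _) (memLp_airyD lam 0 _))]
  have hint : IntegrableOn (fun z => airyD lam 0 (s + x + z) * airyD lam (0 + 1) (s + y + z)
      + airyD lam (0 + 1) (s + x + z) * airyD lam 0 (s + y + z)) (Ioi 0) :=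
    (L2Ray.integrable_mul (memLp_airyD lam 0 _) (memLp_airyD lam _ _)).add
      (L2Ray.integrable_mul (memLp_airyD lam _ _) (memLp_airyD lam 0 _))
  have hlim : Tendsto (fun z => airyD lam 0 (s + x + z) * airyD lam 0 (s + y + z)) atTop (𝓝 0) := by
    have := (tendsto_airyD_add_atTop lam 0 (s + x)).mul (tendsto_airyD_add_atTop lam 0 (s + y))
    simpa using this
  refine (integral_Ioi_of_hasDerivAt_of_tendsto
    ((hshift 0 _ 0).mul (hshift 0 _ 0)).continuousAt.continuousWithinAt
    (fun z _ => ((hshift 0 _ z).mul (hshift 0 _ z)).congr_deriv (add_comm _ _)) hint hlim).trans ?_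
  simp [shiftFun]

/-- The integrand of the derivative of a Fredholm term in the endpoint. -/
def fredholmDerivIntegrand (lam s : ℝ) {n : ℕ} (t : Fin n → ℝ) : ℝ :=
  ∑ i, ((fredholmMatrix (shiftKernel lam s) t).updateRow i
    fun j => -(shiftFun lam s (t i) * shiftFun lam s (t j))).det

theorem abs_fredholmDerivIntegrand_le {lam s B : ℝ} (hk : ExpKernel (shiftKernel lam s) B)
    (ha : ExpKernel (fun x y => shiftFun lam s x * shiftFun lam s y) B) {n : ℕ} (t : Fin n → ℝ) :
    |fredholmDerivIntegrand lam s t| ≤ n * (B * √n) ^ n * expWeight t := by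
  refine (Finset.abs_sum_le_sum_abs _ _).trans ?_
  have : ∀ i ∈ (Finset.univ : Finset (Fin n)),
      |((fredholmMatrix (shiftKernel lam s) t).updateRow i
        fun j => -(shiftFun lam s (t i) * shiftFun lam s (t j))).det|
        ≤ (B * √n) ^ n * expWeight t := fun i _ => by
    refine abs_det_le_of_abs_le hk.nonneg (fun _ => (Real.exp_pos _).le) (fun _ => Real.exp_pos _)
      fun p q => ?_
    rcases eq_or_ne p i with rfl | hp
    · simpa using ha.bound (t p) (t q)
    · simpa [hp, fredholmMatrix] using hk.bound (t p) (t q)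
  refine (Finset.sum_le_card_nsmul _ _ _ this).trans (le_of_eq ?_)
  simp [mul_assoc]

theorem fredholmDerivIntegrand_eq (lam s : ℝ) {n : ℕ} (t : Fin n → ℝ) :
    fredholmDerivIntegrand lam s t = -∑ i, shiftFun lam s (t i) *
      ((fredholmMatrix (shiftKernel lam s) t).updateRow i fun j => shiftFun lam s (t j)).det := by
  rw [← Finset.sum_neg_distrib]
  refine Finset.sum_congr rfl fun i _ => ?_
  rw [← neg_mul, ← Matrix.det_updateRow_smul]
  congr 2
  ext j
  simp

theorem integrable_fredholmDerivIntegrand (lam s : ℝ) (n : ℕ) :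
    Integrable (fun t : Fin n → ℝ => fredholmDerivIntegrand lam s t) (rayPi n) := by
  obtain ⟨B, hB, hk, ha⟩ := exists_expKernel_expFun lam s
  simp_rw [fredholmDerivIntegrand_eq]
  exact (integrable_finsetSum _ fun i _ => hk.integrable_mul_det_updateRow ha ha i).neg

theorem integral_fredholmDerivIntegrand_zero (lam s : ℝ) :
    ∫ t : Fin 0 → ℝ, fredholmDerivIntegrand lam s t ∂(rayPi 0) = 0 := by
  simp [fredholmDerivIntegrand]

theorem integral_fredholmDerivIntegrand_succ (lam s : ℝ) (n : ℕ) :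
    ∫ t : Fin (n + 1) → ℝ, fredholmDerivIntegrand lam s t ∂(rayPi (n + 1))
      = -((n + 1) * inner ℝ (airyVec lam 0 s) (fredholmVec lam s n)) := by
  obtain ⟨B, hB, hk, ha⟩ := exists_expKernel_expFun lam s
  simp_rw [fredholmDerivIntegrand_eq]
  rw [integral_neg, integral_finsetSum _ fun i _ => hk.integrable_mul_det_updateRow ha ha i]
  simp_rw [hk.integral_mul_det_updateRow ha ha]
  rw [airyVec, fredholmVec,
    inner_toL2Ray_toL2Ray (memLp_airyD lam 0 s) (memLp_fredholmMinor lam s n)]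
  simp [shiftFun]

theorem hasDerivAt_fredholmTerm (lam s : ℝ) (n : ℕ) :
    HasDerivAt (fun s => fredholmTerm (shiftKernel lam s) n)
      (∫ t : Fin n → ℝ, fredholmDerivIntegrand lam s t ∂(rayPi n)) s := by
  obtain ⟨C, hC, h⟩ := exists_expKernel_shiftKernel lam
  set B := C * Real.exp (-2 * (s - 1)) with hB
  have hle : ∀ x ∈ Ioi (s - 1), C * Real.exp (-2 * x) ≤ B := fun x hx => by
    have hx' : s - 1 < x := hx
    exact mul_le_mul_of_nonneg_left (Real.exp_le_exp.2 (by linarith)) hC.le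
  refine (hasDerivAt_integral_of_dominated_loc_of_deriv_le
    (F := fun s (t : Fin n → ℝ) => (fredholmMatrix (shiftKernel lam s) t).det)
    (F' := fun s (t : Fin n → ℝ) => fredholmDerivIntegrand lam s t)
    (bound := fun t => n * (B * √n) ^ n * expWeight t)
    (Ioi_mem_nhds (sub_one_lt s)) ?_ ?_ ?_ ?_ ?_ ?_).2
  · exact .of_forall fun x => ((h x).1.continuous_det n).aestronglyMeasurable
  · exact (h s).1.integrable_det n
  · exact (integrable_fredholmDerivIntegrand lam s n).aestronglyMeasurable
  · exact .of_forall fun t x hx => abs_fredholmDerivIntegrand_le ((h x).1.mono (hle x hx))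
      ((h x).2.1.mono (hle x hx)) t
  · exact (integrable_expWeight n).const_mul _
  · exact .of_forall fun t x _ => hasDerivAt_det fun i j => hasDerivAt_shiftKernel lam x (t i) (t j)

/-- The logarithmic derivative of the Fredholm determinant is `(A, (I - K)⁻¹ A) = R(s, s)`. -/
theorem hasDerivAt_fredholmSeries {lam s : ℝ} (h : IsUnit (1 - airyShiftOp lam s)) :
    HasDerivAt (fredholmSeries lam) (fredholmSeries lam s * scalarU lam s) s := by
  obtain ⟨C, hC, hb⟩ := exists_expKernel_shiftKernel lam
  set B := C * Real.exp (-2 * (s - 1)) with hB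
  have hB0 : 0 ≤ B := by positivity
  have hle : ∀ x ∈ Ioi (s - 1), C * Real.exp (-2 * x) ≤ B := fun x hx => by
    have hx' : s - 1 < x := hx
    exact mul_le_mul_of_nonneg_left (Real.exp_le_exp.2 (by linarith)) hC.le
  have hs : s ∈ Ioi (s - 1) := sub_one_lt s
  have hd := hasDerivAt_tsum_of_isPreconnected
    (g := fun n x => (-1) ^ n / (n ! : ℝ) * fredholmTerm (shiftKernel lam x) n)
    (g' := fun n x => (-1) ^ n / (n ! : ℝ) *
      ∫ t : Fin n → ℝ, fredholmDerivIntegrand lam x t ∂(rayPi n))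
    (summable_hadamard (by positivity : 0 ≤ 2 * B)) isOpen_Ioi isPreconnected_Ioi
    (fun n x _ => (hasDerivAt_fredholmTerm lam x n).const_mul _)
    (fun n x hx => by
      rw [Real.norm_eq_abs, abs_mul, abs_neg_one_pow_div_factorial, one_div_mul_eq_div]
      refine div_le_div_of_nonneg_right ?_ (by positivity)
      refine (abs_integral_le_of_abs_le_expWeight (by positivity) fun t =>
        abs_fredholmDerivIntegrand_le ((hb x).1.mono (hle x hx))
          ((hb x).2.1.mono (hle x hx)) t).trans ?_
      have h2 : (n : ℝ) ≤ 2 ^ n := by exact_mod_cast (Nat.lt_two_pow_self).le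
      calc (n : ℝ) * (B * √n) ^ n ≤ 2 ^ n * (B * √n) ^ n := by gcongr
        _ = _ := by ring) hs (summable_fredholmSeries lam s) hs
  refine hd.congr_deriv ?_
  have h1 : HasSum (fun n : ℕ => (-1) ^ n / (n ! : ℝ) *
      inner ℝ (airyVec lam 0 s) (fredholmVec lam s n))
      (fredholmSeries lam s * scalarU lam s) := by
    have h2 := (summable_fredholmVec lam s).hasSum
    rw [tsum_fredholmVec h] at h2
    simpa [real_inner_smul_right, scalarU] using (innerSL ℝ (airyVec lam 0 s)).hasSum h2
  refine HasSum.tsum_eq ?_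
  refine (hasSum_nat_add_iff' 1).1 ?_
  simp only [Finset.sum_range_one, integral_fredholmDerivIntegrand_zero, mul_zero, sub_zero]
  have he : ∀ n : ℕ, (-1) ^ (n + 1) / ((n + 1)! : ℝ) *
      ∫ t : Fin (n + 1) → ℝ, fredholmDerivIntegrand lam s t ∂(rayPi (n + 1))
      = (-1) ^ n / (n ! : ℝ) * inner ℝ (airyVec lam 0 s) (fredholmVec lam s n) := fun n => by
    rw [integral_fredholmDerivIntegrand_succ, ← neg_neg ((-1 : ℝ) ^ n / _),
      ← neg_one_pow_div_factorial_succ]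
    ring
  simp only [he]
  exact h1

theorem tendsto_fredholmSeries (lam : ℝ) : Tendsto (fredholmSeries lam) atTop (𝓝 1) := by
  obtain ⟨C, hC, h⟩ := exists_expKernel_shiftKernel lam
  have hsum : ∑' n : ℕ, (if n = 0 then (1 : ℝ) else 0) = 1 := by simp
  rw [← hsum]
  have hB : ∀ s : ℝ, 0 ≤ s → C * Real.exp (-2 * s) ≤ C := fun s hs =>
    mul_le_of_le_one_right hC.le (Real.exp_le_one_iff.2 (by linarith))
  refine tendsto_tsum_of_dominated_convergence (summable_hadamard hC.le) (fun n => ?_) ?_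
  · rcases eq_or_ne n 0 with rfl | hn
    · simp [fredholmTerm, Measure.real]
    · rw [if_neg hn]
      have h1 : Tendsto (fun s : ℝ => (C * Real.exp (-2 * s) * √n) ^ n) atTop (𝓝 0) := by
        have h2 : Tendsto (fun s : ℝ => Real.exp (-2 * s)) atTop (𝓝 0) :=
          Real.tendsto_exp_atBot.comp (tendsto_id.const_mul_atTop_of_neg (by norm_num))
        have h3 := ((h2.const_mul C).mul_const √n).pow n
        simpa [hn] using h3
      have h2 : Tendsto (fun s => fredholmTerm (shiftKernel lam s) n) atTop (𝓝 0) :=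
        squeeze_zero_norm (fun s => (h s).1.abs_fredholmTerm_le n) h1
      simpa using h2.const_mul ((-1) ^ n / (n ! : ℝ))
  · filter_upwards [eventually_ge_atTop 0] with s hs n
    rw [Real.norm_eq_abs, abs_mul, abs_neg_one_pow_div_factorial, one_div_mul_eq_div]
    exact div_le_div_of_nonneg_right (((h s).1.mono (hB s hs)).abs_fredholmTerm_le n)
      (by positivity)

theorem fredholmDet_airyKernel (lam s : ℝ) :
    fredholmDet s (airyKernel lam) = fredholmSeries lam s := by
  unfold fredholmDet fredholmSeries
  congr 1
  ext n
  congr 1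
  have hmp := measurePreserving_pi (fun _ : Fin n => volume.restrict (Ioi (0 : ℝ)))
    (fun _ : Fin n => volume.restrict (Ioi s)) fun _ => measurePreserving_shift s
  have hemb : MeasurableEmbedding fun (t : Fin n → ℝ) i => s + t i :=
    measurableEmbedding_addLeft fun _ : Fin n => s
  exact (hmp.integral_comp hemb _).symm

/-! ### The determinant as an exponential -/

theorem integrableOn_Ioi_of_abs_le_exp_atTop {F : ℝ → ℝ} {s C b : ℝ}
    (hF : ContinuousOn F (Ici s)) (hb : 0 < b)
    (h : ∀ᶠ x in atTop, |F x| ≤ C * Real.exp (-b * x)) : IntegrableOn F (Ioi s) := by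
  refine integrable_of_isBigO_exp_neg hb hF ?_
  refine IsBigO.of_bound C ?_
  filter_upwards [h] with x hx
  rwa [Real.norm_eq_abs, Real.norm_eq_abs, Real.abs_exp]

/-- The decay of `q` and `R`, and an integration by parts which uses `R' = -q²`. -/
theorem integrableOn_and_integral_sub_mul_scalarQ_sq {lam s : ℝ}
    (h : ∀ x, s ≤ x → IsUnit (1 - airyShiftOp lam x)) :
    IntegrableOn (scalarR lam) (Ioi s) ∧
      IntegrableOn (fun x => (x - s) * scalarQ lam x ^ 2) (Ioi s) ∧
      ∫ x in Ioi s, (x - s) * scalarQ lam x ^ 2 = ∫ x in Ioi s, scalarR lam x := by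
  obtain ⟨C, hC, hb⟩ := exists_abs_scalars_le_exp_neg lam
  have hrc : ContinuousOn (scalarR lam) (Ici s) := fun x hx =>
    (hasDerivAt_scalarR (h x hx)).continuousAt.continuousWithinAt
  have hqc : ContinuousOn (scalarQ lam) (Ici s) := fun x hx =>
    (hasDerivAt_scalarQ (h x hx)).continuousAt.continuousWithinAt
  have hr : IntegrableOn (scalarR lam) (Ioi s) :=
    integrableOn_Ioi_of_abs_le_exp_atTop hrc one_pos (C := C)
      (hb.mono fun x hx => by simpa using hx.2.2.2)
  -- `(x - s) exp(-x)` is bounded by a constant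
  have hx1 : ∀ᶠ x : ℝ in atTop, (x - s) * Real.exp (-x) ≤ 1 ∧ 0 ≤ x - s := by
    have h1 : Tendsto (fun x : ℝ => x ^ 1 * Real.exp (-x) - s * Real.exp (-x)) atTop
        (𝓝 (0 - s * 0)) :=
      (Real.tendsto_pow_mul_exp_neg_atTop_nhds_zero 1).sub
        (Real.tendsto_exp_neg_atTop_nhds_zero.const_mul s)
    filter_upwards [h1.eventually_le_const (by simp : 0 - s * 0 < 1), eventually_ge_atTop s]
      with x hx hxs
    exact ⟨by linarith [hx], sub_nonneg.2 hxs⟩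
  have hq : IntegrableOn (fun x => (x - s) * scalarQ lam x ^ 2) (Ioi s) := by
    refine integrableOn_Ioi_of_abs_le_exp_atTop (by fun_prop) one_pos (C := C ^ 2) ?_
    filter_upwards [hb, hx1] with x hx hx'
    have h2 : scalarQ lam x ^ 2 ≤ (C * Real.exp (-x)) ^ 2 := sq_le_sq' (by linarith [abs_le.1 hx.1])
      (abs_le.1 hx.1).2
    rw [abs_of_nonneg (mul_nonneg hx'.2 (sq_nonneg _))]
    calc (x - s) * scalarQ lam x ^ 2 ≤ (x - s) * (C * Real.exp (-x)) ^ 2 :=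
          mul_le_mul_of_nonneg_left h2 hx'.2
      _ = ((x - s) * Real.exp (-x)) * (C ^ 2 * Real.exp (-x)) := by ring
      _ ≤ 1 * (C ^ 2 * Real.exp (-x)) := mul_le_mul_of_nonneg_right hx'.1 (by positivity)
      _ = _ := by rw [one_mul, neg_one_mul]
  refine ⟨hr, hq, ?_⟩
  have hd : ∀ x ∈ Ioi s, HasDerivAt (fun x => (x - s) * scalarR lam x)
      (scalarR lam x - (x - s) * scalarQ lam x ^ 2) x := fun x hx => by
    refine (((hasDerivAt_id x).sub_const s).fun_mul
      (hasDerivAt_scalarR (h x (le_of_lt hx)))).congr_deriv ?_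
    simp only [id]
    ring
  have hlim : Tendsto (fun x => (x - s) * scalarR lam x) atTop (𝓝 0) := by
    have h1 : Tendsto (fun x : ℝ => C * (x ^ 1 * Real.exp (-x) - s * Real.exp (-x))) atTop
        (𝓝 (C * (0 - s * 0))) :=
      ((Real.tendsto_pow_mul_exp_neg_atTop_nhds_zero 1).sub
        (Real.tendsto_exp_neg_atTop_nhds_zero.const_mul s)).const_mul C
    rw [mul_zero, sub_zero, mul_zero] at h1
    refine squeeze_zero_norm' ?_ h1
    filter_upwards [hb, hx1] with x hx hx'
    rw [norm_mul, Real.norm_eq_abs, abs_of_nonneg hx'.2]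
    calc (x - s) * ‖scalarR lam x‖ ≤ (x - s) * (C * Real.exp (-x)) :=
          mul_le_mul_of_nonneg_left hx.2.2.2 hx'.2
      _ = _ := by ring
  have h0 := integral_Ioi_of_hasDerivAt_of_tendsto (a := s)
    ((by fun_prop : ContinuousOn (fun x => (x - s) * scalarR lam x) (Ici s)) s self_mem_Ici) hd
    (hr.sub hq) hlim
  rw [integral_sub hr hq, sub_self, zero_mul, sub_zero, sub_eq_zero] at h0
  exact h0.symm

/-- Both sides have the logarithmic derivative `R` and the limit `1` at infinity. -/
theorem fredholmSeries_eq_exp {lam s : ℝ} (h : ∀ x, s ≤ x → IsUnit (1 - airyShiftOp lam x)) :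
    fredholmSeries lam s = Real.exp (-∫ x in Ioi s, scalarR lam x) := by
  have hint := (integrableOn_and_integral_sub_mul_scalarQ_sq h).1
  have hrc : ContinuousOn (scalarR lam) (Ici s) := fun x hx =>
    (hasDerivAt_scalarR (h x hx)).continuousAt.continuousWithinAt
  set G : ℝ → ℝ := fun x => fredholmSeries lam x * Real.exp (-∫ y in s..x, scalarR lam y) with hG
  have hI : ∀ x, s ≤ x → HasDerivAt (fun x => ∫ y in s..x, scalarR lam y) (scalarR lam x) x := by
    intro x hx
    refine intervalIntegral.integral_hasDerivAt_right ?_ ?_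
      (hasDerivAt_scalarR (h x hx)).continuousAt
    · exact (hrc.mono (by rw [uIcc_of_le hx]; exact Icc_subset_Ici_self)).intervalIntegrable
    · exact ContinuousOn.stronglyMeasurableAtFilter (isOpen_isUnit_airyShiftOp lam)
        (fun y hy => (hasDerivAt_scalarR hy).continuousAt.continuousWithinAt) x (h x hx)
  have hd : ∀ x, s ≤ x → HasDerivAt G 0 x := fun x hx => by
    refine ((hasDerivAt_fredholmSeries (h x hx)).fun_mul (hI x hx).fun_neg.exp).congr_deriv ?_
    rw [← scalarR_eq_scalarU (h x hx)]
    ring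
  have hconst : ∀ x, s ≤ x → G x = G s := fun x hx =>
    constant_of_has_deriv_right_zero (a := s) (b := x)
      (fun y hy => (hd y hy.1).continuousAt.continuousWithinAt)
      (fun y hy => (hd y hy.1).hasDerivWithinAt) x ⟨hx, le_rfl⟩
  have hlim : Tendsto G atTop (𝓝 (1 * Real.exp (-∫ x in Ioi s, scalarR lam x))) :=
    (tendsto_fredholmSeries lam).mul ((Real.continuous_exp.tendsto _).comp
      (intervalIntegral_tendsto_integral_Ioi s hint tendsto_id).neg)
  have h1 : Tendsto G atTop (𝓝 (G s)) := tendsto_const_nhds.congr'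
    (by filter_upwards [eventually_ge_atTop s] with x hx; exact (hconst x hx).symm)
  have h2 := tendsto_nhds_unique h1 hlim
  simpa [hG] using h2

end

theorem mainTheorem2 (lam : ℝ) (hlam : 0 < lam) :
    -- where `I - K` is invertible
    (lam ≤ 1 → ∀ s : ℝ, IsUnit (1 - airyOp lam s)) ∧
    (∀ᶠ s in atTop, IsUnit (1 - airyOp lam s)) ∧
    -- the behaviour of `q` at infinity
    (airyQ lam ~[atTop] fun s => √lam * airyAi s) ∧
    ∀ s : ℝ, (∀ x : ℝ, s ≤ x → IsUnit (1 - airyOp lam x)) →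
      -- `R(x, y)` is the continuous kernel of `K (I - K)⁻¹`
      ContinuousOn (Function.uncurry (resolventKernel lam s)) (Ici s ×ˢ Ici s) ∧
      (∀ f : L2Ray s, airyOp lam s (airyResolvent lam s f) =ᵐ[volume.restrict (Ioi s)]
        fun x => ∫ y in Ioi s, resolventKernel lam s x y * f y) ∧
      -- the second Painlevé equation
      ContDiffAt ℝ 2 (airyQ lam) s ∧
      deriv (deriv (airyQ lam)) s = s * airyQ lam s + 2 * airyQ lam s ^ 3 ∧
      -- the relation of `R` and `q`
      HasDerivAt (airyR lam) (-(airyQ lam s) ^ 2) s ∧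
      -- the third-order equation for `R`
      ContDiffAt ℝ 3 (airyR lam) s ∧
      (deriv (airyR lam) s ≠ 0 →
        1 / 2 * deriv (fun x => deriv (deriv (airyR lam)) x / deriv (airyR lam) x) s
          - airyR lam s / deriv (airyR lam) s + deriv (airyR lam) s = 0) ∧
      -- the determinant
      IntegrableOn (fun x => (x - s) * airyQ lam x ^ 2) (Ioi s) ∧
      fredholmDet s (airyKernel lam)
        = Real.exp (-∫ x in Ioi s, (x - s) * airyQ lam x ^ 2) := by
  simp only [isUnit_one_sub_airyOp_iff]
  refine ⟨fun h1 s => isUnit_one_sub_airyShiftOp_of_le_one hlam.le h1 s,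
    (eventually_norm_airyShiftOp_le lam).mono fun s hs =>
      isUnit_one_sub_airyShiftOp_of_norm_le hs, ?_, fun s h => ?_⟩
  · refine (isEquivalent_scalarQ lam).congr_left ?_
    filter_upwards [eventually_norm_airyShiftOp_le lam] with s hs
    exact (airyQ_eq_scalarQ (isUnit_one_sub_airyShiftOp_of_norm_le hs)).symm
  have hs := h s le_rfl
  have hU := eventually_isUnit_one_sub_airyShiftOp hs
  have hq : airyQ lam =ᶠ[𝓝 s] scalarQ lam := hU.mono fun x hx => airyQ_eq_scalarQ hx
  have hr : airyR lam =ᶠ[𝓝 s] scalarR lam := hU.mono fun x hx => airyR_eq_scalarR hx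
  have hqI : EqOn (fun x => (x - s) * scalarQ lam x ^ 2)
      (fun x => (x - s) * airyQ lam x ^ 2) (Ioi s) :=
    fun x hx => by simp only [airyQ_eq_scalarQ (h x (le_of_lt hx))]
  obtain ⟨-, hint, hparts⟩ := integrableOn_and_integral_sub_mul_scalarQ_sq h
  refine ⟨(continuous_resolventKernel hs).continuousOn, airyOp_airyResolvent_coeFn hs,
    (contDiffAt_two_scalarQ hs).congr_of_eventuallyEq hq, ?_, ?_,
    (contDiffAt_three_scalarR hs).congr_of_eventuallyEq hr, ?_,
    hint.congr_fun hqI measurableSet_Ioi, ?_⟩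
  · rw [hq.deriv.deriv_eq, hq.self_of_nhds, deriv_deriv_scalarQ hs]
  · rw [hq.self_of_nhds]
    exact (hasDerivAt_scalarR hs).congr_of_eventuallyEq hr
  · have h2 : (fun x => deriv (deriv (airyR lam)) x / deriv (airyR lam) x)
        =ᶠ[𝓝 s] fun x => deriv (deriv (scalarR lam)) x / deriv (scalarR lam) x :=
      hr.deriv.deriv.div hr.deriv
    rw [h2.deriv_eq, hr.deriv_eq, hr.self_of_nhds]
    exact third_order_scalarR h
  · rw [fredholmDet_airyKernel, fredholmSeries_eq_exp h, ← hparts,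
      setIntegral_congr_fun measurableSet_Ioi hqI]
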